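/- Let $a,b,d$ be distinct positive integers, let $n=a+b+2d$, and put $$A=-2nx(a+d)+(a+d)(a+2d)+nx^2(n-d),\qquad B=a(a+d)-2anx-nx^2(d-n),$$ $$C=x^2(a+b)(n-d)-2ax(n-d)+a(a+d),\qquad D=nx^2(a+b)+a(a+2d)-2anx,$$ $$\pi_{a,b,d}(x)=\frac{a^a\,b^b\,A^{a+d}B^{b+d}D^{d}}{2^d\,d^{2d}\,n^n\,x^{a+2d}(1-x)^{b+2d}C^{n-d}}\in\mathbb Q(x).$$ For an algebraically closed field $\Omega$ of characteristic $0$ and $v\in\Omega\setminus\{0,1\}$, let $\mathcal H_v(\Omega)$ be the set of isomorphism classes of degree $n$ covers $F:Y\to\mathbb P^1_t$ by a connected smooth projective curve over $\Omega$ whose ramification partitions over $t=v,0,1,\infty$ are $2\,1^{n-2}$, $a\,b\,d^2$, $3\,1^{n-3}$, $n$ respectively, and which are unramified elsewhere. These sets, functorially in $\Omega$, are the geometric fibres of a finite étale cover of $\mathbb P^1_v\setminus\{0,1,\infty\}$; its completion is the Hurwitz–Belyi map, along the pencil $v\mapsto(\{v\},\{0\},\{1\},\{\infty\})$, of the Hurwitz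 parameter $$h(a,b,d)=\bigl(S_n,\ (2\,1^{n-2},\ a_0\,b_1\,d^2,\ 3_x\,1^{n-3},\ n_\infty),\ (1,1,1,1)\bigr).$$ The subscripts say that $Y$ is identified with $\mathbb P^1_y$ so that the point of ramification index $a$ over $t=0$ is $y=0$, the point of index $b$ over $t=0$ is $y=1$, and the point over $t=\infty$ is $y=\infty$; the coordinate $x$ of the cover is then the value of $y$ at the point of index $3$ over $t=1$. Then this Hurwitz–Belyi map is $\pi_{a,b,d}:\mathbb P^1_x\to\mathbb P^1_v$. Precisely: $\pi_{a,b,d}$ is a Belyi map (non-constant, with critical values in $\{0,1,\infty\}$); each cover in $\mathcal H_v(\Omega)$ admits the above normalization and has a unique coordinate $x$; and for all $\Omega$ and all $v\in\Omega\setminus\{0,1\}$ the coordinate gives a bijection $$\mathcal H_v(\Omega)\ \longrightarrow\ \{x\in\mathbb P^1(\Omega):\pi_{a,b,d}(x)=v\},$$ compatible with base change along all field embeddings $\Omega\to\Omega'$, in particular with Galois actions. If moreover $\gcd(a,b,d)=1$, the same holds with $\mathcal H_v(\Omega)$ restricted to the covers whose monodromy group is the full symmetric group $S_n$. -/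

import Mathlib

open Polynomial

universe u

/-- A connected smooth projective curve `Y` over the field `Ω` together with a finite morphism
`F : Y → ℙ¹_t`, presented by its function field: a finite field extension `K` of `Ω(t)`. -/
structure CurveCover (Ω : Type u) [Field Ω] where
  /-- the function field of `Y` -/
  K : Type u
  [instField : Field K]
  [instAlgebra : Algebra (RatFunc Ω) K]
  [instFinite : FiniteDimensional (RatFunc Ω) K]

attribute [instance] CurveCover.instField CurveCover.instAlgebra CurveCover.instFinite

namespace CurveCover

variable {Ω : Type u} [Field Ω]

/-- Constant functions on `Y`. -/
noncomputable def const (Y : CurveCover Ω) (c : Ω) : Y.K :=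
  algebraMap (RatFunc Ω) Y.K (RatFunc.C c)

/-- The covering map `F`, as the element `t` of the function field of `Y`. -/
noncomputable def covering (Y : CurveCover Ω) : Y.K :=
  algebraMap (RatFunc Ω) Y.K RatFunc.X

/-- The degree of `F : Y → ℙ¹_t`. -/
noncomputable def degree (Y : CurveCover Ω) : ℕ := Module.finrank (RatFunc Ω) Y.K

/-- A point of the curve `Y`: a nontrivial valuation ring of its function field which contains
the constants (the local ring of the point). -/
structure Point (Y : CurveCover Ω) where
  ring : ValuationSubring Y.K
  ne_top : ring ≠ ⊤
  const_mem : ∀ c : Ω, Y.const c ∈ ring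

/-- The function `f` takes the value `τ ∈ ℙ¹(Ω)` at the point `P`. -/
def Point.TakesValue {Y : CurveCover Ω} (P : Y.Point) (f : Y.K) (τ : OnePoint Ω) : Prop :=
  τ.elim (1 < P.ring.valuation f) (fun c => P.ring.valuation (f - Y.const c) < 1)

/-- `ϖ` generates the maximal ideal of the local ring of `P`. -/
def Point.IsUniformizer {Y : CurveCover Ω} (P : Y.Point) (ϖ : Y.K) : Prop :=
  ∀ f : Y.K, P.ring.valuation f < 1 ↔ P.ring.valuation f ≤ P.ring.valuation ϖ

/-- The pullback to `Y` of the standard local parameter of `ℙ¹_t` at `τ`: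
`t - τ` for finite `τ`, and `1 / t` for `τ = ∞`. -/
noncomputable def localParameter (Y : CurveCover Ω) (τ : OnePoint Ω) : Y.K :=
  τ.elim Y.covering⁻¹ (fun c => Y.covering - Y.const c)

/-- The point `P` of `Y` lies over `τ`, with ramification index `e`. -/
def Point.LiesOver {Y : CurveCover Ω} (P : Y.Point) (τ : OnePoint Ω) (e : ℕ) : Prop :=
  P.TakesValue Y.covering τ ∧
    ∃ ϖ : Y.K, P.IsUniformizer ϖ ∧
      P.ring.valuation (Y.localParameter τ) = P.ring.valuation ϖ ^ e

/-- The points of `Y` over `τ` are finite in number, and the multiset of their ramification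
indices is `M`. Over an algebraically closed field of characteristic zero, `M` is the cycle type
of the local monodromy of `F` at `τ`. -/
def HasRamification (Y : CurveCover Ω) (τ : OnePoint Ω) (M : Multiset ℕ) : Prop :=
  ∃ (S : Finset Y.Point) (e : Y.Point → ℕ),
    (∀ P : Y.Point, P ∈ S ↔ P.TakesValue Y.covering τ) ∧
    (∀ P ∈ S, P.LiesOver τ (e P)) ∧ S.val.map e = M

/-- The sheets of `F`: the points of the geometric generic fibre. -/
abbrev Sheets (Y : CurveCover Ω) : Type u :=
  Y.K →ₐ[RatFunc Ω] AlgebraicClosure (RatFunc Ω)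

/-- The monodromy representation of `F`: the absolute Galois group of `Ω(t)` permutes the
sheets. -/
noncomputable def monodromy (Y : CurveCover Ω) :
    (AlgebraicClosure (RatFunc Ω) ≃ₐ[RatFunc Ω] AlgebraicClosure (RatFunc Ω)) →*
      Equiv.Perm Y.Sheets where
  toFun g :=
    { toFun := fun φ => g.toAlgHom.comp φ
      invFun := fun φ => g.symm.toAlgHom.comp φ
      left_inv := fun φ => by ext z; simp
      right_inv := fun φ => by ext z; simp }
  map_one' := by ext φ z; simp
  map_mul' g g' := by ext φ z; simp

/-- The monodromy group of `F` is the full symmetric group on the sheets. -/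
def HasSymmetricMonodromy (Y : CurveCover Ω) : Prop := Y.monodromy.range = ⊤

/-- Isomorphic covers of `ℙ¹_t`. -/
def IsIsomorphic (Y Y' : CurveCover Ω) : Prop := Nonempty (Y.K ≃ₐ[RatFunc Ω] Y'.K)

/-- `Y'` is the base change of `Y` along the embedding `σ` of algebraically closed fields:
there is an embedding of function fields which is `σ` on constants and sends `t` to `t`, and the
degrees over `ℙ¹_t` agree. -/
def IsBaseChange {Ω' : Type u} [Field Ω'] (σ : Ω →+* Ω') (Y : CurveCover Ω)
    (Y' : CurveCover Ω') : Prop :=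
  Y.degree = Y'.degree ∧
    ∃ f : Y.K →+* Y'.K, (∀ c : Ω, f (Y.const c) = Y'.const (σ c)) ∧ f Y.covering = Y'.covering

end CurveCover

/-- The data `(S_n, (C₁, …, C_r), (1, …, 1))`, the conjugacy classes `C_i` of the symmetric group
`S_n` being given by the corresponding partitions of `n`. -/
structure HurwitzParameter (r : ℕ) where
  n : ℕ
  classes : Fin r → Multiset ℕ

/-- `Y` is a connected cover of degree `n` of `ℙ¹_t` with local monodromy in `C_i` at `p_i`,
and unramified away from the `p_i`. The global monodromy group is only required to be a
transitive subgroup of `S_n`. -/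
def HurwitzParameter.IsCoverOfType {r : ℕ} (h : HurwitzParameter r) {Ω : Type u} [Field Ω]
    (p : Fin r → OnePoint Ω) (Y : CurveCover Ω) : Prop :=
  Y.degree = h.n ∧ (∀ i, Y.HasRamification (p i) (h.classes i)) ∧
    ∀ τ : OnePoint Ω, (∀ i, τ ≠ p i) → Y.HasRamification τ (Multiset.replicate h.n 1)

/-- The Belyi pencil `({v}, {0}, {1}, {∞})`. -/
def basicPencil {Ω : Type u} [Field Ω] (v : Ω) : Fin 4 → OnePoint Ω :=
  ![(v : OnePoint Ω), ((0 : Ω) : OnePoint Ω), ((1 : Ω) : OnePoint Ω), OnePoint.infty]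

/-- A moduli problem of covers over the `v`-line: which covers belong to the parameter value
`v`. -/
abbrev CoverProblem : Type (u + 1) :=
  ∀ (Ω : Type u) [Field Ω], Ω → CurveCover Ω → Prop

/-- The moduli problem of connected covers with the branching data of `h` along the pencil
`({v}, {0}, {1}, {∞})`. -/
def HurwitzParameter.branchedCovers (h : HurwitzParameter 4) : CoverProblem.{u} :=
  fun _ _ v Y => h.IsCoverOfType (basicPencil v) Y

/-- The Hurwitz moduli problem of `h` along the pencil `({v}, {0}, {1}, {∞})`, the global
monodromy group being exactly `S_n`. -/
def HurwitzParameter.symmetricCovers (h : HurwitzParameter 4) : CoverProblem.{u} :=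
  fun _ _ v Y => h.IsCoverOfType (basicPencil v) Y ∧ Y.HasSymmetricMonodromy

/-- The point `x` of `ℙ¹(Ω)` lies in the fibre over the finite value `v` of the rational function
`π = N / M` (in lowest terms), seen as a map `ℙ¹ → ℙ¹`. -/
def InFibre {Ω : Type u} [Field Ω] [CharZero Ω] (π : RatFunc ℚ) (v : Ω) (x : OnePoint Ω) : Prop :=
  x.elim
    ((π.num.map (algebraMap ℚ Ω) - C v * π.denom.map (algebraMap ℚ Ω)).degree <
      max π.num.degree π.denom.degree)
    (fun c => aeval c π.num = v * aeval c π.denom)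

/-- The rational function `π = N / M` is a Belyi map `ℙ¹ → ℙ¹`: it is not constant, and no complex
`v ≠ 0, 1` is a critical value, that is, the binary form of degree `deg π` attached to `N - v M`
has no multiple root in `ℙ¹(ℂ)`. -/
def IsBelyiMap (π : RatFunc ℚ) : Prop :=
  0 < max π.num.natDegree π.denom.natDegree ∧
    ∀ v : ℂ, v ≠ 0 → v ≠ 1 →
      (π.num.map (algebraMap ℚ ℂ) - C v * π.denom.map (algebraMap ℚ ℂ)).Separable ∧
      max π.num.natDegree π.denom.natDegree ≤
        (π.num.map (algebraMap ℚ ℂ) - C v * π.denom.map (algebraMap ℚ ℂ)).natDegree + 1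

/-- `π : ℙ¹_x → ℙ¹_v` is the Belyi map attached to the moduli problem `T`, with respect to the
coordinate `x` on the moduli space (`x Ω Y c` says that the cover `Y` has coordinate `c`).
The moduli space is the finite étale cover of `ℙ¹_v - {0, 1, ∞}` whose fibre over a geometric
point `v` is the set of isomorphism classes of the covers `T Ω v`, functorially in the
algebraically closed field `Ω`. For `Ω` an algebraic closure of `ℂ(v)` with its Galois action this
determines the cover of complex curves and hence its completion; for `Ω = ℂ` it
describes the fibres over complex numbers. So `x` has to identify these fibres
with those of `π`, functorially. -/
structure IsHurwitzBelyiMap (T : CoverProblem.{u}) (π : RatFunc ℚ)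
    (x : ∀ (Ω : Type u) [Field Ω], CurveCover Ω → OnePoint Ω → Prop) : Prop where
  /-- `π` is a Belyi map -/
  belyi : IsBelyiMap π
  /-- every cover has exactly one coordinate -/
  existsUnique : ∀ (Ω : Type u) [Field Ω] [CharZero Ω] [IsAlgClosed Ω] (v : Ω), v ≠ 0 → v ≠ 1 →
    ∀ Y : CurveCover Ω, T Ω v Y → ∃! c : OnePoint Ω, x Ω Y c
  /-- the coordinate lies in the fibre of `π` over `v` -/
  inFibre : ∀ (Ω : Type u) [Field Ω] [CharZero Ω] [IsAlgClosed Ω] (v : Ω), v ≠ 0 → v ≠ 1 →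
    ∀ (Y : CurveCover Ω) (c : OnePoint Ω), T Ω v Y → x Ω Y c → InFibre π v c
  /-- covers with the same coordinate are isomorphic -/
  injective : ∀ (Ω : Type u) [Field Ω] [CharZero Ω] [IsAlgClosed Ω] (v : Ω), v ≠ 0 → v ≠ 1 →
    ∀ (Y Y' : CurveCover Ω) (c : OnePoint Ω), T Ω v Y → T Ω v Y' → x Ω Y c → x Ω Y' c →
      Y.IsIsomorphic Y'
  /-- every point of the fibre of `π` over `v` is the coordinate of some cover -/
  surjective : ∀ (Ω : Type u) [Field Ω] [CharZero Ω] [IsAlgClosed Ω] (v : Ω), v ≠ 0 → v ≠ 1 →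
    ∀ c : OnePoint Ω, InFibre π v c → ∃ Y : CurveCover Ω, T Ω v Y ∧ x Ω Y c
  /-- the coordinate is compatible with embeddings of algebraically closed fields; the case of the
  identity says that it depends only on the isomorphism class -/
  natural : ∀ (Ω Ω' : Type u) [Field Ω] [CharZero Ω] [IsAlgClosed Ω]
    [Field Ω'] [CharZero Ω'] [IsAlgClosed Ω'] (σ : Ω →+* Ω') (v : Ω), v ≠ 0 → v ≠ 1 →
    ∀ (Y : CurveCover Ω) (Y' : CurveCover Ω') (c : OnePoint Ω), T Ω v Y → T Ω' (σ v) Y' →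
      Y.IsBaseChange σ Y' → x Ω Y c → x Ω' Y' (c.map σ)

/-- The Hurwitz parameter `(S_n, (2 1^{n-2}, a b d², 3 1^{n-3}, n), (1, 1, 1, 1))`,
where `n = a + b + 2 d`. -/
def semicubical (a b d : ℕ) : HurwitzParameter 4 where
  n := a + b + 2 * d
  classes :=
    ![2 ::ₘ Multiset.replicate (a + b + 2 * d - 2) 1,
      {a, b, d, d},
      3 ::ₘ Multiset.replicate (a + b + 2 * d - 3) 1,
      {a + b + 2 * d}]

/-- The coordinate on the moduli space given by the marking `a₀ b₁ d²`, `3_x 1^{n-3}`, `n_∞`: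
identify `Y` with `ℙ¹_y` such that the point of ramification index `a` over `t = 0` is `y = 0`, the
point of index `b` over `t = 0` is `y = 1`, and the point of index `n` over `t = ∞` is `y = ∞`;
then `c` is the position of the point of index `3` over `t = 1`. -/
def semicubicalCoordinate (a b d : ℕ) (Ω : Type u) [Field Ω] (Y : CurveCover Ω)
    (c : OnePoint Ω) : Prop :=
  ∃ (y : Y.K) (Pa Pb Pinf Px : Y.Point),
    Subfield.closure (Set.range Y.const ∪ {y}) = ⊤ ∧
    Pa.LiesOver ((0 : Ω) : OnePoint Ω) a ∧ Pa.TakesValue y ((0 : Ω) : OnePoint Ω) ∧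
    Pb.LiesOver ((0 : Ω) : OnePoint Ω) b ∧ Pb.TakesValue y ((1 : Ω) : OnePoint Ω) ∧
    Pinf.LiesOver OnePoint.infty (a + b + 2 * d) ∧ Pinf.TakesValue y OnePoint.infty ∧
    Px.LiesOver ((1 : Ω) : OnePoint Ω) 3 ∧ Px.TakesValue y c

/-! Outside infinity the ramification of such a cover adds up to `1 + (n - 4) + 2 = n - 1`, and
infinity is totally ramified. Hence the genus is zero and `t = F(y)` for a polynomial `F = γ yᵃ (y -
1)ᵇ Q(y)ᵈ` with `Q = y² + p y + q`.

The logarithmic derivative of `F` has a cubic numerator with leading coefficient `n`. Its zeros must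
be the triple point `x`, counted twice, and the double point `w` over `v`. For given `x` this is a
linear system in `w, p, q` with determinant `n C` (`System`, `system_iff`). Its solution satisfies
`n C w = a A`, `n C (1 - w) = b B`, `C Q(x) = 2 d² x² (1 - x)²` and `n² C² Q(w) = A B D`, so that `v
= F(w) / F(x)` is `π(x)` (`System.numer_mul`). Conversely, if `π(x) = v` is neither `0` nor `1`,
then `x ≠ 0, 1`, none of `A, B, C, D` vanishes at `x`, and `x ≠ w`; this is what is needed for `F`
to have the prescribed ramification (`isCoverOfType_of_isNormalForm`). So `x` determines `F` and
thereby the cover, and a field embedding carries `y` and `F` along.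

For the Belyi property, `π' / π = T³ / (A B D x (1 - x) C)` with `T = n x C - a A = n C (x - w)`. A
critical point with value other than `0, ∞` therefore has `w = x`, and there `π = F(w) / F(x) = 1`
(`wronskian_numer_denom`, `numer_eq_denom_of_polyT`).

Genus zero is obtained inside the function field. The functions regular away from infinity have a
`k[t]`-basis consisting of functions of least pole order in each class modulo `n`. The element of
the trace dual basis belonging to the class of `1` has the opposite order of its partner. Since the
different is tame, its norm has degree at most the total ramification, which is less than `n`
(`order_of_dual`). So the partner has pole order less than `n`, hence equal to `1`, and it serves as
the coordinate `y` (`IsTotallyRamified.exists_order_one`).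

For the symmetric group, a block of the monodromy group yields a decomposition `F = f ∘ g`
(`exists_comp_of_isBlock`). If `deg g ≥ 2`, a critical point of `f` outside the zero fibre would
produce too much ramification in `F`. Hence `f` is a power of a linear polynomial up to a constant,
and its degree divides `gcd(a, b, d) = 1`. The group is thus primitive; the inertia group at the
double point contains a transposition (`exists_isSwap`), and Jordan's theorem applies. -/

namespace CurveCover

/-! ### Points and valuations; function fields generated by one element. -/

variable {k : Type u} [Field k] (Y : CurveCover k)

noncomputable instance constAlgebra : Algebra k Y.K :=
  ((algebraMap (RatFunc k) Y.K).comp RatFunc.C).toAlgebra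

noncomputable instance polynomialAlgebra : Algebra k[X] Y.K :=
  ((algebraMap (RatFunc k) Y.K).comp (algebraMap k[X] (RatFunc k))).toAlgebra

instance : IsScalarTower k (RatFunc k) Y.K :=
  IsScalarTower.of_algebraMap_eq fun _ => by rw [RatFunc.algebraMap_eq_C]; rfl

instance : IsScalarTower k[X] (RatFunc k) Y.K :=
  IsScalarTower.of_algebraMap_eq fun _ => rfl

instance : IsScalarTower k k[X] Y.K :=
  IsScalarTower.of_algebraMap_eq fun c => by
    change algebraMap (RatFunc k) Y.K (RatFunc.C c) =
      algebraMap (RatFunc k) Y.K (algebraMap k[X] (RatFunc k) (C c))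
    rw [RatFunc.algebraMap_C]

theorem algebraMap_eq_const (c : k) : algebraMap k Y.K c = Y.const c := rfl

theorem algebraMap_polynomial (p : k[X]) : algebraMap k[X] Y.K p = aeval Y.covering p := by
  rw [IsScalarTower.algebraMap_apply k[X] (RatFunc k) Y.K, covering, aeval_algebraMap_apply]
  congr 1
  simp

theorem transcendental_covering : Transcendental k Y.covering := by
  rw [covering, transcendental_algebraMap_iff (algebraMap (RatFunc k) Y.K).injective]
  exact RatFunc.transcendental_X

/-- `y` generates the function field of `Y` over the constants. -/
def Generates (y : Y.K) : Prop := Subfield.closure (Set.range Y.const ∪ {y}) = ⊤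

variable {Y}

theorem generates_iff_adjoin {y : Y.K} :
    Y.Generates y ↔ IntermediateField.adjoin k {y} = ⊤ := by
  rw [Generates, ← IntermediateField.toSubfield_injective.eq_iff,
    IntermediateField.adjoin_toSubfield, IntermediateField.top_toSubfield]
  rfl

theorem Generates.exists_div {y : Y.K} (hy : Y.Generates y) (f : Y.K) :
    ∃ p q : k[X], aeval y q ≠ 0 ∧ f = aeval y p / aeval y q := by
  have hf : f ∈ IntermediateField.adjoin k {y} := by
    rw [generates_iff_adjoin.1 hy]; trivial
  obtain ⟨p, q, h⟩ := IntermediateField.mem_adjoin_simple_iff _ _ |>.1 hf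
  -- With a vanishing denominator the quotient is `0` by convention, which is also `0 / 1`.
  by_cases hq : aeval y q = 0
  · exact ⟨0, 1, by simp, by simp [h, hq]⟩
  · exact ⟨p, q, hq, h⟩

/-- Otherwise the whole function field would be algebraic over the constants, but it contains `t`.
-/
theorem Generates.transcendental {y : Y.K} (hy : Y.Generates y) : Transcendental k y := by
  intro h
  have := IntermediateField.isAlgebraic_adjoin_simple (K := k) h.isIntegral
  refine Y.transcendental_covering ?_
  have hm : Y.covering ∈ IntermediateField.adjoin k {y} := by
    rw [generates_iff_adjoin.1 hy]; trivial
  exact IntermediateField.isAlgebraic_iff.1 (this.isAlgebraic ⟨_, hm⟩)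

theorem Generates.aeval_eq_zero {y : Y.K} (hy : Y.Generates y) {p : k[X]} :
    aeval y p = 0 ↔ p = 0 :=
  ⟨fun h => (transcendental_iff.1 hy.transcendental) p h, fun h => by simp [h]⟩

theorem Generates.aeval_injective {y : Y.K} (hy : Y.Generates y) :
    Function.Injective (aeval (R := k) y) := fun p q h => by
  rw [← sub_eq_zero, ← hy.aeval_eq_zero, map_sub, h, sub_self]

theorem Generates.of_adjoin_le {y z : Y.K} (hy : Y.Generates y)
    (h : y ∈ IntermediateField.adjoin k {z}) : Y.Generates z := by
  rw [generates_iff_adjoin] at *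
  rw [eq_top_iff, ← hy, IntermediateField.adjoin_le_iff]
  simpa using h

theorem Generates.inv {y : Y.K} (hy : Y.Generates y) : Y.Generates y⁻¹ :=
  hy.of_adjoin_le <| by
    have := inv_mem (IntermediateField.mem_adjoin_simple_self k y⁻¹)
    simpa using this

theorem Generates.affine {y : Y.K} (hy : Y.Generates y) {α : k} (hα : α ≠ 0) (β : k) :
    Y.Generates (Y.const α * y + Y.const β) :=
  hy.of_adjoin_le <| by
    set z := Y.const α * y + Y.const β with hz
    have h1 : y = algebraMap k Y.K α⁻¹ * (z - algebraMap k Y.K β) := by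
      rw [hz, algebraMap_eq_const Y β, add_sub_cancel_right, ← algebraMap_eq_const, ← mul_assoc,
        ← map_mul, inv_mul_cancel₀ hα, map_one, one_mul]
    rw [h1]
    exact mul_mem (algebraMap_mem _ _)
      (sub_mem (IntermediateField.mem_adjoin_simple_self k z) (algebraMap_mem _ _))

theorem const_ne_zero {c : k} (hc : c ≠ 0) : Y.const c ≠ 0 := by
  rw [← algebraMap_eq_const]; simpa using hc

theorem const_sub (c d : k) : Y.const (c - d) = Y.const c - Y.const d := by
  simp [← algebraMap_eq_const]

@[simp] theorem const_zero : Y.const 0 = 0 := by simp [← algebraMap_eq_const]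

@[simp] theorem const_one : Y.const 1 = 1 := by simp [← algebraMap_eq_const]

namespace Point

theorem ext_ring {P Q : Y.Point} (h : P.ring = Q.ring) : P = Q := by
  cases P; cases Q; simp_all

variable (P : Y.Point)

theorem valuation_const_le (c : k) : P.ring.valuation (Y.const c) ≤ 1 :=
  (P.ring.valuation_le_one_iff _).2 (P.const_mem c)

theorem valuation_const {c : k} (hc : c ≠ 0) : P.ring.valuation (Y.const c) = 1 := by
  refine le_antisymm (P.valuation_const_le c) ?_
  have h := P.valuation_const_le c⁻¹
  rw [← algebraMap_eq_const, map_inv₀, algebraMap_eq_const, map_inv₀] at h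
  rwa [inv_le_one₀] at h
  rw [zero_lt_iff]
  simpa using const_ne_zero hc

theorem takesValue_coe {f : Y.K} {c : k} :
    P.TakesValue f (c : OnePoint k) ↔ P.ring.valuation (f - Y.const c) < 1 := Iff.rfl

theorem takesValue_infty {f : Y.K} :
    P.TakesValue f OnePoint.infty ↔ 1 < P.ring.valuation f := Iff.rfl

theorem TakesValue.mem {f : Y.K} {c : k} {P : Y.Point} (h : P.TakesValue f (c : OnePoint k)) :
    P.ring.valuation f ≤ 1 := by
  rw [← sub_add_cancel f (Y.const c)]
  exact (P.ring.valuation.map_add _ _).trans (max_le (takesValue_coe P |>.1 h).le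
    (P.valuation_const_le c))

theorem TakesValue.unique {f : Y.K} {τ τ' : OnePoint k} {P : Y.Point} (h : P.TakesValue f τ)
    (h' : P.TakesValue f τ') : τ = τ' := by
  induction τ using OnePoint.rec with
  | infty =>
    induction τ' using OnePoint.rec with
    | infty => rfl
    | coe c => exact absurd h (not_lt.2 h'.mem)
  | coe c =>
    induction τ' using OnePoint.rec with
    | infty => exact absurd h' (not_lt.2 h.mem)
    | coe c' =>
      rw [takesValue_coe] at h h'
      by_contra hne
      have hcc : c' - c ≠ 0 := fun h0 => hne (by rw [sub_eq_zero.1 h0])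
      have := P.valuation_const hcc
      have h2 : Y.const (c' - c) = (f - Y.const c) - (f - Y.const c') := by
        rw [const_sub]; ring
      rw [h2] at this
      exact absurd this (((P.ring.valuation.map_sub _ _).trans_lt (max_lt h h')).ne)

theorem TakesValue.inv {f : Y.K} {P : Y.Point} :
    P.TakesValue f OnePoint.infty ↔ f ≠ 0 ∧ P.TakesValue f⁻¹ ((0 : k) : OnePoint k) := by
  rw [takesValue_coe, takesValue_infty, const_zero, sub_zero, map_inv₀]
  by_cases hf : f = 0
  · simp [hf]
  · have : 0 < P.ring.valuation f := by rw [zero_lt_iff]; simpa using hf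
    rw [inv_lt_one₀ this]
    simp [hf]

/-- Polynomials in `f` are regular where `f` is. -/
theorem valuation_aeval_le {f : Y.K} (hf : P.ring.valuation f ≤ 1) (p : k[X]) :
    P.ring.valuation (aeval f p) ≤ 1 := by
  induction p using Polynomial.induction_on' with
  | add p q hp hq =>
    rw [map_add]
    exact (P.ring.valuation.map_add _ _).trans (max_le hp hq)
  | monomial n c =>
    rw [aeval_monomial, map_mul, map_pow, algebraMap_eq_const]
    exact mul_le_one' (P.valuation_const_le c) (pow_le_one' hf n)

theorem valuation_aeval_eq_one {f : Y.K} {c : k} (h : P.TakesValue f (c : OnePoint k))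
    {p : k[X]} (hp : p.eval c ≠ 0) : P.ring.valuation (aeval f p) = 1 := by
  obtain ⟨r, hr⟩ := X_sub_C_dvd_sub_C_eval (a := c) (p := p)
  have h1 : aeval f p = (f - Y.const c) * aeval f r + Y.const (p.eval c) := by
    have := congrArg (aeval f) (sub_eq_iff_eq_add.1 hr)
    simpa [algebraMap_eq_const] using this
  rw [h1, ← P.valuation_const hp]
  refine P.ring.valuation.map_add_eq_of_lt_right ?_
  rw [P.valuation_const hp, map_mul]
  exact mul_lt_one_of_lt_of_le h (P.valuation_aeval_le h.mem r)

theorem valuation_aeval {f : Y.K} {c : k} (h : P.TakesValue f (c : OnePoint k))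
    {p : k[X]} (hp : p ≠ 0) :
    P.ring.valuation (aeval f p) =
      P.ring.valuation (f - Y.const c) ^ p.rootMultiplicity c := by
  obtain ⟨q, hq, hq'⟩ := exists_eq_pow_rootMultiplicity_mul_and_not_dvd p hp c
  rw [dvd_iff_isRoot] at hq'
  conv_lhs => rw [hq]
  rw [map_mul, map_mul, P.valuation_aeval_eq_one h hq', mul_one]
  simp [algebraMap_eq_const]

theorem TakesValue.aeval {f : Y.K} {c : k} {P : Y.Point} (h : P.TakesValue f (c : OnePoint k))
    (p : k[X]) : P.TakesValue (aeval f p) ((p.eval c : k) : OnePoint k) := by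
  rw [takesValue_coe]
  obtain ⟨r, hr⟩ := X_sub_C_dvd_sub_C_eval (a := c) (p := p)
  have h1 : Polynomial.aeval f p - Y.const (p.eval c) =
      (f - Y.const c) * Polynomial.aeval f r := by
    have := congrArg (Polynomial.aeval f) hr
    simpa [algebraMap_eq_const] using this
  rw [h1, map_mul]
  exact mul_lt_one_of_lt_of_le h (P.valuation_aeval_le h.mem r)

theorem IsUniformizer.lt_one {ϖ : Y.K} {P : Y.Point} (h : P.IsUniformizer ϖ) :
    P.ring.valuation ϖ < 1 := (h ϖ).2 le_rfl

/-- If `0` generated the maximal ideal, the local ring would be the whole field, which `ne_top`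
excludes. -/
theorem IsUniformizer.ne_zero {ϖ : Y.K} {P : Y.Point} (h : P.IsUniformizer ϖ) : ϖ ≠ 0 := by
  rintro rfl
  refine P.ne_top (eq_top_iff.2 fun f _ => ?_)
  rw [← ValuationSubring.valuation_le_one_iff]
  by_contra hf
  rw [not_le] at hf
  have h2 := (h f⁻¹).1 (by rw [map_inv₀]; exact inv_lt_one_of_one_lt₀ hf)
  simp only [map_inv₀, map_zero, le_zero_iff, inv_eq_zero] at h2
  simp [h2] at hf

theorem IsUniformizer.valuation_eq {ϖ ϖ' : Y.K} {P : Y.Point} (h : P.IsUniformizer ϖ)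
    (h' : P.IsUniformizer ϖ') : P.ring.valuation ϖ = P.ring.valuation ϖ' :=
  le_antisymm ((h' ϖ).1 h.lt_one) ((h ϖ').1 h'.lt_one)

theorem IsUniformizer.pow_injective {ϖ : Y.K} {P : Y.Point} (h : P.IsUniformizer ϖ) {i j : ℕ}
    (hij : P.ring.valuation ϖ ^ i = P.ring.valuation ϖ ^ j) : i = j := by
  have h0 : 0 < P.ring.valuation ϖ := by rw [zero_lt_iff]; simpa using h.ne_zero
  exact (pow_right_strictAnti₀ h0 h.lt_one).injective hij

theorem LiesOver.unique {P : Y.Point} {τ : OnePoint k} {e e' : ℕ} (h : P.LiesOver τ e)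
    (h' : P.LiesOver τ e') : e = e' := by
  obtain ⟨-, ϖ, h1, h2⟩ := h
  obtain ⟨-, ϖ', h1', h2'⟩ := h'
  rw [h2, h1'.valuation_eq h1] at h2'
  exact h1.pow_injective h2'

end Point

/-- There is a point at which a given nonunit of a ring of functions vanishes. -/
theorem exists_point {z : Y.K} (hz : z ≠ 0) (A : Subalgebra k Y.K) (hzA : z ∈ A)
    (h : z⁻¹ ∉ A) : ∃ P : Y.Point, (∀ f ∈ A, P.ring.valuation f ≤ 1) ∧ P.ring.valuation z < 1 := by
  -- Chevalley's extension theorem: the proper ideal `(z)` of `A` consists of nonunits of some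
  -- valuation ring of the field that contains `A`.
  obtain ⟨V, hV, hV'⟩ := Ideal.image_subset_nonunits_valuationSubring
    (A := A.toSubring) (Ideal.span {⟨z, hzA⟩}) (by
      rw [Ne, Ideal.span_singleton_eq_top, isUnit_iff_exists_inv]
      rintro ⟨⟨w, hw⟩, hw'⟩
      have : z * w = 1 := congrArg Subtype.val hw'
      rw [eq_inv_of_mul_eq_one_right this] at hw
      exact h hw)
  have hz1 : V.valuation z < 1 := by
    have : z ∈ V.nonunits := hV' ⟨⟨z, hzA⟩, Ideal.mem_span_singleton_self _, rfl⟩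
    exact V.mem_nonunits_iff.1 this
  refine ⟨⟨V, ?_, fun c => hV (A.algebraMap_mem c)⟩, fun f hf => ?_, hz1⟩
  · rintro rfl
    have := (ValuationSubring.valuation_le_one_iff ⊤ z⁻¹).2 trivial
    rw [map_inv₀] at this
    have h3 := (one_lt_inv₀ (a := (⊤ : ValuationSubring Y.K).valuation z)
      (by rw [zero_lt_iff]; simpa using hz)).2 hz1
    exact absurd this (not_le.2 h3)
  · exact (V.valuation_le_one_iff f).2 (hV hf)

namespace Generates

variable {y : Y.K} (hy : Y.Generates y)
include hy

theorem sub_const_ne_zero (c : k) : y - Y.const c ≠ 0 := by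
  intro h
  have : aeval y (X - C c) = 0 := by simpa [algebraMap_eq_const] using h
  exact X_sub_C_ne_zero c (hy.aeval_eq_zero.1 this)

theorem ne_zero : y ≠ 0 := by simpa using hy.sub_const_ne_zero 0

/-- As `y` is transcendental, an inverse `p(y)` would give the identity `(X - c) p = 1` of
polynomials, which fails at `c`. -/
theorem sub_const_inv_notMem (c : k) : (y - Y.const c)⁻¹ ∉ Algebra.adjoin k {y} := by
  intro h
  rw [Algebra.adjoin_singleton_eq_range_aeval] at h
  obtain ⟨p, hp⟩ := h
  have h2 : aeval y ((X - C c) * p) = aeval y (1 : k[X]) := by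
    have h3 : aeval y p = (y - Y.const c)⁻¹ := hp
    rw [map_mul, h3]
    simpa [algebraMap_eq_const] using mul_inv_cancel₀ (hy.sub_const_ne_zero c)
  have := congrArg (eval c) (hy.aeval_injective h2)
  simp at this

theorem exists_point_coe (c : k) : ∃ P : Y.Point, P.TakesValue y (c : OnePoint k) := by
  obtain ⟨P, -, h⟩ := CurveCover.exists_point (hy.sub_const_ne_zero c) (Algebra.adjoin k {y})
    (sub_mem (Algebra.self_mem_adjoin_singleton k y) ((Algebra.adjoin k {y}).algebraMap_mem c))
    (hy.sub_const_inv_notMem c)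
  exact ⟨P, h⟩

theorem exists_point (c : OnePoint k) : ∃ P : Y.Point, P.TakesValue y c := by
  induction c using OnePoint.rec with
  | infty =>
    obtain ⟨P, hP⟩ := hy.inv.exists_point_coe 0
    exact ⟨P, Point.TakesValue.inv.2 ⟨hy.ne_zero, hP⟩⟩
  | coe c => exact hy.exists_point_coe c

/-- At a point with `y = c`, valuations are powers of the one of `y - c`. -/
theorem valuation_eq_zpow {P : Y.Point} {c : k} (h : P.TakesValue y (c : OnePoint k))
    {f : Y.K} {p q : k[X]} (hf : f ≠ 0) (hq : aeval y q ≠ 0) (hfpq : f = aeval y p / aeval y q) :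
    P.ring.valuation f = P.ring.valuation (y - Y.const c) ^
      ((p.rootMultiplicity c : ℤ) - q.rootMultiplicity c) := by
  have h0 : P.ring.valuation (y - Y.const c) ≠ 0 := by simpa using hy.sub_const_ne_zero c
  rw [hfpq, map_div₀, P.valuation_aeval h, P.valuation_aeval h, zpow_sub₀ h0, zpow_natCast,
    zpow_natCast]
  · rintro rfl; simp at hq
  · rintro rfl; exact hf (by simp [hfpq])

theorem valuation_zpow_lt_one {P : Y.Point} {c : k} (h : P.TakesValue y (c : OnePoint k))
    (m : ℤ) : P.ring.valuation (y - Y.const c) ^ m < 1 ↔ 0 < m := by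
  have h0 : 0 < P.ring.valuation (y - Y.const c) := by
    rw [zero_lt_iff]; simpa using hy.sub_const_ne_zero c
  have := (zpow_right_strictAnti₀ h0 h).lt_iff_gt (a := m) (b := 0)
  simpa using this

theorem isUniformizer {P : Y.Point} {c : k} (h : P.TakesValue y (c : OnePoint k)) :
    P.IsUniformizer (y - Y.const c) := by
  intro f
  have h0 : 0 < P.ring.valuation (y - Y.const c) := by
    rw [zero_lt_iff]; simpa using hy.sub_const_ne_zero c
  by_cases hf : f = 0
  · simp [hf]
  obtain ⟨p, q, hq, hfpq⟩ := hy.exists_div f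
  rw [hy.valuation_eq_zpow h hf hq hfpq, hy.valuation_zpow_lt_one h]
  have := (zpow_right_strictAnti₀ h0 h).le_iff_ge (a := 1)
    (b := (p.rootMultiplicity c : ℤ) - q.rootMultiplicity c)
  have := (zpow_right_strictAnti₀ h0 h).le_iff_ge (b := 1)
    (a := (p.rootMultiplicity c : ℤ) - q.rootMultiplicity c)
  simp only [zpow_one] at this
  rw [this]
  omega

/-- Whether `p(y) / q(y)` is regular depends only on the multiplicities of `c` in `p` and `q`, and
not on the point. -/
theorem point_unique_coe {P Q : Y.Point} {c : k} (hP : P.TakesValue y (c : OnePoint k))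
    (hQ : Q.TakesValue y (c : OnePoint k)) : P = Q := by
  refine Point.ext_ring (SetLike.ext fun f => ?_)
  by_cases hf : f = 0
  · simp [hf, zero_mem]
  obtain ⟨p, q, hq, hfpq⟩ := hy.exists_div f
  have key : ∀ {R : Y.Point}, R.TakesValue y (c : OnePoint k) →
      (f ∈ R.ring ↔ q.rootMultiplicity c ≤ p.rootMultiplicity c) := fun {R} hR => by
    have h0 : 0 < R.ring.valuation (y - Y.const c) := by
      rw [zero_lt_iff]; simpa using hy.sub_const_ne_zero c
    have := (zpow_right_strictAnti₀ h0 hR).le_iff_ge (b := 0)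
      (a := (p.rootMultiplicity c : ℤ) - q.rootMultiplicity c)
    rw [← ValuationSubring.valuation_le_one_iff, hy.valuation_eq_zpow hR hf hq hfpq]
    simp only [zpow_zero] at this
    rw [this]; omega
  rw [key hP, key hQ]

theorem point_unique {P Q : Y.Point} {c : OnePoint k} (hP : P.TakesValue y c)
    (hQ : Q.TakesValue y c) : P = Q := by
  induction c using OnePoint.rec with
  | infty =>
    exact hy.inv.point_unique_coe (Point.TakesValue.inv.1 hP).2 (Point.TakesValue.inv.1 hQ).2
  | coe c => exact hy.point_unique_coe hP hQ

end Generates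

/-- A regular function takes a finite value at every point where it satisfies a monic equation
with constant coefficients up to the maximal ideal. -/
theorem Point.exists_takesValue_of_eval [IsAlgClosed k] (P : Y.Point) {f : Y.K} {p : k[X]}
    (hp : p ≠ 0) (h : P.ring.valuation (aeval f p) < 1) :
    ∃ c : k, P.TakesValue f (c : OnePoint k) := by
  have hs := IsAlgClosed.splits p
  by_contra! hc
  have h1 : ∀ c, 1 ≤ P.ring.valuation (f - Y.const c) := fun c => not_lt.1 (hc c)
  have h2 : ∀ s : Multiset k, 1 ≤ P.ring.valuation (aeval f (s.map (X - C ·)).prod) := by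
    intro s
    induction s using Multiset.induction with
    | empty => simp
    | cons c s ih =>
      rw [Multiset.map_cons, Multiset.prod_cons, map_mul, map_mul]
      refine one_le_mul ?_ ih
      simpa [algebraMap_eq_const] using h1 c
  rw [hs.eq_prod_roots, map_mul, map_mul, aeval_C, algebraMap_eq_const,
    P.valuation_const (leadingCoeff_ne_zero.2 hp), one_mul] at h
  exact absurd h (not_lt.2 (h2 _))

/-- If `y` took no value at `P`, every nonzero polynomial in `y` would be a unit at `P`, and the
local ring would be the whole field. -/
theorem Generates.exists_takesValue [IsAlgClosed k] {y : Y.K} (hy : Y.Generates y)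
    (P : Y.Point) : ∃ c : OnePoint k, P.TakesValue y c := by
  by_contra! hc
  have hy1 : P.ring.valuation y ≤ 1 := not_lt.1 fun h => hc OnePoint.infty h
  have key : ∀ p : k[X], p ≠ 0 → P.ring.valuation (aeval y p) = 1 := fun p hp => by
    refine le_antisymm (P.valuation_aeval_le hy1 p) (not_lt.1 fun h => ?_)
    obtain ⟨c, h⟩ := P.exists_takesValue_of_eval hp h
    exact hc _ h
  refine P.ne_top (eq_top_iff.2 fun f _ => ?_)
  rw [← ValuationSubring.valuation_le_one_iff]
  obtain ⟨p, q, hq, rfl⟩ := hy.exists_div f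
  rw [map_div₀, key q (by rintro rfl; simp at hq), div_one]
  exact P.valuation_aeval_le hy1 p

end CurveCover

/-! ### Behaviour at infinity and polynomial covers. -/

namespace CurveCover

variable {k : Type u} [Field k] {Y : CurveCover k}

namespace Point

variable (P : Y.Point)

theorem valuation_aeval_le_pow {f : Y.K} (hf : 1 ≤ P.ring.valuation f) (p : k[X]) :
    P.ring.valuation (aeval f p) ≤ P.ring.valuation f ^ p.natDegree := by
  rw [aeval_eq_sum_range]
  refine P.ring.valuation.map_sum_le fun i hi => ?_
  rw [Algebra.smul_def, map_mul, map_pow, algebraMap_eq_const]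
  calc _ ≤ 1 * P.ring.valuation f ^ i := mul_le_mul_left (P.valuation_const_le _) _
    _ ≤ _ := by
      rw [one_mul]
      exact pow_le_pow_right₀ hf (Nat.lt_succ_iff.1 (Finset.mem_range.1 hi))

/-- At a pole of `f` the leading monomial strictly dominates the others. -/
theorem valuation_aeval_infty {f : Y.K} (hf : 1 < P.ring.valuation f) {p : k[X]} (hp : p ≠ 0) :
    P.ring.valuation (aeval f p) = P.ring.valuation f ^ p.natDegree := by
  have hlead : P.ring.valuation (aeval f (C p.leadingCoeff * X ^ p.natDegree)) =
      P.ring.valuation f ^ p.natDegree := by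
    rw [map_mul, map_mul, aeval_C, algebraMap_eq_const,
      P.valuation_const (leadingCoeff_ne_zero.2 hp), one_mul, map_pow, aeval_X, map_pow]
  -- Constants are treated apart because `eraseLead` does not lower their degree.
  by_cases h0 : p.natDegree = 0
  · rw [eq_C_of_natDegree_eq_zero h0] at hp ⊢
    simp only [aeval_C, algebraMap_eq_const, natDegree_C, pow_zero]
    exact P.valuation_const fun h => hp (by rw [h, C_0])
  conv_lhs => rw [← eraseLead_add_C_mul_X_pow p, map_add]
  rw [P.ring.valuation.map_add_eq_of_lt_right, hlead]
  rw [hlead]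
  refine (P.valuation_aeval_le_pow hf.le _).trans_lt (pow_lt_pow_right₀ hf ?_)
  have := eraseLead_natDegree_le p
  omega

/-- At a point over `∞`, rational functions of `t` have the value of a power of `t`. -/
theorem valuation_algebraMap_infty (hP : P.TakesValue Y.covering OnePoint.infty)
    {r : RatFunc k} (hr : r ≠ 0) : P.ring.valuation (algebraMap (RatFunc k) Y.K r) =
      P.ring.valuation Y.covering ^ r.intDegree := by
  have h0 : P.ring.valuation Y.covering ≠ 0 := (zero_lt_one.trans hP).ne'
  conv_lhs => rw [← RatFunc.num_div_denom r]
  rw [map_div₀, map_div₀, ← IsScalarTower.algebraMap_apply, ← IsScalarTower.algebraMap_apply,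
    algebraMap_polynomial, algebraMap_polynomial, P.valuation_aeval_infty hP (r.num_ne_zero hr),
    P.valuation_aeval_infty hP r.denom_ne_zero, RatFunc.intDegree, zpow_sub₀ h0, zpow_natCast,
    zpow_natCast]

theorem IsUniformizer.pos {ϖ : Y.K} {P : Y.Point} (h : P.IsUniformizer ϖ) :
    0 < P.ring.valuation ϖ := by
  rw [zero_lt_iff]; simpa using h.ne_zero

theorem IsUniformizer.zpow_injective {ϖ : Y.K} {P : Y.Point} (h : P.IsUniformizer ϖ) {i j : ℤ}
    (hij : P.ring.valuation ϖ ^ i = P.ring.valuation ϖ ^ j) : i = j :=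
  (zpow_right_strictAnti₀ h.pos h.lt_one).injective hij

variable {P}

theorem valuation_covering_of_liesOver {n : ℕ} {ϖ : Y.K}
    (hn : P.ring.valuation (Y.localParameter OnePoint.infty) = P.ring.valuation ϖ ^ n) :
    P.ring.valuation Y.covering = P.ring.valuation ϖ ^ (-n : ℤ) := by
  have : P.ring.valuation Y.covering⁻¹ = P.ring.valuation ϖ ^ n := hn
  rw [map_inv₀] at this
  rw [zpow_neg, zpow_natCast, ← this, inv_inv]

/-- Functions whose orders at a point over `∞` with ramification index `n` are
pairwise incongruent modulo `n` are linearly independent. -/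
theorem linearIndependent_of_order (hP : P.TakesValue Y.covering OnePoint.infty) {ϖ : Y.K}
    (hϖ : P.IsUniformizer ϖ) {n : ℕ}
    (hn : P.ring.valuation (Y.localParameter OnePoint.infty) = P.ring.valuation ϖ ^ n)
    {ι : Type*} {f : ι → Y.K} {m : ι → ℤ}
    (hf : ∀ i, P.ring.valuation (f i) = P.ring.valuation ϖ ^ m i)
    (hm : ∀ i j, (n : ℤ) ∣ m i - m j → i = j) : LinearIndependent (RatFunc k) f := by
  classical
  rw [linearIndependent_iff']
  intro s g hs i hi
  by_contra hgi
  set t := s.filter fun j => g j ≠ 0 with ht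
  have hts : ∑ j ∈ t, g j • f j = 0 := by
    rw [← hs, ht, Finset.sum_filter_of_ne]
    intro j _ hj h0
    exact hj (by rw [h0, zero_smul])
  have hval : ∀ j ∈ t, P.ring.valuation (g j • f j) =
      P.ring.valuation ϖ ^ (-n * (g j).intDegree + m j) := fun j hj => by
    rw [Algebra.smul_def, map_mul, P.valuation_algebraMap_infty hP (Finset.mem_filter.1 hj).2,
      hf, valuation_covering_of_liesOver hn, ← zpow_mul, ← zpow_add₀ hϖ.pos.ne']
  -- Coefficients in `k(t)` shift orders by multiples of `n`, so the nonzero terms have distinct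
  -- valuations and the largest one cannot cancel.
  obtain ⟨j, hj, hmax⟩ := t.exists_max_image (fun j => P.ring.valuation (g j • f j))
    ⟨i, Finset.mem_filter.2 ⟨hi, hgi⟩⟩
  have hsum := P.ring.valuation.map_sum_eq_of_lt hj (f := fun j => g j • f j) fun l hl => by
    have hl' := Finset.mem_sdiff.1 hl
    refine lt_of_le_of_ne (hmax l hl'.1) fun heq => ?_
    rw [hval l hl'.1, hval j hj] at heq
    have h1 := hϖ.zpow_injective heq
    have : l = j := hm l j ⟨(g l).intDegree - (g j).intDegree, by linarith⟩
    exact hl'.2 (by simp [this])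
  rw [hts, map_zero, hval j hj] at hsum
  exact (zpow_ne_zero _ hϖ.pos.ne') hsum.symm

end Point

/-- In a cover by a rational curve with coordinate `y`, totally ramified over `∞` at `y = ∞`, the
covering map is the polynomial `F` in `y`. -/
structure IsPolynomialCover (Y : CurveCover k) (y : Y.K) (F : k[X]) : Prop where
  generates : Y.Generates y
  covering_eq : Y.covering = aeval y F

namespace IsPolynomialCover

variable {y : Y.K} {F : k[X]} (h : Y.IsPolynomialCover y F)
include h

theorem natDegree_pos : 0 < F.natDegree := by
  rw [Nat.pos_iff_ne_zero]
  intro h0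
  refine Y.transcendental_covering ?_
  rw [h.covering_eq, eq_C_of_natDegree_eq_zero h0, aeval_C]
  exact isAlgebraic_algebraMap _

theorem ne_zero : F ≠ 0 := by
  rintro rfl
  simpa using h.natDegree_pos

theorem sub_C_ne_zero (c : k) : F - C c ≠ 0 := by
  intro h0
  have := h.natDegree_pos
  rw [sub_eq_zero.1 h0] at this
  simp at this

theorem covering_sub_const (c : k) : Y.covering - Y.const c = aeval y (F - C c) := by
  rw [h.covering_eq, map_sub, aeval_C, algebraMap_eq_const]

theorem takesValue_infty_iff (P : Y.Point) :
    P.TakesValue Y.covering OnePoint.infty ↔ P.TakesValue y OnePoint.infty := by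
  rw [Point.takesValue_infty, Point.takesValue_infty, h.covering_eq]
  constructor
  · intro h1
    by_contra h2
    exact absurd (P.valuation_aeval_le (not_lt.1 h2) F) (not_le.2 h1)
  · intro h1
    rw [P.valuation_aeval_infty h1 h.ne_zero]
    exact one_lt_pow₀ h1 h.natDegree_pos.ne'

theorem liesOver_infty {P : Y.Point} (hP : P.TakesValue y OnePoint.infty) :
    P.LiesOver OnePoint.infty F.natDegree := by
  refine ⟨(h.takesValue_infty_iff P).2 hP, y⁻¹, ?_, ?_⟩
  · simpa using h.generates.inv.isUniformizer (Point.TakesValue.inv.1 hP).2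
  · change P.ring.valuation Y.covering⁻¹ = _
    rw [h.covering_eq, map_inv₀, map_inv₀, P.valuation_aeval_infty hP h.ne_zero, inv_pow]

theorem hasRamification_infty : Y.HasRamification OnePoint.infty {F.natDegree} := by
  classical
  obtain ⟨P, hP⟩ := h.generates.exists_point OnePoint.infty
  refine ⟨{P}, fun _ => F.natDegree, fun Q => ?_, fun Q hQ => ?_, by simp⟩
  · rw [Finset.mem_singleton, h.takesValue_infty_iff]
    exact ⟨fun hQ => hQ ▸ hP, fun hQ => h.generates.point_unique hQ hP⟩
  · rw [Finset.mem_singleton.1 hQ]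
    exact h.liesOver_infty hP

/-- The powers `1, y, …` up to exponent `deg F - 1` have orders at infinity that are pairwise
incongruent modulo the ramification index `deg F`. -/
theorem le_degree : F.natDegree ≤ Y.degree := by
  obtain ⟨P, hP⟩ := h.generates.exists_point OnePoint.infty
  obtain ⟨h1, ϖ, h2, h3⟩ := h.liesOver_infty hP
  have hu : P.IsUniformizer y⁻¹ := by
    simpa using h.generates.inv.isUniformizer (Point.TakesValue.inv.1 hP).2
  have hli := Point.linearIndependent_of_order (P := P) h1 h2 h3 (ι := Fin F.natDegree)
    (f := fun i => y ^ (i : ℕ)) (m := fun i => -(i : ℤ)) (fun i => by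
      rw [h2.valuation_eq hu, map_inv₀, inv_zpow', neg_neg, zpow_natCast, map_pow])
    (fun i j hij => by
      have hi := i.2
      have hj := j.2
      have h0 := Int.eq_zero_of_abs_lt_dvd hij (by rw [abs_lt]; omega)
      exact Fin.ext (by omega))
  simpa [CurveCover.degree] using hli.fintype_card_le_finrank

theorem adjoin_eq_top : IntermediateField.adjoin (RatFunc k) {y} = ⊤ := by
  rw [eq_top_iff]
  intro f _
  obtain ⟨p, q, -, rfl⟩ := h.generates.exists_div f
  have key : ∀ p : k[X], aeval y p ∈ IntermediateField.adjoin (RatFunc k) {y} := fun p => by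
    have := aeval_mem_adjoin_singleton (RatFunc k) y (p := p.map (algebraMap k (RatFunc k)))
    rw [aeval_map_algebraMap] at this
    exact IntermediateField.algebra_adjoin_le_adjoin _ _ this
  exact div_mem (key p) (key q)

/-- The equation `F(y) = t`. -/
theorem aeval_sub_X : aeval y (F.map (algebraMap k (RatFunc k)) - C RatFunc.X) = 0 := by
  rw [map_sub, aeval_C, aeval_map_algebraMap, ← h.covering_eq, covering, sub_self]

omit h in
theorem natDegree_sub_X :
    (F.map (algebraMap k (RatFunc k)) - C RatFunc.X).natDegree = F.natDegree := by
  rw [natDegree_sub_C, natDegree_map]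

/-- One bound is total ramification at infinity, the other is that `y` is a root of `F - t` and
generates the field over `k(t)`. -/
theorem degree_eq : Y.degree = F.natDegree := by
  refine le_antisymm ?_ h.le_degree
  rw [CurveCover.degree, ← IntermediateField.finrank_top', ← h.adjoin_eq_top,
    IntermediateField.adjoin.finrank (Algebra.IsIntegral.isIntegral y), ← natDegree_sub_X (F := F)]
  refine natDegree_le_of_dvd (minpoly.dvd _ _ h.aeval_sub_X) fun h0 => ?_
  have := h.natDegree_pos
  rw [← natDegree_sub_X, h0] at this
  simp at this

theorem liesOver {P : Y.Point} {c : k} (hP : P.TakesValue y (c : OnePoint k)) {τ : k}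
    (hτ : F.eval c = τ) :
    P.LiesOver (τ : OnePoint k) ((F - C τ).rootMultiplicity c) := by
  refine ⟨?_, y - Y.const c, h.generates.isUniformizer hP, ?_⟩
  · rw [h.covering_eq, ← hτ]
    exact hP.aeval F
  · change P.ring.valuation (Y.covering - Y.const τ) = _
    rw [h.covering_sub_const, P.valuation_aeval hP (h.sub_C_ne_zero τ)]

theorem liesOver_iff {P : Y.Point} {c : k} (hP : P.TakesValue y (c : OnePoint k)) {τ : k}
    {e : ℕ} : P.LiesOver (τ : OnePoint k) e ↔
      F.eval c = τ ∧ (F - C τ).rootMultiplicity c = e := by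
  constructor
  · intro he
    have h1 : P.TakesValue Y.covering ((F.eval c : k) : OnePoint k) := by
      rw [h.covering_eq]; exact hP.aeval F
    have h2 := OnePoint.coe_injective (h1.unique he.1)
    exact ⟨h2, (h.liesOver hP h2).unique he⟩
  · rintro ⟨h1, rfl⟩
    exact h.liesOver hP h1

variable [IsAlgClosed k]

theorem exists_value {P : Y.Point} {τ : k} (hP : P.TakesValue Y.covering (τ : OnePoint k)) :
    ∃ c : k, P.TakesValue y (c : OnePoint k) ∧ F.eval c = τ := by
  obtain ⟨c, hc⟩ := h.generates.exists_takesValue P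
  induction c using OnePoint.rec with
  | infty =>
    exact absurd ((h.takesValue_infty_iff P).2 hc |>.unique hP) (OnePoint.infty_ne_coe τ)
  | coe c =>
    have h1 := hc.aeval F
    rw [← h.covering_eq] at h1
    exact ⟨c, hc, OnePoint.coe_injective (h1.unique hP)⟩

-- The points over `τ` correspond to the distinct roots `c` of `F - τ` through `y = c`, and `y - c`
-- is a uniformizer there.
open Classical in
theorem hasRamification (τ : k) : Y.HasRamification (τ : OnePoint k)
    ((F - C τ).roots.toFinset.val.map fun c => (F - C τ).rootMultiplicity c) := by
  choose pt hpt using fun c : k => h.generates.exists_point (c : OnePoint k)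
  have hinj : Function.Injective pt := fun c c' hcc => by
    have h1 := hpt c
    rw [hcc] at h1
    exact OnePoint.coe_injective (h1.unique (hpt c'))
  have hroot : ∀ c, c ∈ (F - C τ).roots.toFinset ↔ F.eval c = τ := fun c => by
    rw [Multiset.mem_toFinset, mem_roots (h.sub_C_ne_zero τ)]
    simp [sub_eq_zero]
  refine ⟨(F - C τ).roots.toFinset.map ⟨pt, hinj⟩,
    fun P => (F - C τ).rootMultiplicity (Function.invFun pt P), fun P => ?_, fun P hP => ?_, ?_⟩
  · rw [Finset.mem_map]
    constructor
    · rintro ⟨c, hc, rfl⟩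
      exact (h.liesOver (hpt c) ((hroot c).1 hc)).1
    · intro hP
      obtain ⟨c, hc, hcτ⟩ := h.exists_value hP
      exact ⟨c, (hroot c).2 hcτ, h.generates.point_unique (hpt c) hc⟩
  · obtain ⟨c, hc, rfl⟩ := Finset.mem_map.1 hP
    simp only [Function.Embedding.coeFn_mk, Function.leftInverse_invFun hinj c]
    exact h.liesOver (hpt c) ((hroot c).1 hc)
  · simp only [Finset.map_val, Multiset.map_map, Function.comp_def, Function.Embedding.coeFn_mk,
      Function.leftInverse_invFun hinj _]

end IsPolynomialCover

theorem HasRamification.unique {τ : OnePoint k} {M M' : Multiset ℕ} (h : Y.HasRamification τ M)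
    (h' : Y.HasRamification τ M') : M = M' := by
  obtain ⟨S, e, hS, he, rfl⟩ := h
  obtain ⟨S', e', hS', he', rfl⟩ := h'
  obtain rfl : S = S' := Finset.ext fun P => by rw [hS, hS']
  exact Multiset.map_congr rfl fun P hP => (he P hP).unique (he' P hP)

end CurveCover

/-! ### Norm, trace and pole order at a totally ramified point. -/

namespace CurveCover

variable {k : Type u} [Field k] {Y : CurveCover k}

/-- `P` is the only point over `∞`, and it is totally ramified. -/
structure IsTotallyRamified (P : Y.Point) (ϖ : Y.K) : Prop where
  takesValue : P.TakesValue Y.covering OnePoint.infty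
  unique : ∀ Q : Y.Point, Q.TakesValue Y.covering OnePoint.infty → Q = P
  isUniformizer : P.IsUniformizer ϖ
  valuation_eq : P.ring.valuation (Y.localParameter OnePoint.infty) =
    P.ring.valuation ϖ ^ Y.degree

theorem valuationSubring_lt_one_iff {L : Type*} [Field L] (V : ValuationSubring L) {x : L}
    (hx : x ≠ 0) : V.valuation x < 1 ↔ x⁻¹ ∉ V := by
  rw [← ValuationSubring.valuation_le_one_iff, map_inv₀, not_le, one_lt_inv₀]
  rw [zero_lt_iff]; simpa using hx

theorem norm_ne_zero {f : Y.K} (hf : f ≠ 0) : Algebra.norm (RatFunc k) f ≠ 0 :=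
  (Algebra.norm_ne_zero_iff (R := RatFunc k)).2 hf

instance : Nonempty Y.Sheets := ⟨IsAlgClosed.lift⟩

namespace IsTotallyRamified

variable {P : Y.Point} {ϖ : Y.K} (h : IsTotallyRamified P ϖ)
include h

/-- A valuation ring of the algebraic closure which lies over `P` for all sheets. -/
theorem exists_valuationSubring : ∃ W : ValuationSubring (AlgebraicClosure (RatFunc k)),
    ∀ (σ : Y.Sheets) (f : Y.K), σ f ∈ W ↔ f ∈ P.ring := by
  obtain ⟨σ₀⟩ : Nonempty Y.Sheets := inferInstance
  -- `W` is a valuation ring dominating the local ring of `P` along one sheet.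
  obtain ⟨W, hW, hloc⟩ := IsLocalRing.exists_factor_valuationRing
    ((σ₀ : Y.K →+* AlgebraicClosure (RatFunc k)).comp P.ring.subtype)
  have hmem : ∀ f ∈ P.ring, σ₀ f ∈ W := fun f hf => hW ⟨f, hf⟩
  have ht : Y.covering ∉ P.ring := by
    rw [← ValuationSubring.valuation_le_one_iff, not_le]; exact h.takesValue
  have hti : Y.covering⁻¹ ∈ P.ring := (P.ring.mem_or_inv_mem _).resolve_left ht
  -- Domination keeps `1 / t` a nonunit, so `t` still has a pole.
  have htW : σ₀ Y.covering ∉ W := by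
    intro hmW
    have h1 : IsUnit (((σ₀ : Y.K →+* AlgebraicClosure (RatFunc k)).comp
        P.ring.subtype).codRestrict W.toSubring hW ⟨Y.covering⁻¹, hti⟩) := by
      refine IsUnit.of_mul_eq_one ⟨σ₀ Y.covering, hmW⟩ (Subtype.ext ?_)
      change σ₀ Y.covering⁻¹ * σ₀ Y.covering = 1
      rw [← map_mul, inv_mul_cancel₀, map_one]
      rintro h0
      exact ht (h0 ▸ zero_mem _)
    obtain ⟨⟨w, hw⟩, hw'⟩ := (hloc.map_nonunit _ h1).exists_right_inv
    have h2 : Y.covering⁻¹ * w = 1 := congrArg Subtype.val hw'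
    have h3 : w = Y.covering := by
      rw [eq_inv_of_mul_eq_one_right h2, inv_inv]
    exact ht (h3 ▸ hw)
  have hbase : ∀ (σ : Y.Sheets) (r : RatFunc k), σ (algebraMap _ _ r) =
      σ₀ (algebraMap _ _ r) := fun σ r => by rw [σ.commutes, σ₀.commutes]
  refine ⟨W, fun σ f => ?_⟩
  -- The pullback of `W` along any sheet is a point over infinity, because all sheets agree on
  -- `k(t)`. By total ramification it is `P`.
  let V : ValuationSubring Y.K := W.comap (σ : Y.K →+* AlgebraicClosure (RatFunc k))
  have hV : Y.covering ∉ V := fun hc => by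
    have : σ Y.covering ∈ W := hc
    rw [covering, hbase] at this
    exact htW this
  let Q : Y.Point := ⟨V, fun htop => hV (htop ▸ trivial), fun c => by
    change σ (Y.const c) ∈ W
    rw [const, hbase]
    exact hmem _ (P.const_mem c)⟩
  have hQ : Q = P := h.unique Q (by
    rw [Point.takesValue_infty, ← not_le, ValuationSubring.valuation_le_one_iff]
    exact hV)
  rw [← hQ]
  rfl

variable [CharZero k]

/-- The trace is the sum of the conjugates, all of which lie in the maximal ideal of a single `W` as
`W` restricts to `P` along every sheet. -/
theorem valuation_trace_lt_one {f : Y.K} (hf : P.ring.valuation f < 1) :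
    P.ring.valuation (algebraMap (RatFunc k) Y.K (Algebra.trace (RatFunc k) Y.K f)) < 1 := by
  obtain ⟨W, hW⟩ := h.exists_valuationSubring
  have hlt : ∀ (σ : Y.Sheets) (f : Y.K), W.valuation (σ f) < 1 ↔ P.ring.valuation f < 1 :=
      fun σ f => by
    by_cases h0 : f = 0
    · simp [h0]
    · rw [valuationSubring_lt_one_iff _ h0, valuationSubring_lt_one_iff _ (by simpa using h0),
        ← map_inv₀, hW]
  obtain ⟨σ₀⟩ : Nonempty Y.Sheets := inferInstance
  rw [← hlt σ₀, σ₀.commutes, trace_eq_sum_embeddings (AlgebraicClosure (RatFunc k))]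
  exact W.valuation.map_sum_lt' zero_lt_one fun σ _ => (hlt σ f).2 hf

theorem valuation_norm_lt_one {f : Y.K} (hf : P.ring.valuation f < 1) :
    P.ring.valuation (algebraMap (RatFunc k) Y.K (Algebra.norm (RatFunc k) f)) < 1 := by
  obtain ⟨W, hW⟩ := h.exists_valuationSubring
  have hlt : ∀ (σ : Y.Sheets) (f : Y.K), W.valuation (σ f) < 1 ↔ P.ring.valuation f < 1 :=
      fun σ f => by
    by_cases h0 : f = 0
    · simp [h0]
    · rw [valuationSubring_lt_one_iff _ h0, valuationSubring_lt_one_iff _ (by simpa using h0),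
        ← map_inv₀, hW]
  obtain ⟨σ₀⟩ : Nonempty Y.Sheets := inferInstance
  rw [← hlt σ₀, σ₀.commutes, Algebra.norm_eq_prod_embeddings (RatFunc k)
    (AlgebraicClosure (RatFunc k)), map_prod]
  classical
  rw [← Finset.mul_prod_erase _ _ (Finset.mem_univ σ₀)]
  exact mul_lt_one_of_lt_of_le ((hlt σ₀ f).2 hf)
    (Finset.prod_le_one' fun σ _ => ((hlt σ f).2 hf).le)

/-- The norm computes orders at the totally ramified point. -/
theorem valuation_norm (f : Y.K) :
    P.ring.valuation (algebraMap (RatFunc k) Y.K (Algebra.norm (RatFunc k) f)) =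
      P.ring.valuation f ^ Y.degree := by
  by_cases hf : f = 0
  · have : Y.degree ≠ 0 := Module.finrank_pos.ne'
    simp [hf, this]
  set N := Algebra.norm (RatFunc k) f with hN
  have hN0 : N ≠ 0 := norm_ne_zero hf
  have hN1 : algebraMap (RatFunc k) Y.K N ≠ 0 := by simpa using hN0
  -- `g` has norm `1`. If it were not a unit at `P`, then it or its inverse would lie in the maximal
  -- ideal, and so would its norm.
  set g := f ^ Y.degree / algebraMap (RatFunc k) Y.K N with hg
  have hg0 : g ≠ 0 := div_ne_zero (pow_ne_zero _ hf) hN1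
  have hgN : Algebra.norm (RatFunc k) g = 1 := by
    rw [hg, div_eq_mul_inv, map_mul, map_pow, ← map_inv₀, Algebra.norm_algebraMap, ← hN,
      ← CurveCover.degree, inv_pow, mul_inv_cancel₀ (pow_ne_zero _ hN0)]
  have h1 : P.ring.valuation g = 1 := by
    refine le_antisymm ?_ ?_
    · by_contra hlt
      rw [not_le] at hlt
      have := h.valuation_norm_lt_one (f := g⁻¹) (by
        rw [map_inv₀]; exact inv_lt_one_of_one_lt₀ hlt)
      have hgi : Algebra.norm (RatFunc k) g⁻¹ = 1 := by
        rw [eq_comm, ← one_mul (Algebra.norm (RatFunc k) g⁻¹), ← hgN, ← map_mul,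
          mul_inv_cancel₀ hg0, map_one, hgN]
      rw [hgi] at this
      simp at this
    · by_contra hlt
      rw [not_le] at hlt
      have := h.valuation_norm_lt_one hlt
      rw [hgN] at this
      simp at this
  rw [hg, map_div₀, map_pow, div_eq_one_iff_eq (by simpa using hN0)] at h1
  exact h1.symm

end IsTotallyRamified

/-- The degree in `t` of the norm of a function. -/
noncomputable def order (f : Y.K) : ℤ := (Algebra.norm (RatFunc k) f).intDegree

theorem order_mul {f g : Y.K} (hf : f ≠ 0) (hg : g ≠ 0) : order (f * g) = order f + order g := by
  rw [order, map_mul, RatFunc.intDegree_mul (norm_ne_zero hf)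
    (norm_ne_zero hg), order, order]

@[simp] theorem order_one : order (1 : Y.K) = 0 := by simp [order]

theorem order_inv {f : Y.K} (hf : f ≠ 0) : order f⁻¹ = - order f := by
  have := order_mul hf (inv_ne_zero hf)
  rw [mul_inv_cancel₀ hf, order_one] at this
  linarith

theorem order_pow {f : Y.K} (hf : f ≠ 0) (m : ℕ) : order (f ^ m) = m * order f := by
  induction m with
  | zero => simp
  | succ m ih => rw [pow_succ, order_mul (pow_ne_zero _ hf) hf, ih]; push_cast; ring

theorem order_algebraMap (r : RatFunc k) :
    order (algebraMap (RatFunc k) Y.K r) = Y.degree * r.intDegree := by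
  rw [order, Algebra.norm_algebraMap, ← CurveCover.degree]
  by_cases hr : r = 0
  · have : Y.degree ≠ 0 := Module.finrank_pos.ne'
    simp [hr, this]
  generalize Y.degree = m
  induction m with
  | zero => simp
  | succ m ih => rw [pow_succ, RatFunc.intDegree_mul (pow_ne_zero _ hr) hr, ih]; push_cast; ring

theorem order_nonneg {f : Y.K} (hf : IsIntegral k[X] f) : 0 ≤ order f := by
  obtain ⟨p, hp⟩ := IsIntegrallyClosed.isIntegral_iff.1 (Algebra.isIntegral_norm (RatFunc k) hf)
  rw [order, ← hp, RatFunc.intDegree_polynomial]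
  positivity

namespace IsTotallyRamified

variable {P : Y.Point} {ϖ : Y.K} (h : IsTotallyRamified P ϖ)
include h

theorem covering_eq : P.ring.valuation Y.covering = P.ring.valuation ϖ ^ (-Y.degree : ℤ) :=
  Point.valuation_covering_of_liesOver h.valuation_eq

variable [CharZero k]

/-- Extracting roots of exponent `Y.degree` from `valuation_norm`; this identifies `order` with the
pole order at `P`. -/
theorem valuation_eq_order {f : Y.K} (hf : f ≠ 0) :
    P.ring.valuation f = P.ring.valuation ϖ ^ (-order f) := by
  have h1 := h.valuation_norm f
  rw [P.valuation_algebraMap_infty h.takesValue (norm_ne_zero hf), h.covering_eq,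
    ← zpow_mul, ← order, show -(Y.degree : ℤ) * order f = (-order f) * Y.degree by ring, zpow_mul,
    zpow_natCast] at h1
  exact ((pow_left_inj₀ zero_le zero_le Module.finrank_pos.ne').1 h1).symm

end IsTotallyRamified
end CurveCover

/-! ### Leading coefficients at infinity; a function with a simple pole by trace duality. -/

namespace CurveCover

variable {k : Type u} [Field k] {Y : CurveCover k}

namespace Point

variable {P : Y.Point}

theorem exists_const_of_ratFunc (hP : P.TakesValue Y.covering OnePoint.infty) {r : RatFunc k}
    (hr : P.ring.valuation (algebraMap (RatFunc k) Y.K r) ≤ 1) :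
    ∃ c : k, P.ring.valuation (algebraMap (RatFunc k) Y.K r - Y.const c) < 1 := by
  by_cases h0 : r = 0
  · exact ⟨0, by simp [h0]⟩
  have hdeg : r.num.natDegree ≤ r.denom.natDegree := by
    rw [P.valuation_algebraMap_infty hP h0] at hr
    by_contra hlt
    rw [RatFunc.intDegree] at hr
    exact absurd (one_lt_zpow₀ hP (n := (r.num.natDegree : ℤ) - r.denom.natDegree) (by omega))
      (not_lt.2 hr)
  -- This is the value at infinity: the denominator is monic, and the coefficient is `0` if the
  -- numerator has smaller degree.
  set c := r.num.coeff r.denom.natDegree with hc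
  refine ⟨c, ?_⟩
  set s := r.num - C c * r.denom with hs
  have hden : aeval Y.covering r.denom ≠ 0 := fun hz =>
    r.denom_ne_zero ((transcendental_iff.1 Y.transcendental_covering) _ hz)
  have heq : algebraMap (RatFunc k) Y.K r - Y.const c =
      aeval Y.covering s / aeval Y.covering r.denom := by
    conv_lhs => rw [← RatFunc.num_div_denom r]
    rw [map_div₀, ← IsScalarTower.algebraMap_apply, ← IsScalarTower.algebraMap_apply,
      algebraMap_polynomial, algebraMap_polynomial, hs, map_sub, map_mul, aeval_C,
      algebraMap_eq_const]
    field_simp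
  rw [heq, map_div₀, P.valuation_aeval_infty hP r.denom_ne_zero]
  by_cases hs0 : s = 0
  · simp [hs0]
  rw [P.valuation_aeval_infty hP hs0, div_lt_one₀ (pow_pos (zero_lt_one.trans hP) _)]
  refine pow_lt_pow_right₀ hP ?_
  have hle : s.natDegree ≤ r.denom.natDegree :=
    (natDegree_sub_le _ _).trans (max_le hdeg (natDegree_C_mul_le _ _))
  refine lt_of_le_of_ne hle fun hne => hs0 ?_
  rw [← leadingCoeff_eq_zero, leadingCoeff, hne, hs, coeff_sub, coeff_C_mul,
    (RatFunc.monic_denom r).coeff_natDegree, mul_one, hc, sub_self]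

/-- The residue field at `P` is `k`. Dividing the minimal polynomial of `f` over `k(t)` by a
coefficient of largest valuation and reducing it at infinity gives a nonzero polynomial over `k`
whose value at `f` lies in the maximal ideal. -/
theorem exists_const [IsAlgClosed k] (hP : P.TakesValue Y.covering OnePoint.infty) {f : Y.K}
    (hf : P.ring.valuation f = 1) : ∃ c : k, c ≠ 0 ∧ P.ring.valuation (f - Y.const c) < 1 := by
  set p := minpoly (RatFunc k) f with hp
  have hp0 : p ≠ 0 := minpoly.ne_zero (Algebra.IsIntegral.isIntegral f)
  have hsum : ∑ i ∈ p.support, p.coeff i • f ^ i = 0 := by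
    have := minpoly.aeval (RatFunc k) f
    rwa [← hp, aeval_eq_sum_range, ← sum_over_range (f := fun i a => a • f ^ i) p (by simp), sum_def]
      at this
  obtain ⟨j, hj, hmax⟩ := p.support.exists_max_image
    (fun i => P.ring.valuation (algebraMap (RatFunc k) Y.K (p.coeff i)))
    (nonempty_support_iff.2 hp0)
  have hj0 : p.coeff j ≠ 0 := mem_support_iff.1 hj
  have hj1 : 0 < P.ring.valuation (algebraMap (RatFunc k) Y.K (p.coeff j)) := by
    rw [zero_lt_iff]; simpa using hj0
  have hex : ∀ i, ∃ c : k, i ∈ p.support →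
      P.ring.valuation (algebraMap (RatFunc k) Y.K (p.coeff i / p.coeff j) - Y.const c) < 1 := by
    intro i
    by_cases hi : i ∈ p.support
    · obtain ⟨c, hc⟩ := exists_const_of_ratFunc hP (r := p.coeff i / p.coeff j) (by
        rw [map_div₀, map_div₀, div_le_one₀ hj1]
        exact hmax i hi)
      exact ⟨c, fun _ => hc⟩
    · exact ⟨0, fun h => absurd h hi⟩
  choose c hc using hex
  set q : k[X] := ∑ i ∈ p.support, monomial i (c i) with hq
  have hqj : q.coeff j = c j := by
    rw [hq, finsetSum_coeff]
    simp only [coeff_monomial]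
    rw [Finset.sum_ite_eq' p.support j c, if_pos hj]
  -- The coefficient at `j` is the residue of `1`.
  have hq0 : q ≠ 0 := by
    intro h0
    have h1 := hc j hj
    rw [← hqj, h0] at h1
    simp [hj0] at h1
  have hval : P.ring.valuation (aeval f q) < 1 := by
    have h1 : ∑ i ∈ p.support, (p.coeff i / p.coeff j) • f ^ i = 0 := by
      simp_rw [div_eq_inv_mul, ← smul_smul, ← Finset.smul_sum, hsum, smul_zero]
    have h2 : aeval f q = - ∑ i ∈ p.support,
        (algebraMap (RatFunc k) Y.K (p.coeff i / p.coeff j) - Y.const (c i)) * f ^ i := by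
      simp_rw [sub_mul, Finset.sum_sub_distrib, ← Algebra.smul_def, h1]
      rw [hq, map_sum]
      simp [aeval_monomial, algebraMap_eq_const]
    rw [h2, Valuation.map_neg]
    refine P.ring.valuation.map_sum_lt' zero_lt_one fun i hi => ?_
    rw [map_mul, map_pow, hf, one_pow, mul_one]
    exact hc i hi
  obtain ⟨d, hd⟩ := P.exists_takesValue_of_eval hq0 hval
  refine ⟨d, ?_, hd⟩
  rintro rfl
  rw [takesValue_coe, const_zero, sub_zero, hf] at hd
  exact lt_irrefl _ hd

end Point

theorem order_aeval_covering (p : k[X]) :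
    order (aeval Y.covering p) = Y.degree * p.natDegree := by
  rw [← algebraMap_polynomial, IsScalarTower.algebraMap_apply k[X] (RatFunc k) Y.K,
    order_algebraMap, RatFunc.intDegree_polynomial]

theorem isIntegral_aeval_covering (p : k[X]) : IsIntegral k[X] (aeval Y.covering p) := by
  rw [← algebraMap_polynomial]
  exact isIntegral_algebraMap

namespace IsTotallyRamified

variable {P : Y.Point} {ϖ : Y.K} (h : IsTotallyRamified P ϖ) [CharZero k]
include h

theorem valuation_le_iff {f g : Y.K} (hf : f ≠ 0) (hg : g ≠ 0) :
    P.ring.valuation f ≤ P.ring.valuation g ↔ order f ≤ order g := by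
  rw [h.valuation_eq_order hf, h.valuation_eq_order hg,
    (zpow_right_strictAnti₀ h.isUniformizer.pos h.isUniformizer.lt_one).le_iff_ge]
  omega

theorem order_eq_zero_iff {f : Y.K} (hf : f ≠ 0) :
    P.ring.valuation f = 1 ↔ order f = 0 := by
  have h1 := h.valuation_le_iff hf one_ne_zero
  have h2 := h.valuation_le_iff one_ne_zero hf
  rw [map_one, order_one] at h1 h2
  constructor
  · intro h3
    exact le_antisymm (h1.1 h3.le) (h2.1 h3.ge)
  · intro h3
    exact le_antisymm (h1.2 h3.le) (h2.2 h3.ge)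

theorem order_uniformizer : order ϖ = -1 := by
  have h1 := h.valuation_eq_order h.isUniformizer.ne_zero
  nth_rw 1 [← zpow_one (P.ring.valuation ϖ)] at h1
  have := h.isUniformizer.zpow_injective h1
  omega

variable [IsAlgClosed k]

/-- Functions of equal order agree to leading order up to a constant. -/
theorem exists_sub_const_mul {f g : Y.K} (hf : f ≠ 0) (hg : g ≠ 0) (hfg : order f = order g) :
    ∃ c : k, c ≠ 0 ∧ (f - Y.const c * g = 0 ∨ order (f - Y.const c * g) < order f) := by
  have h0 : f / g ≠ 0 := div_ne_zero hf hg
  have h1 : P.ring.valuation (f / g) = 1 := by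
    rw [h.order_eq_zero_iff h0, div_eq_mul_inv, order_mul hf (inv_ne_zero hg), order_inv hg, hfg]
    ring
  obtain ⟨c, hc, hc'⟩ := Point.exists_const h.takesValue h1
  refine ⟨c, hc, or_iff_not_imp_left.2 fun hne => ?_⟩
  have h2 : f - Y.const c * g = (f / g - Y.const c) * g := by field_simp
  rw [← not_le, ← h.valuation_le_iff hf hne, not_le, h2, map_mul]
  have h3 : P.ring.valuation f = P.ring.valuation g := by
    rw [h.valuation_eq_order hf, h.valuation_eq_order hg, hfg]
  rw [h3]
  have h4 : 0 < P.ring.valuation g := by rw [zero_lt_iff]; simpa using hg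
  exact mul_lt_of_lt_one_left h4 hc'

/-- The trace of a function whose order is a multiple of the degree does not cancel. -/
theorem trace_ne_zero {f : Y.K} (hf : f ≠ 0) {m : ℤ} (hm : order f = Y.degree * m) :
    Algebra.trace (RatFunc k) Y.K f ≠ 0 ∧
      (Algebra.trace (RatFunc k) Y.K f).intDegree = m := by
  -- Scaling by a power of `t` makes `f` a unit at `P` with some residue `c`. Its trace is `n c` up
  -- to the maximal ideal, and `n c ≠ 0` in characteristic zero.
  set g : Y.K := (RatFunc.X ^ (-m) : RatFunc k) • f with hg
  have hX : (RatFunc.X : RatFunc k) ≠ 0 := RatFunc.X_ne_zero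
  have hXm : ∀ m : ℤ, (RatFunc.X ^ m : RatFunc k).intDegree = m := by
    have hnat : ∀ m : ℕ, (RatFunc.X ^ m : RatFunc k).intDegree = m := fun m => by
      rw [← RatFunc.algebraMap_X, ← map_pow, RatFunc.intDegree_polynomial, natDegree_X_pow]
    intro m
    obtain ⟨m, rfl | rfl⟩ := m.eq_nat_or_neg
    · rw [zpow_natCast, hnat]
    · rw [zpow_neg, zpow_natCast, RatFunc.intDegree_inv, hnat]
  have hX' : algebraMap (RatFunc k) Y.K (RatFunc.X ^ (-m)) ≠ 0 := by
    exact (_root_.map_ne_zero _).2 (zpow_ne_zero (-m) hX)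
  have hg0 : g ≠ 0 := by
    rw [hg, Algebra.smul_def]
    exact mul_ne_zero hX' hf
  have hgo : P.ring.valuation g = 1 := by
    rw [h.order_eq_zero_iff hg0, hg, Algebra.smul_def, order_mul hX' hf, order_algebraMap, hXm, hm]
    ring
  obtain ⟨c, hc, hc'⟩ := Point.exists_const h.takesValue hgo
  set T := Algebra.trace (RatFunc k) Y.K g with hT
  have h1 := h.valuation_trace_lt_one hc'
  have h2 : T = Algebra.trace (RatFunc k) Y.K (g - Y.const c) +
      RatFunc.C ((Y.degree : k) * c) := by
    rw [map_sub, const, Algebra.trace_algebraMap, ← CurveCover.degree, ← hT, map_mul, map_natCast,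
      nsmul_eq_mul]
    ring
  have hn : (Y.degree : k) * c ≠ 0 :=
    mul_ne_zero (Nat.cast_ne_zero.2 Module.finrank_pos.ne') hc
  have h3 : P.ring.valuation (algebraMap (RatFunc k) Y.K T) = 1 := by
    rw [h2, map_add, ← P.valuation_const hn]
    refine P.ring.valuation.map_add_eq_of_lt_right ?_
    exact h1.trans_eq (P.valuation_const hn).symm
  have hT0 : T ≠ 0 := by
    intro h0
    rw [h0] at h3
    simp at h3
  have hTd : T.intDegree = 0 := by
    have := (h.order_eq_zero_iff (by simpa using hT0)).1 h3
    rw [order_algebraMap] at this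
    have hd : (Y.degree : ℤ) ≠ 0 := Nat.cast_ne_zero.2 Module.finrank_pos.ne'
    exact (mul_eq_zero.1 this).resolve_left hd
  have h4 : T = RatFunc.X ^ (-m) * Algebra.trace (RatFunc k) Y.K f := by
    rw [hT, hg, map_smul, smul_eq_mul]
  have h5 : Algebra.trace (RatFunc k) Y.K f ≠ 0 := fun h0 => hT0 (by rw [h4, h0, mul_zero])
  refine ⟨h5, ?_⟩
  rw [h4, RatFunc.intDegree_mul (zpow_ne_zero _ hX) h5, hXm] at hTd
  linarith

omit h [IsAlgClosed k] [CharZero k] in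
theorem exists_integral_smul (f : Y.K) :
    ∃ p : k[X], p ≠ 0 ∧ IsIntegral k[X] (aeval Y.covering p * f) := by
  obtain ⟨⟨p, hp⟩, hm⟩ := IsIntegral.exists_multiple_integral_of_isLocalization
    (nonZeroDivisors k[X]) (Rₘ := RatFunc k) f (Algebra.IsIntegral.isIntegral f)
  refine ⟨p, nonZeroDivisors.ne_zero hp, ?_⟩
  rw [← algebraMap_polynomial, ← Algebra.smul_def]
  exact hm

-- Multiplying `ϖ⁻¹ ^ j` by a polynomial in `t` makes it integral and changes its order by a
-- multiple of the degree, so every class modulo the degree occurs.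
omit [IsAlgClosed k] in
theorem exists_integral_order (j : ℕ) : ∃ (m : ℕ) (f : Y.K), f ≠ 0 ∧ IsIntegral k[X] f ∧
    order f = m ∧ m % Y.degree = j % Y.degree := by
  have hϖ := h.isUniformizer.ne_zero
  obtain ⟨p, hp, hint⟩ := exists_integral_smul (ϖ⁻¹ ^ j)
  have h1 : aeval Y.covering p ≠ 0 := fun h0 =>
    hp ((transcendental_iff.1 Y.transcendental_covering) _ h0)
  refine ⟨Y.degree * p.natDegree + j, _, mul_ne_zero h1 (pow_ne_zero _ (inv_ne_zero hϖ)), hint,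
    ?_, by simp⟩
  rw [order_mul h1 (pow_ne_zero _ (inv_ne_zero hϖ)), order_aeval_covering,
    order_pow (inv_ne_zero hϖ), order_inv hϖ, h.order_uniformizer]
  push_cast; ring

/-- Integral functions are polynomials in a function whose only pole is a simple one. -/
theorem exists_aeval_of_order_one {y : Y.K} (hy0 : y ≠ 0) (hy : IsIntegral k[X] y)
    (hy1 : order y = 1) {f : Y.K} (hf : IsIntegral k[X] f) : ∃ p : k[X], f = aeval y p := by
  by_cases hf0 : f = 0
  · exact ⟨0, by simp [hf0]⟩
  obtain ⟨N, hN⟩ := Int.eq_ofNat_of_zero_le (order_nonneg hf)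
  induction N using Nat.strong_induction_on generalizing f with
  | _ N ih =>
    obtain ⟨c, -, hc⟩ := h.exists_sub_const_mul hf0 (pow_ne_zero N hy0)
      (by rw [order_pow hy0, hy1, hN]; simp)
    have hint : IsIntegral k[X] (f - Y.const c * y ^ N) := by
      refine hf.sub (IsIntegral.mul ?_ (hy.pow N))
      rw [← algebraMap_eq_const, IsScalarTower.algebraMap_apply k k[X] Y.K]
      exact isIntegral_algebraMap
    have hex : ∃ p : k[X], f - Y.const c * y ^ N = aeval y p := by
      by_cases h0 : f - Y.const c * y ^ N = 0
      · exact ⟨0, by simp [h0]⟩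
      obtain ⟨M, hM⟩ := Int.eq_ofNat_of_zero_le (order_nonneg hint)
      exact ih M (by have := hc.resolve_left h0; omega) hint h0 hM
    obtain ⟨p, hp⟩ := hex
    refine ⟨p + C c * X ^ N, ?_⟩
    rw [map_add, ← hp, map_mul, aeval_C, algebraMap_eq_const, map_pow, aeval_X]
    ring

/-- `t` is integral, hence a polynomial in `y`; every function is a quotient of integral ones, hence
rational in `y`. -/
theorem isPolynomialCover_of_order_one {y : Y.K} (hy0 : y ≠ 0) (hy : IsIntegral k[X] y)
    (hy1 : order y = 1) :
    P.TakesValue y OnePoint.infty ∧ ∃ F : k[X], Y.IsPolynomialCover y F := by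
  refine ⟨?_, ?_⟩
  · rw [Point.takesValue_infty, h.valuation_eq_order hy0, hy1, zpow_neg, zpow_one]
    exact (one_lt_inv₀ h.isUniformizer.pos).2 h.isUniformizer.lt_one
  obtain ⟨F, hF⟩ := h.exists_aeval_of_order_one hy0 hy hy1
    (by simpa using isIntegral_aeval_covering (Y := Y) X)
  refine ⟨F, ?_, hF⟩
  rw [generates_iff_adjoin, eq_top_iff]
  intro f _
  obtain ⟨p, hp, hint⟩ := exists_integral_smul f
  obtain ⟨q, hq⟩ := h.exists_aeval_of_order_one hy0 hy hy1 hint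
  obtain ⟨r, hr⟩ := h.exists_aeval_of_order_one hy0 hy hy1 (isIntegral_aeval_covering (Y := Y) p)
  have h1 : aeval Y.covering p ≠ 0 := fun h0 =>
    hp ((transcendental_iff.1 Y.transcendental_covering) _ h0)
  have h2 : f = aeval y q / aeval y r := by
    rw [← hq, ← hr]; field_simp
  exact (IntermediateField.mem_adjoin_simple_iff _ _).2 ⟨q, r, h2⟩

/-- If all functions in the trace dual of the integral functions vanish to order less than the
degree at infinity, then there is an integral function with a simple pole. -/
theorem exists_order_one (hdeg : 1 < Y.degree)
    (hdual : ∀ g : Y.K, g ≠ 0 → (∀ b : Y.K, IsIntegral k[X] b →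
      Algebra.trace (RatFunc k) Y.K (g * b) ∈ (algebraMap k[X] (RatFunc k)).range) →
      -(Y.degree : ℤ) < order g) :
    ∃ y : Y.K, y ≠ 0 ∧ IsIntegral k[X] y ∧ order y = 1 := by
  classical
  set n := Y.degree with hn
  have hex : ∀ j : Fin n, ∃ m : ℕ, ∃ f : Y.K, f ≠ 0 ∧ IsIntegral k[X] f ∧ order f = m ∧
      m % n = j := fun j => by
    obtain ⟨m, f, h1, h2, h3, h4⟩ := h.exists_integral_order j
    exact ⟨m, f, h1, h2, h3, h4.trans (Nat.mod_eq_of_lt j.2)⟩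
  -- For each class modulo `n`, `f j` is an integral function of least order `ρ j` in that class.
  choose f hf0 hfint hford hfmod using fun j => Nat.find_spec (hex j)
  set ρ := fun j => Nat.find (hex j) with hρ
  have hmin : ∀ (j : Fin n) (m : ℕ) (g : Y.K), g ≠ 0 → IsIntegral k[X] g → order g = m →
      m % n = j → ρ j ≤ m := fun j m g h1 h2 h3 h4 => Nat.find_min' (hex j) ⟨g, h1, h2, h3, h4⟩
  have hmod : ∀ i j : Fin n, (n : ℤ) ∣ (-(ρ i : ℤ)) - (-(ρ j : ℤ)) → i = j := fun i j hij => by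
    have h1 : (ρ j : ℤ) ≡ ρ i [ZMOD n] :=
      (Int.modEq_iff_dvd.2 (by rwa [show (ρ i : ℤ) - ρ j = -((-(ρ i : ℤ)) - (-(ρ j : ℤ))) by ring,
        dvd_neg]))
    have h2 := (Int.natCast_modEq_iff.1 h1)
    have h3 : ρ j % n = ρ i % n := h2
    exact Fin.ext (by rw [← hfmod i, ← hfmod j]; exact h3.symm)
  have hli : LinearIndependent (RatFunc k) f :=
    Point.linearIndependent_of_order h.takesValue h.isUniformizer h.valuation_eq
      (fun i => by rw [h.valuation_eq_order (hf0 i), hford]) hmod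
  have : Nonempty (Fin n) := ⟨⟨1, hdeg⟩⟩
  set b := basisOfLinearIndependentOfCardEqFinrank hli (by simp [hn, CurveCover.degree]) with hb
  have hbf : ∀ i, b i = f i := fun i => by rw [hb, coe_basisOfLinearIndependentOfCardEqFinrank]
  -- Subtracting a constant multiple of `t ^ q * f j`, with `j` the class of the order, lowers the
  -- order; hence the `f j` span the integral functions over `k[t]`.
  have hspan : ∀ (N : ℕ) (g : Y.K), g ≠ 0 → IsIntegral k[X] g → order g = N →
      g ∈ Submodule.span k[X] (Set.range f) := by
    intro N
    induction N using Nat.strong_induction_on with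
    | _ N ih =>
      intro g hg0 hg hgN
      let j : Fin n := ⟨N % n, Nat.mod_lt _ (by omega)⟩
      have h1 : ρ j ≤ N := hmin j N g hg0 hg hgN rfl
      obtain ⟨q, hq⟩ : n ∣ N - ρ j :=
        (Nat.modEq_iff_dvd' h1).1 (show ρ j % n = N % n from hfmod j)
      have hX : aeval Y.covering (X ^ q : k[X]) ≠ 0 := fun h0 =>
        pow_ne_zero q X_ne_zero ((transcendental_iff.1 Y.transcendental_covering) _ h0)
      obtain ⟨c, -, hc⟩ := h.exists_sub_const_mul hg0 (mul_ne_zero hX (hf0 j)) (by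
        rw [order_mul hX (hf0 j), order_aeval_covering, natDegree_X_pow, hford, hgN, ← hn]
        have : N = n * q + ρ j := by omega
        rw [this]; push_cast; rfl)
      have heq : Y.const c * (aeval Y.covering (X ^ q : k[X]) * f j) = (C c * X ^ q) • f j := by
        rw [Algebra.smul_def, algebraMap_polynomial, map_mul, aeval_C, algebraMap_eq_const,
          mul_assoc]
      rw [heq] at hc
      have hmem : (C c * X ^ q : k[X]) • f j ∈ Submodule.span k[X] (Set.range f) :=
        Submodule.smul_mem _ _ (Submodule.subset_span ⟨j, rfl⟩)
      have hint : IsIntegral k[X] (g - (C c * X ^ q : k[X]) • f j) :=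
        hg.sub ((hfint j).smul _)
      rw [← sub_add_cancel g ((C c * X ^ q : k[X]) • f j)]
      refine add_mem ?_ hmem
      by_cases h0 : g - (C c * X ^ q : k[X]) • f j = 0
      · rw [h0]; exact zero_mem _
      obtain ⟨M, hM⟩ := Int.eq_ofNat_of_zero_le (order_nonneg hint)
      exact ih M (by have := hc.resolve_left h0; omega) _ h0 hint hM
  let j₁ : Fin n := ⟨1, hdeg⟩
  -- The dual basis element for the class of `1`. It lies in the trace dual of the integral
  -- functions since the `f j` span them.
  set g := (Algebra.traceForm (RatFunc k) Y.K).dualBasis (traceForm_nondegenerate _ _) b j₁ with hg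
  have hg0 : g ≠ 0 := Module.Basis.ne_zero _ _
  have hgf : ∀ j, Algebra.trace (RatFunc k) Y.K (g * f j) = if j = j₁ then 1 else 0 := fun j => by
    have := LinearMap.BilinForm.apply_dualBasis_left
      (traceForm_nondegenerate (RatFunc k) Y.K) b j₁ j
    rwa [hbf, Algebra.traceForm_apply] at this
  have hgdual : ∀ a : Y.K, IsIntegral k[X] a →
      Algebra.trace (RatFunc k) Y.K (g * a) ∈ (algebraMap k[X] (RatFunc k)).range := by
    intro a ha
    by_cases ha0 : a = 0
    · rw [ha0, mul_zero, map_zero]; exact zero_mem _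
    obtain ⟨N, hN⟩ := Int.eq_ofNat_of_zero_le (order_nonneg ha)
    have key : ∀ x ∈ Submodule.span k[X] (Set.range f),
        Algebra.trace (RatFunc k) Y.K (g * x) ∈ (algebraMap k[X] (RatFunc k)).range := by
      intro x hx
      induction hx using Submodule.span_induction with
      | mem x hx =>
        obtain ⟨j, rfl⟩ := hx
        rw [hgf]
        split_ifs
        · exact one_mem _
        · exact zero_mem _
      | zero => rw [mul_zero, map_zero]; exact zero_mem _
      | add x z _ _ hx hz => rw [mul_add, map_add]; exact add_mem hx hz
      | smul r x _ hx =>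
        rw [mul_smul_comm, ← algebraMap_smul (RatFunc k) r (g * x), map_smul, smul_eq_mul]
        exact mul_mem ⟨r, rfl⟩ hx
    exact key a (hspan N a ha0 ha hN)
  -- The orders of the `f l` meet all classes, so some `g * f l` has order divisible by `n`. Its
  -- trace does not cancel, so duality forces `l = j₁`; the trace then being `1`, the orders of `g`
  -- and `f j₁` are opposite.
  obtain ⟨l, m, hlm⟩ : ∃ (l : Fin n) (m : ℤ), order (g * f l) = n * m := by
    have hn0 : (0 : ℤ) < n := by omega
    have hnn := Int.emod_nonneg (-order g) hn0.ne'
    have hlt := Int.emod_lt_of_pos (-order g) hn0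
    refine ⟨⟨((-order g) % n).toNat, by omega⟩, ?_⟩
    generalize hl : (⟨((-order g) % n).toNat, _⟩ : Fin n) = l
    have h1 : (ρ l : ℤ) % n = (-order g) % n := by
      have h2 : ρ l % n = l := hfmod l
      have h3 : (l : ℕ) = ((-order g) % n).toNat := by rw [← hl]
      omega
    have h4 : (n : ℤ) ∣ ρ l - (-order g) := (Int.ModEq.symm h1).dvd
    rw [order_mul hg0 (hf0 l), hford]
    obtain ⟨m, hm⟩ := h4
    exact ⟨m, by rw [← hm]; ring⟩
  obtain ⟨h1, h2⟩ := h.trace_ne_zero (mul_ne_zero hg0 (hf0 l)) hlm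
  rw [hgf] at h1 h2
  split_ifs at h1 h2 with hl
  · subst hl
    rw [RatFunc.intDegree_one] at h2
    rw [← h2, mul_zero, order_mul hg0 (hf0 _), hford] at hlm
    -- The bound on the trace dual gives `ρ j₁ < n`, and `ρ j₁` is congruent to `1` modulo `n`.
    have h3 := hdual g hg0 hgdual
    have h4 : ρ j₁ < n := by
      have : order g = -(ρ j₁ : ℤ) := by simp only [hρ]; omega
      omega
    have h5 : ρ j₁ = 1 := by
      have : ρ j₁ % n = 1 := hfmod j₁
      rwa [Nat.mod_eq_of_lt h4] at this
    refine ⟨f j₁, hf0 _, hfint _, ?_⟩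
    rw [hford]
    exact_mod_cast h5
  · exact absurd rfl h1

end IsTotallyRamified
end CurveCover

/-! ### Tameness of the different and its relative norm. -/

/-- In a finite algebra over a field of characteristic zero, idempotents of trace zero vanish. -/
theorem IsIdempotentElem.eq_zero_of_trace_eq_zero {F R : Type*} [Field F] [CharZero F]
    [CommRing R] [Algebra F R] [Module.Finite F R] {x : R} (hx : IsIdempotentElem x)
    (h : Algebra.trace F R x = 0) : x = 0 := by
  have h1 : IsIdempotentElem (Algebra.lmul F R x) := hx.map (Algebra.lmul F R)
  have h2 := LinearMap.IsIdempotentElem.eq_zero_of_trace_eq_zero h1 h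
  simpa using LinearMap.congr_fun h2 1

section Different

attribute [local instance] FractionRing.liftAlgebra

open UniqueFactorizationMonoid

variable {A B : Type*} [CommRing A] [CommRing B] [Algebra A B] 
  [IsDedekindDomain A]
  [IsDedekindDomain B] [Module.IsTorsionFree A B] [Module.Finite A B]
  [Algebra.IsSeparable (FractionRing A) (FractionRing B)]

/-- In residue characteristic zero the different is not divisible by the full power with which a
prime divides its restriction. -/
theorem not_pow_ramificationIdx_dvd_differentIdeal (p : Ideal A) [p.IsMaximal] (hp : p ≠ ⊥)
    [CharZero (A ⧸ p)] (P : Ideal B) [P.IsMaximal] [P.LiesOver p] :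
    ¬ P ^ P.ramificationIdx A ∣ differentIdeal A B := by
  have hpB : p.map (algebraMap A B) ≠ ⊥ := Ideal.map_ne_bot_of_ne_bot hp
  have hP0 : P ≠ ⊥ := Ideal.ne_bot_of_liesOver_of_ne_bot hp P
  have hPp : Prime P := Ideal.prime_of_isPrime hP0 inferInstance
  have hfin : FiniteMultiplicity P (p.map (algebraMap A B)) :=
    FiniteMultiplicity.of_prime_left hPp hpB
  obtain ⟨Q, hQ, hPQ⟩ := hfin.exists_eq_pow_mul_and_not_dvd
  rw [← Ideal.IsDedekindDomain.ramificationIdx_eq_multiplicity p P hpB] at hQ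
  set e := P.ramificationIdx A with he
  have he0 : e ≠ 0 := by
    intro h0
    rw [h0, pow_zero, one_mul] at hQ
    refine hPQ ?_
    rw [← hQ, Ideal.dvd_iff_le]
    exact Ideal.map_le_of_le_comap (P.over_def p).le
  have hcop : IsCoprime (P ^ e) Q := by
    refine IsCoprime.pow_left ?_
    rw [Ideal.isCoprime_iff_sup_eq]
    by_contra hne
    have h1 : P = P ⊔ Q := Ideal.IsMaximal.eq_of_le inferInstance hne le_sup_left
    exact hPQ (Ideal.dvd_iff_le.2 (h1 ▸ le_sup_right))
  -- As `z + x = 1` with `z ∈ P ^ e` and `x ∈ Q`, the class of `x` modulo `p B = P ^ e * Q` is the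
  -- idempotent of the component at `P`.
  obtain ⟨z, hz, x, hx, hzx⟩ := Ideal.isCoprime_iff_exists.1 hcop
  -- It suffices that the trace of `x` is not in `p`. Otherwise the idempotent has trace zero and
  -- vanishes, so that `x`, and with it `1 = z + x`, lies in `P`.
  refine not_dvd_differentIdeal_of_intTrace_not_mem A (P ^ e) Q hQ.symm x hx fun htr => ?_
  let := Ideal.Quotient.field p
  set pB := p.map (algebraMap A B) with hpBdef
  have h1 : Algebra.trace (A ⧸ p) (B ⧸ pB) (Ideal.Quotient.mk pB x) = 0 := by
    rw [Algebra.trace_quotient_eq_of_isDedekindDomain]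
    exact Ideal.Quotient.eq_zero_iff_mem.2 htr
  have hidem : IsIdempotentElem (Ideal.Quotient.mk pB x) := by
    rw [IsIdempotentElem, ← map_mul, Ideal.Quotient.eq]
    have : x * x - x = -(z * x) := by linear_combination x * hzx
    rw [this, neg_mem_iff, hQ]
    exact Ideal.mul_mem_mul hz hx
  have : Module.Finite (A ⧸ p) (B ⧸ pB) := Module.Finite.of_restrictScalars_finite A _ _
  have h2 := hidem.eq_zero_of_trace_eq_zero h1
  rw [Ideal.Quotient.eq_zero_iff_mem] at h2
  have h3 : x ∈ P := Ideal.map_le_of_le_comap (P.over_def p).le h2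
  have h4 : z ∈ P := Ideal.pow_le_self he0 hz
  exact (Ideal.ne_top_iff_one P).1 (Ideal.IsMaximal.ne_top inferInstance) (hzx ▸ add_mem h4 h3)

theorem count_differentIdeal_lt_ramificationIdx [DecidableEq (Ideal B)]
    (p : Ideal A) [p.IsMaximal] (hp : p ≠ ⊥)
    [CharZero (A ⧸ p)] (P : Ideal B) [P.IsMaximal] [P.LiesOver p] :
    (normalizedFactors (differentIdeal A B)).count P < P.ramificationIdx A := by
  have hP0 : P ≠ ⊥ := Ideal.ne_bot_of_liesOver_of_ne_bot hp P
  have hPp : Prime P := Ideal.prime_of_isPrime hP0 inferInstance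
  have hD : differentIdeal A B ≠ 0 := differentIdeal_ne_bot
  by_contra hlt
  refine not_pow_ramificationIdx_dvd_differentIdeal p hp P ?_
  rw [pow_dvd_iff_le_emultiplicity, emultiplicity_eq_count_normalizedFactors hPp.irreducible hD,
    normalize_eq]
  exact_mod_cast not_lt.1 hlt

end Different

section RelNorm

variable {k : Type*} [Field k] [CharZero k] {B : Type*} [CommRing B] [Algebra k[X] B]
  [IsDedekindDomain B] [Module.IsTorsionFree k[X] B] [Module.Finite k[X] B]

/-- The norm of a prime over `(X - c)` is the power of `(X - c)` whose exponent is the inertia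
degree; multiply these generators. -/
theorem exists_mem_relNorm_prod (s : Multiset (Ideal B))
    (hs : ∀ P ∈ s, P.IsMaximal ∧ ∃ c : k, P.under k[X] = Ideal.span {X - C c}) :
    ∃ Δ ∈ Ideal.relNorm k[X] s.prod, Δ.Monic ∧
      Δ.natDegree = (s.map fun P => P.inertiaDeg k[X]).sum := by
  induction s using Multiset.induction with
  | empty => exact ⟨1, by simp, monic_one, by simp⟩
  | cons P s ih =>
    obtain ⟨Δ, h1, h2, h3⟩ := ih fun P hP => hs P (Multiset.mem_cons_of_mem hP)
    obtain ⟨hP, c, hc⟩ := hs P (Multiset.mem_cons_self P s)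
    have hmax : (Ideal.span {X - C c} : Ideal k[X]).IsMaximal := by
      rw [← hc]; infer_instance
    have : P.LiesOver (Ideal.span {X - C c} : Ideal k[X]) := ⟨hc.symm⟩
    refine ⟨(X - C c) ^ P.inertiaDeg k[X] * Δ, ?_, ((monic_X_sub_C c).pow _).mul h2, ?_⟩
    · rw [Multiset.prod_cons, map_mul,
        Ideal.relNorm_eq_pow_of_isMaximal P (Ideal.span {X - C c} : Ideal k[X])]
      exact Ideal.mul_mem_mul (Ideal.pow_mem_pow (Ideal.mem_span_singleton_self _) _) h1
    · rw [((monic_X_sub_C c).pow _).natDegree_mul h2, natDegree_pow, natDegree_X_sub_C, mul_one, h3,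
        Multiset.map_cons, Multiset.sum_cons]

end RelNorm

/-! ### Finite points as primes of the ring of integral functions. -/

section Separation

variable {B : Type*} [CommRing B] [IsDedekindDomain B]

/-- The localization of a Dedekind domain at a prime is a valuation ring. -/
theorem exists_mul_eq_mul_notMem (P : Ideal B) [P.IsPrime] (hP : P ≠ ⊥) {a b : B} (ha : a ≠ 0)
    (hb : b ≠ 0) : ∃ j ∉ P, ∃ c, b * j = a * c ∨ a * j = b * c := by
  have hPp : Prime P := Ideal.prime_of_isPrime hP inferInstance
  have key : ∀ {a b : B}, a ≠ 0 → (Ideal.span {b} : Ideal B) ≤ P ^ multiplicity P (Ideal.span {a}) →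
      ∃ j ∉ P, ∃ c, b * j = a * c := by
    intro a b ha hab
    -- Write `(a) = P ^ m * J` with `J` not inside `P`, and take `j ∈ J` outside `P`; then `b * j ∈
    -- (a)` as soon as `b ∈ P ^ m`.
    obtain ⟨J, hJ, hPJ⟩ := (FiniteMultiplicity.of_prime_left hPp
      (show (Ideal.span {a} : Ideal B) ≠ 0 by simpa using ha)).exists_eq_pow_mul_and_not_dvd
    rw [Ideal.dvd_iff_le, SetLike.not_le_iff_exists] at hPJ
    obtain ⟨j, hj, hjP⟩ := hPJ
    refine ⟨j, hjP, ?_⟩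
    have : b * j ∈ Ideal.span {a} := by
      rw [hJ]
      exact Ideal.mul_mem_mul (hab (Ideal.mem_span_singleton_self b)) hj
    obtain ⟨c, hc⟩ := Ideal.mem_span_singleton'.1 this
    exact ⟨c, by rw [← hc, mul_comm]⟩
  rcases le_total (multiplicity P (Ideal.span {a})) (multiplicity P (Ideal.span {b})) with h | h
  · obtain ⟨j, hj, c, hc⟩ := key (a := a) (b := b) ha
      ((Ideal.dvd_iff_le.1 (pow_multiplicity_dvd P _)).trans (Ideal.pow_le_pow_right h))
    exact ⟨j, hj, c, Or.inl hc⟩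
  · obtain ⟨j, hj, c, hc⟩ := key (a := b) (b := a) hb
      ((Ideal.dvd_iff_le.1 (pow_multiplicity_dvd P _)).trans (Ideal.pow_le_pow_right h))
    exact ⟨j, hj, c, Or.inr hc⟩

end Separation

namespace CurveCover

variable {k : Type u} [Field k] {Y : CurveCover k}

variable (Y) in
/-- The functions on `Y` which are regular away from `∞`. -/
noncomputable abbrev integers : Subalgebra k[X] Y.K := integralClosure k[X] Y.K

section Instances

variable [CharZero k]

instance : IsDedekindDomain Y.integers :=
  IsIntegralClosure.isDedekindDomain k[X] (RatFunc k) Y.K Y.integers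

instance : Module.Finite k[X] Y.integers :=
  IsIntegralClosure.finite k[X] (RatFunc k) Y.K Y.integers

omit [CharZero k] in
theorem injective_algebraMap_polynomial : Function.Injective (algebraMap k[X] Y.K) := by
  rw [IsScalarTower.algebraMap_eq k[X] (RatFunc k) Y.K]
  exact (algebraMap (RatFunc k) Y.K).injective.comp (IsFractionRing.injective k[X] (RatFunc k))

instance : Module.IsTorsionFree k[X] Y.K :=
  Module.isTorsionFree_iff_algebraMap_injective.2 injective_algebraMap_polynomial

instance : Module.IsTorsionFree k[X] Y.integers := inferInstance

instance : IsFractionRing Y.integers Y.K :=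
  integralClosure.isFractionRing_of_finite_extension (RatFunc k) Y.K

theorem finrank_integers : Module.finrank k[X] Y.integers = Y.degree :=
  IsIntegralClosure.rank k[X] (RatFunc k) Y.K Y.integers

end Instances

namespace Point

variable {P : Y.Point}

/-- The local ring contains `k[t]` and is integrally closed. -/
theorem mem_ring_of_isIntegral (hP : P.ring.valuation Y.covering ≤ 1) {f : Y.K}
    (hf : IsIntegral k[X] f) : f ∈ P.ring := by
  have hmem : ∀ p : k[X], algebraMap k[X] Y.K p ∈ P.ring.toSubring := fun p => by
    rw [algebraMap_polynomial]
    exact (P.ring.valuation_le_one_iff _).1 (P.valuation_aeval_le hP p)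
  have h1 : IsIntegral P.ring f := by
    exact hf.map_of_comp_eq ((algebraMap k[X] Y.K).codRestrict P.ring.toSubring hmem)
      (RingHom.id Y.K) rfl
  obtain ⟨y, rfl⟩ := IsIntegrallyClosed.isIntegral_iff.1 h1
  exact y.2

/-- The prime ideal of regular functions vanishing at a finite point. -/
noncomputable def center (hP : P.ring.valuation Y.covering ≤ 1) : Ideal Y.integers :=
  (IsLocalRing.maximalIdeal P.ring).comap
    ((algebraMap Y.integers Y.K).codRestrict P.ring.toSubring
      fun b => mem_ring_of_isIntegral hP b.2)

theorem mem_center (hP : P.ring.valuation Y.covering ≤ 1) {b : Y.integers} :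
    b ∈ center hP ↔ P.ring.valuation (b : Y.K) < 1 :=
  (P.ring.valuation_lt_one_iff _)

instance (hP : P.ring.valuation Y.covering ≤ 1) : (center hP).IsPrime := by
  unfold center; infer_instance

theorem center_liesOver {τ : k} (h : P.TakesValue Y.covering (τ : OnePoint k)) :
    (center h.mem).LiesOver (Ideal.span {X - C τ} : Ideal k[X]) := by
  constructor
  refine Ideal.IsMaximal.eq_of_le (PrincipalIdealRing.isMaximal_of_irreducible
    (irreducible_X_sub_C τ)) (Ideal.IsPrime.ne_top inferInstance) ?_
  rw [Ideal.span_singleton_le_iff_mem]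
  change algebraMap k[X] Y.integers (X - C τ) ∈ center h.mem
  rw [mem_center]
  change P.ring.valuation (algebraMap k[X] Y.K (X - C τ)) < 1
  rw [algebraMap_polynomial, map_sub, aeval_X, aeval_C, algebraMap_eq_const]
  exact h

variable [CharZero k]

/-- A quotient `b / a` of integral functions can be rewritten so that its numerator or its
denominator is outside the common center. Its regularity can then be read off from the center alone.
-/
theorem mem_ring_of_center_eq {Q : Y.Point} (hP : P.ring.valuation Y.covering ≤ 1)
    (hQ : Q.ring.valuation Y.covering ≤ 1) (hne : center hP ≠ ⊥)
    (h : center hP = center hQ) {f : Y.K} (hf : f ∈ P.ring) : f ∈ Q.ring := by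
  by_cases hf0 : f = 0
  · rw [hf0]; exact zero_mem _
  obtain ⟨b, a, ha, hba⟩ := IsFractionRing.div_surjective Y.integers f
  replace hba : (b : Y.K) / a = f := hba
  subst hba
  have ha0 : a ≠ 0 := nonZeroDivisors.ne_zero ha
  have hb0 : b ≠ 0 := by rintro rfl; simp at hf0
  have ha' : (a : Y.K) ≠ 0 := by simpa using ha0
  have hb' : (b : Y.K) ≠ 0 := by simpa using hb0
  obtain ⟨j, hj, c, hc⟩ := exists_mul_eq_mul_notMem (center hP) hne ha0 hb0
  have hj' : (j : Y.K) ≠ 0 := by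
    rintro h0
    have : j = 0 := by exact_mod_cast h0
    exact hj (this ▸ zero_mem _)
  have hjP : ∀ {R : Y.Point} (hR : R.ring.valuation Y.covering ≤ 1), j ∉ center hR →
      R.ring.valuation (j : Y.K) = 1 := fun {R} hR hjR => by
    rw [mem_center, not_lt] at hjR
    exact le_antisymm ((R.ring.valuation_le_one_iff _).2 (mem_ring_of_isIntegral hR j.2)) hjR
  rw [← ValuationSubring.valuation_le_one_iff] at hf ⊢
  rcases hc with hc | hc
  · have h1 : (b : Y.K) / a = (c : Y.K) / j := by
      rw [div_eq_div_iff ha' hj']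
      exact_mod_cast hc.trans (mul_comm _ _)
    rw [h1, map_div₀, hjP hQ (h ▸ hj), div_one]
    exact (Q.ring.valuation_le_one_iff _).2 (mem_ring_of_isIntegral hQ c.2)
  · have hc0 : (c : Y.K) ≠ 0 := by
      intro h0
      have h2 : c = 0 := by exact_mod_cast h0
      rw [h2, mul_zero] at hc
      rcases mul_eq_zero.1 hc with h3 | h3
      · exact ha0 h3
      · exact hj (h3 ▸ zero_mem _)
    have h1 : (b : Y.K) / a = (j : Y.K) / c := by
      rw [div_eq_div_iff ha' hc0]
      exact_mod_cast hc.symm.trans (mul_comm _ _)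
    have hvc : ∀ {R : Y.Point} (hR : R.ring.valuation Y.covering ≤ 1), j ∉ center hR →
        (R.ring.valuation ((b : Y.K) / a) ≤ 1 ↔
          c ∉ center hR) := fun {R} hR hjR => by
      have h0 : 0 < R.ring.valuation (c : Y.K) := by rw [zero_lt_iff]; simpa using hc0
      rw [h1, map_div₀, hjP hR hjR, mem_center, not_lt, div_le_one₀ h0]
    rw [hvc hP hj] at hf
    rw [hvc hQ (h ▸ hj), ← h]
    exact hf

theorem center_ne_bot {τ : k} (h : P.TakesValue Y.covering (τ : OnePoint k)) :
    center h.mem ≠ ⊥ := by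
  have := center_liesOver h
  refine Ideal.ne_bot_of_liesOver_of_ne_bot (p := Ideal.span {X - C τ}) ?_ _
  rw [Ne, Ideal.span_singleton_eq_bot]
  exact X_sub_C_ne_zero τ

theorem eq_of_center_eq {Q : Y.Point} {τ : k} (hP : P.TakesValue Y.covering (τ : OnePoint k))
    (hQ : Q.TakesValue Y.covering (τ : OnePoint k)) (h : center hP.mem = center hQ.mem) :
    P = Q :=
  ext_ring (SetLike.ext fun _ => ⟨mem_ring_of_center_eq hP.mem hQ.mem (center_ne_bot hP) h,
    mem_ring_of_center_eq hQ.mem hP.mem (center_ne_bot hQ) h.symm⟩)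

/-- Only the injectivity of `P ↦ center P` is needed, since fewer points only weaken the bound on
the different. -/
theorem card_le_ncard_primesOver {τ : k} {S : Finset Y.Point}
    (hS : ∀ P ∈ S, P.TakesValue Y.covering (τ : OnePoint k)) :
    S.card ≤ Nat.card ((Ideal.span {X - C τ} : Ideal k[X]).primesOver Y.integers) := by
  have : (Ideal.span {X - C τ} : Ideal k[X]).IsMaximal :=
    PrincipalIdealRing.isMaximal_of_irreducible (irreducible_X_sub_C τ)
  have hfin : Finite ((Ideal.span {X - C τ} : Ideal k[X]).primesOver Y.integers) := inferInstance
  rw [← Fintype.card_coe, ← Nat.card_eq_fintype_card]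
  refine Nat.card_le_card_of_injective
    (fun P : S => (⟨center (hS P P.2).mem, inferInstance, center_liesOver (hS P P.2)⟩ :
      (Ideal.span {X - C τ} : Ideal k[X]).primesOver Y.integers)) fun P Q hPQ => ?_
  exact Subtype.ext (eq_of_center_eq (hS P P.2) (hS Q Q.2) (congrArg Subtype.val hPQ))

end Point

/-! ### Bounding the different by the ramification. -/

section Bound

variable [CharZero k] [IsAlgClosed k]

open UniqueFactorizationMonoid in
/-- The degree of the norm of the different is bounded by the total ramification. -/
theorem exists_mem_relNorm_differentIdeal (T : Finset k) (r : k → ℕ)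
    (hr : ∀ τ : k, ∃ S : Finset Y.Point, (∀ P ∈ S, P.TakesValue Y.covering (τ : OnePoint k)) ∧
      S.card = r τ) (hT : ∀ τ ∉ T, r τ = Y.degree) :
    ∃ Δ ∈ Ideal.relNorm k[X] (differentIdeal k[X] Y.integers), Δ.Monic ∧
      Δ.natDegree ≤ ∑ τ ∈ T, (Y.degree - r τ) := by
  classical
  set D := differentIdeal k[X] Y.integers with hD
  have hD0 : D ≠ 0 := differentIdeal_ne_bot
  have hfac : ∀ P ∈ normalizedFactors D, P.IsMaximal ∧
      ∃ c : k, P.under k[X] = Ideal.span {X - C c} := by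
    intro P hP
    have hPp := prime_of_normalized_factor P hP
    have h1 : P.IsPrime := Ideal.isPrime_of_prime hPp
    have h2 : P.IsMaximal := h1.isMaximal hPp.ne_zero
    refine ⟨h2, ?_⟩
    have h3 : (P.under k[X]).IsMaximal := inferInstance
    obtain ⟨q, hq⟩ := (IsPrincipalIdealRing.principal (P.under k[X])).principal
    have hq' : P.under k[X] = Ideal.span {q} := hq
    have hq0 : q ≠ 0 := by
      rintro rfl
      refine Ring.ne_bot_of_isMaximal_of_not_isField h3 (Polynomial.not_isField k) ?_
      rw [hq']; simp
    have hirr : Irreducible q := by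
      rw [hq'] at h3
      exact ((Ideal.span_singleton_prime hq0).1 h3.isPrime).irreducible
    obtain ⟨c, hc⟩ := IsAlgClosed.exists_root q
      (by rw [IsAlgClosed.degree_eq_one_of_irreducible k hirr]; simp)
    refine ⟨c, (h3.eq_of_le ?_ ?_)⟩
    · exact (PrincipalIdealRing.isMaximal_of_irreducible (irreducible_X_sub_C c)).ne_top
    · rw [hq', Ideal.span_singleton_le_span_singleton]
      exact dvd_iff_isRoot.2 hc
  obtain ⟨Δ, h1, h2, h3⟩ := exists_mem_relNorm_prod (normalizedFactors D) hfac
  rw [Ideal.prod_normalizedFactors_eq_self hD0] at h1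
  refine ⟨Δ, h1, h2, ?_⟩
  rw [h3, Finset.sum_multiset_map_count]
  choose! c hc using fun P hP => (hfac P hP).2
  set s := (normalizedFactors D).toFinset with hs
  calc ∑ P ∈ s, (normalizedFactors D).count P • P.inertiaDeg k[X]
      = ∑ τ ∈ s.image c ∪ T, ∑ P ∈ s with c P = τ,
          (normalizedFactors D).count P • P.inertiaDeg k[X] :=
        (Finset.sum_fiberwise_of_maps_to (fun P hP => Finset.mem_union_left _
          (Finset.mem_image_of_mem c hP)) _).symm
    _ ≤ ∑ τ ∈ s.image c ∪ T, (Y.degree - r τ) := Finset.sum_le_sum fun τ _ => ?_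
    _ = ∑ τ ∈ T, (Y.degree - r τ) := by
        refine (Finset.sum_subset Finset.subset_union_right fun τ _ hτ => ?_).symm
        rw [hT τ hτ, Nat.sub_self]
  set p : Ideal k[X] := Ideal.span {X - C τ} with hp
  have hpmax : p.IsMaximal := PrincipalIdealRing.isMaximal_of_irreducible (irreducible_X_sub_C τ)
  have hp0 : p ≠ ⊥ := by
    rw [hp, Ne, Ideal.span_singleton_eq_bot]; exact X_sub_C_ne_zero τ
  have hchar : CharZero (k[X] ⧸ p) := charZero_of_injective_algebraMap (algebraMap k (k[X] ⧸ p)).injective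
  have : Fintype (p.primesOver Y.integers) := Fintype.ofFinite _
  have hsum := Ideal.sum_ramification_inertia_eq_finrank p Y.integers
  rw [finrank_integers] at hsum
  obtain ⟨S, hS, hSr⟩ := hr τ
  have hcard := Point.card_le_ncard_primesOver hS
  rw [hSr, ← hp, Nat.card_eq_fintype_card] at hcard
  have hmemover : ∀ P ∈ s.filter (fun P => c P = τ), P ∈ p.primesOver Y.integers := fun P hP => by
    obtain ⟨hP, hPτ⟩ := Finset.mem_filter.1 hP
    have hP' := Multiset.mem_toFinset.1 hP
    exact ⟨(hfac P hP').1.isPrime, ⟨by rw [hc P hP', hPτ]⟩⟩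
  -- By tameness a prime over `τ` contributes at most `(e - 1) f` to the degree. As `∑ e f = n` and
  -- each `f ≥ 1`, the sum over the fibre is at most `n` minus the number of primes.
  have hle : ∑ P ∈ s with c P = τ, (normalizedFactors D).count P • P.inertiaDeg k[X] + r τ ≤
      Y.degree := by
    calc _ ≤ ∑ P : p.primesOver Y.integers,
          (normalizedFactors D).count P.1 • P.1.inertiaDeg k[X] +
          ∑ P : p.primesOver Y.integers, 1 := by
          refine add_le_add ?_ (by simpa using hcard)
          refine le_trans ?_ (Finset.sum_map (Finset.univ : Finset (p.primesOver Y.integers))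
            (Function.Embedding.subtype _)
            fun P => (normalizedFactors D).count P • P.inertiaDeg k[X]).le
          refine Finset.sum_le_sum_of_subset fun P hP => ?_
          exact Finset.mem_map.2 ⟨⟨P, hmemover P hP⟩, Finset.mem_univ _, rfl⟩
      _ ≤ _ := by
          rw [← hsum, ← Finset.sum_add_distrib]
          refine Finset.sum_le_sum fun P _ => ?_
          have hPp : P.1.IsPrime := P.2.1
          have hPl : P.1.LiesOver p := P.2.2
          have hPm : P.1.IsMaximal :=
            hPp.isMaximal (Ideal.ne_bot_of_liesOver_of_ne_bot hp0 P.1)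
          have h4 := count_differentIdeal_lt_ramificationIdx p hp0 P.1
          have h5 := P.1.inertiaDeg_pos k[X]
          rw [smul_eq_mul]
          calc _ ≤ (normalizedFactors D).count P.1 * P.1.inertiaDeg k[X] + P.1.inertiaDeg k[X] := by
                omega
            _ = ((normalizedFactors D).count P.1 + 1) * P.1.inertiaDeg k[X] := by ring
            _ ≤ _ := Nat.mul_le_mul_right _ h4
  omega

/-- The different is the inverse of the trace dual, so `g` times the different is integral. Taking
norms, `N(g) Δ` is a polynomial, and `Δ` has degree less than `n`. -/
theorem order_of_dual {T : Finset k} {r : k → ℕ}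
    (hr : ∀ τ : k, ∃ S : Finset Y.Point, (∀ P ∈ S, P.TakesValue Y.covering (τ : OnePoint k)) ∧
      S.card = r τ) (hT : ∀ τ ∉ T, r τ = Y.degree) (hsum : ∑ τ ∈ T, (Y.degree - r τ) < Y.degree)
    {g : Y.K} (hg0 : g ≠ 0) (hg : ∀ b : Y.K, IsIntegral k[X] b →
      Algebra.trace (RatFunc k) Y.K (g * b) ∈ (algebraMap k[X] (RatFunc k)).range) :
    -(Y.degree : ℤ) < order g := by
  obtain ⟨Δ, h1, h2, h3⟩ := exists_mem_relNorm_differentIdeal T r hr hT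
  have h10 : (1 : FractionalIdeal (nonZeroDivisors Y.integers) Y.K) ≠ 0 := one_ne_zero
  have hmul : ∀ d ∈ differentIdeal k[X] Y.integers, IsIntegral k[X] (g * (d : Y.K)) := by
    intro d hd
    have hgd : g ∈ FractionalIdeal.dual k[X] (RatFunc k)
        (1 : FractionalIdeal (nonZeroDivisors Y.integers) Y.K) := by
      rw [FractionalIdeal.mem_dual h10]
      intro a ha
      obtain ⟨b, rfl⟩ := FractionalIdeal.mem_one_iff _ |>.1 ha
      exact hg _ b.2
    have hd' : (d : Y.K) ∈ (differentIdeal k[X] Y.integers :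
        FractionalIdeal (nonZeroDivisors Y.integers) Y.K) :=
      FractionalIdeal.mem_coeIdeal_of_mem _ hd
    rw [coeIdeal_differentIdeal k[X] (RatFunc k) Y.K Y.integers] at hd'
    have := FractionalIdeal.mul_mem_mul hgd hd'
    rw [mul_inv_cancel₀ (FractionalIdeal.dual_ne_zero _ _ h10)] at this
    obtain ⟨b, hb⟩ := FractionalIdeal.mem_one_iff _ |>.1 this
    rw [← hb]
    exact b.2
  have key : ∀ x ∈ Ideal.relNorm k[X] (differentIdeal k[X] Y.integers),
      Algebra.norm (RatFunc k) g * algebraMap k[X] (RatFunc k) x ∈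
        (algebraMap k[X] (RatFunc k)).range := by
    intro x hx
    rw [Ideal.relNorm_apply] at hx
    induction hx using Submodule.span_induction with
    | mem x hx =>
      obtain ⟨d, hd, rfl⟩ := hx
      rw [Algebra.algebraMap_intNorm (L := Y.K) (B := Y.integers), ← map_mul]
      exact IsIntegrallyClosed.isIntegral_iff.1 (Algebra.isIntegral_norm (RatFunc k) (hmul d hd))
    | zero => rw [map_zero, mul_zero]; exact zero_mem _
    | add x z _ _ hx hz => rw [map_add, mul_add]; exact add_mem hx hz
    | smul a x _ hx =>
      rw [smul_eq_mul, map_mul, mul_left_comm]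
      exact mul_mem ⟨a, rfl⟩ hx
  obtain ⟨q, hq⟩ := key Δ h1
  have hΔ : algebraMap k[X] (RatFunc k) Δ ≠ 0 := by
    simpa using h2.ne_zero
  have h4 : (Algebra.norm (RatFunc k) g * algebraMap k[X] (RatFunc k) Δ).intDegree =
      order g + Δ.natDegree := by
    rw [RatFunc.intDegree_mul (norm_ne_zero hg0) hΔ, RatFunc.intDegree_polynomial, order]
  rw [← hq, RatFunc.intDegree_polynomial] at h4
  omega

end Bound

end CurveCover

/-! ### The quadratics `A, B, C, D` and the linear system for a given triple point. -/

namespace Semicubical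

section Defs

variable {R : Type*} [CommRing R] (a b d : ℕ) (x : R)

/-- The quadratic polynomial `A`. -/
def polyA : R :=
  -2 * (a + b + 2 * d) * x * (a + d) + (a + d) * (a + 2 * d) + (a + b + 2 * d) * x ^ 2 * (a + b + d)

/-- The quadratic polynomial `B`. -/
def polyB : R := a * (a + d) - 2 * a * (a + b + 2 * d) * x + (a + b + 2 * d) * x ^ 2 * (a + b + d)

/-- The quadratic polynomial `C`. -/
def polyC : R := x ^ 2 * (a + b) * (a + b + d) - 2 * a * x * (a + b + d) + a * (a + d)

/-- The quadratic polynomial `D`. -/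
def polyD : R := (a + b + 2 * d) * x ^ 2 * (a + b) + a * (a + 2 * d) - 2 * a * (a + b + 2 * d) * x

/-- The numerator of the Belyi map. -/
def numer : R := a ^ a * b ^ b * polyA a b d x ^ (a + d) * polyB a b d x ^ (b + d) *
  polyD a b d x ^ d

/-- The denominator of the Belyi map. -/
def denom : R := 2 ^ d * d ^ (2 * d) * (a + b + 2 * d) ^ (a + b + 2 * d) * x ^ (a + 2 * d) *
  (1 - x) ^ (b + 2 * d) * polyC a b d x ^ (a + b + d)

variable {S : Type*} [CommRing S] (f : R →+* S)

theorem map_polyA : f (polyA a b d x) = polyA a b d (f x) := by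
  simp [polyA, map_ofNat f 2]

theorem map_polyB : f (polyB a b d x) = polyB a b d (f x) := by
  simp [polyB, map_ofNat f 2]

theorem map_polyC : f (polyC a b d x) = polyC a b d (f x) := by
  simp [polyC, map_ofNat f 2]

theorem map_polyD : f (polyD a b d x) = polyD a b d (f x) := by
  simp [polyD, map_ofNat f 2]

theorem map_numer : f (numer a b d x) = numer a b d (f x) := by
  simp [numer, map_polyA, map_polyB, map_polyD]

theorem map_denom : f (denom a b d x) = denom a b d (f x) := by
  simp [denom, map_polyC, map_ofNat f 2]

/-- This matches `n C w = a A` with `n C (1 - w) = b B`. -/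
theorem polyC_sub_polyA :
    (a + b + 2 * d) * polyC a b d x - a * polyA a b d x = b * polyB a b d x := by
  simp only [polyA, polyB, polyC]; ring

/-- A nonzero constant in the ideal of `C` and `D`: they have no common zero. -/
theorem polyC_sub_polyD :
    (a + b + d) * polyD a b d x - (a + b + 2 * d) * polyC a b d x = a * b * d := by
  simp only [polyD, polyC]; ring

theorem polyA_zero : polyA a b d (0 : R) = (a + d) * (a + 2 * d) := by simp only [polyA]; ring
theorem polyB_zero : polyB a b d (0 : R) = a * (a + d) := by simp only [polyB]; ring
theorem polyD_zero : polyD a b d (0 : R) = a * (a + 2 * d) := by simp only [polyD]; ring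
theorem polyA_one : polyA a b d (1 : R) = b * (b + d) := by simp only [polyA]; ring
theorem polyB_one : polyB a b d (1 : R) = (b + d) * (b + 2 * d) := by simp only [polyB]; ring
theorem polyD_one : polyD a b d (1 : R) = b * (b + 2 * d) := by simp only [polyD]; ring

/-- The left side is a combination of `A` and `B` without constant term, so `A` and `B` have no
common zero. -/
theorem polyA_polyB_relation :
    4 * d ^ 2 * (a + b + 2 * d) * polyB a b d x -
      (polyA a b d x - polyB a b d x) * ((a + b + d) *
        (polyA a b d x - polyB a b d x) - 4 * d * ((a + d) * (a + b + d) - a * (a + b + 2 * d))) =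
      4 * d ^ 3 * (a + d) * (b + d) := by
  simp only [polyA, polyB]; ring

/-- The cubic polynomial whose cube is the numerator of the logarithmic derivative. -/
def polyT : R := (a + b + 2 * d) * x * polyC a b d x - a * polyA a b d x

end Defs

section Field

set_option linter.unusedSectionVars false

variable {k : Type*} [Field k] [CharZero k] {a b d : ℕ} (ha : 0 < a) (hb : 0 < b) (hd : 0 < d)
include ha hb hd

/-- At a zero of `C` the relation `n C = a A + b B` makes the vanishing of `A` and of `B`
equivalent, and they have no common zero. -/
theorem polyC_ne_zero_or (x : k) (hC : polyC a b d x = 0) :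
    polyA a b d x ≠ 0 ∧ polyB a b d x ≠ 0 ∧ polyD a b d x ≠ 0 := by
  have ha' : (a : k) ≠ 0 := Nat.cast_ne_zero.2 ha.ne'
  have hb' : (b : k) ≠ 0 := Nat.cast_ne_zero.2 hb.ne'
  have hd' : (d : k) ≠ 0 := Nat.cast_ne_zero.2 hd.ne'
  have had : (a + d : k) ≠ 0 := by exact_mod_cast (by omega : a + d ≠ 0)
  have hbd : (b + d : k) ≠ 0 := by exact_mod_cast (by omega : b + d ≠ 0)
  have h1 := polyC_sub_polyA a b d x
  have h2 := polyC_sub_polyD a b d x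
  have h3 := polyA_polyB_relation a b d x
  rw [hC] at h1 h2
  have key : ¬ (polyA a b d x = 0 ∧ polyB a b d x = 0) := by
    rintro ⟨hA, hB⟩
    rw [hA, hB] at h3
    have : (4 * d ^ 3 * (a + d) * (b + d) : k) ≠ 0 := by
      refine mul_ne_zero (mul_ne_zero (mul_ne_zero (by norm_num) (pow_ne_zero _ hd')) had) hbd
    apply this
    rw [← h3]; ring
  refine ⟨fun hA => key ⟨hA, ?_⟩, fun hB => key ⟨?_, hB⟩, fun hD => ?_⟩
  · rw [hA] at h1
    have : (b : k) * polyB a b d x = 0 := by rw [← h1]; ring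
    exact (mul_eq_zero.1 this).resolve_left hb'
  · rw [hB] at h1
    have : (a : k) * polyA a b d x = 0 := by linear_combination -h1
    exact (mul_eq_zero.1 this).resolve_left ha'
  · rw [hD] at h2
    have : (a * b * d : k) ≠ 0 := mul_ne_zero (mul_ne_zero ha' hb') hd'
    apply this
    rw [← h2]; ring

theorem ne_zero_of_denom_ne_zero {x : k} (h : denom a b d x ≠ 0) :
    x ≠ 0 ∧ 1 - x ≠ 0 ∧ polyC a b d x ≠ 0 := by
  refine ⟨?_, ?_, ?_⟩ <;> intro h0 <;> apply h <;> rw [denom, h0]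
  · rw [zero_pow (by omega)]; ring
  · rw [zero_pow (n := b + 2 * d) (by omega)]; ring
  · rw [zero_pow (n := a + b + d) (by omega)]; ring

theorem ne_zero_of_numer_ne_zero {x : k} (h : numer a b d x ≠ 0) :
    polyA a b d x ≠ 0 ∧ polyB a b d x ≠ 0 ∧ polyD a b d x ≠ 0 := by
  refine ⟨?_, ?_, ?_⟩ <;> intro h0 <;> apply h <;> rw [numer, h0]
  · rw [zero_pow (n := a + d) (by omega)]; ring
  · rw [zero_pow (n := b + d) (by omega)]; ring
  · rw [zero_pow (by omega)]; ring

theorem numer_ne_zero {x : k} (hA : polyA a b d x ≠ 0) (hB : polyB a b d x ≠ 0)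
    (hD : polyD a b d x ≠ 0) : numer a b d x ≠ 0 := by
  have ha' : (a : k) ≠ 0 := Nat.cast_ne_zero.2 ha.ne'
  have hb' : (b : k) ≠ 0 := Nat.cast_ne_zero.2 hb.ne'
  exact mul_ne_zero (mul_ne_zero (mul_ne_zero (mul_ne_zero (pow_ne_zero _ ha')
    (pow_ne_zero _ hb')) (pow_ne_zero _ hA)) (pow_ne_zero _ hB)) (pow_ne_zero _ hD)

theorem denom_ne_zero {x : k} (h0 : x ≠ 0) (h1 : 1 - x ≠ 0) (hC : polyC a b d x ≠ 0) :
    denom a b d x ≠ 0 := by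
  have hd' : (d : k) ≠ 0 := Nat.cast_ne_zero.2 hd.ne'
  have hn : (a + b + 2 * d : k) ≠ 0 := by exact_mod_cast (by omega : a + b + 2 * d ≠ 0)
  exact mul_ne_zero (mul_ne_zero (mul_ne_zero (mul_ne_zero (mul_ne_zero
    (pow_ne_zero _ two_ne_zero) (pow_ne_zero _ hd')) (pow_ne_zero _ hn)) (pow_ne_zero _ h0))
    (pow_ne_zero _ h1)) (pow_ne_zero _ hC)

/-- The numerator and the denominator of the Belyi map have no common zero. -/
theorem numer_ne_zero_of_denom_eq_zero {x : k} (h : denom a b d x = 0) : numer a b d x ≠ 0 := by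
  have ha' : (a : k) ≠ 0 := Nat.cast_ne_zero.2 ha.ne'
  have hb' : (b : k) ≠ 0 := Nat.cast_ne_zero.2 hb.ne'
  have had : (a + d : k) ≠ 0 := by exact_mod_cast (by omega : a + d ≠ 0)
  have hbd : (b + d : k) ≠ 0 := by exact_mod_cast (by omega : b + d ≠ 0)
  have had2 : (a + 2 * d : k) ≠ 0 := by exact_mod_cast (by omega : a + 2 * d ≠ 0)
  have hbd2 : (b + 2 * d : k) ≠ 0 := by exact_mod_cast (by omega : b + 2 * d ≠ 0)
  by_cases h0 : x = 0
  · subst h0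
    refine numer_ne_zero ha hb hd ?_ ?_ ?_
    · rw [polyA_zero]; exact mul_ne_zero had had2
    · rw [polyB_zero]; exact mul_ne_zero ha' had
    · rw [polyD_zero]; exact mul_ne_zero ha' had2
  by_cases h1 : 1 - x = 0
  · obtain rfl : x = 1 := (sub_eq_zero.1 h1).symm
    refine numer_ne_zero ha hb hd ?_ ?_ ?_
    · rw [polyA_one]; exact mul_ne_zero hb' hbd
    · rw [polyB_one]; exact mul_ne_zero hbd hbd2
    · rw [polyD_one]; exact mul_ne_zero hb' hbd2
  by_cases hC : polyC a b d x = 0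
  · obtain ⟨hA, hB, hD⟩ := polyC_ne_zero_or ha hb hd x hC
    exact numer_ne_zero ha hb hd hA hB hD
  · exact absurd h (denom_ne_zero ha hb hd h0 h1 hC)

omit ha hb hd in
/-- The linear system for the coefficients of the quadratic factor `y² + p y + q` and the critical
point `w`, for a given triple point `x`. -/
structure System (a b d : ℕ) (x w p q : k) : Prop where
  at_zero : a * q = (a + b + 2 * d) * x ^ 2 * w
  at_one : b * (1 + p + q) = (a + b + 2 * d) * (1 - x) ^ 2 * (1 - w)
  sum : (a + b + d) * p = a + 2 * d - (a + b + 2 * d) * (2 * x + w)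

-- Elimination of `p` and `q`: the determinant of the system in `w, p, q` is `n C`, and this is
-- Cramer's rule for `w`.
omit ha hb hd in
theorem System.mul_polyC {x w p q : k} (h : System a b d x w p q) :
    (a + b + 2 * d) * polyC a b d x * w = a * polyA a b d x := by
  obtain ⟨h1, h2, h3⟩ := h
  simp only [polyA, polyC]
  linear_combination a * (a + b + d) * h2 - a * b * h3 - b * (a + b + d) * h1

omit ha hb hd in
theorem System.mul_polyC_one_sub {x w p q : k} (h : System a b d x w p q) :
    (a + b + 2 * d) * polyC a b d x * (1 - w) = b * polyB a b d x := by
  rw [mul_sub, mul_one, h.mul_polyC, polyC_sub_polyA]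

/-- Where the determinant vanishes the system is inconsistent, because `A` does not vanish there. -/
theorem System.polyC_ne_zero {x w p q : k} (h : System a b d x w p q) : polyC a b d x ≠ 0 := by
  intro hC
  have ha' : (a : k) ≠ 0 := Nat.cast_ne_zero.2 ha.ne'
  have h1 := h.mul_polyC
  rw [hC, mul_zero, zero_mul, zero_eq_mul] at h1
  exact (polyC_ne_zero_or ha hb hd x hC).1 (h1.resolve_left ha')

/-- The factor `a (a + b + d)` clears the denominators of `p` and `q`; after inserting `w` an
identity of polynomials in `x` remains. It gives the factors `x² (1 - x)²` which enter the
denominator of `π`. -/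
theorem System.quadratic_at_triple {x w p q : k} (h : System a b d x w p q) :
    (x ^ 2 + p * x + q) * polyC a b d x = 2 * d ^ 2 * x ^ 2 * (1 - x) ^ 2 := by
  have ha' : (a : k) ≠ 0 := Nat.cast_ne_zero.2 ha.ne'
  have hm : (a + b + d : k) ≠ 0 := by exact_mod_cast (by omega : a + b + d ≠ 0)
  have hw := h.mul_polyC
  obtain ⟨h1, h2, h3⟩ := h
  refine mul_left_cancel₀ (mul_ne_zero ha' hm) ?_
  have key : a * (a + b + d) * ((x ^ 2 + p * x + q) * polyC a b d x) =
      a * (a + b + d) * x ^ 2 * polyC a b d x +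
      a * x * polyC a b d x * (a + 2 * d - 2 * (a + b + 2 * d) * x) +
      ((a + b + d) * x ^ 2 - a * x) * (a * polyA a b d x) := by
    linear_combination a * polyC a b d x * x * h3 + (a + b + d) * polyC a b d x * h1 +
      ((a + b + d) * x ^ 2 - a * x) * hw
  rw [key]
  simp only [polyA, polyC]
  ring

theorem System.quadratic_at_double {x w p q : k} (h : System a b d x w p q) :
    (w ^ 2 + p * w + q) * (a + b + 2 * d) ^ 2 * polyC a b d x ^ 2 =
      polyA a b d x * polyB a b d x * polyD a b d x := by
  have ha' : (a : k) ≠ 0 := Nat.cast_ne_zero.2 ha.ne'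
  have hm : (a + b + d : k) ≠ 0 := by exact_mod_cast (by omega : a + b + d ≠ 0)
  have hw := h.mul_polyC
  obtain ⟨h1, h2, h3⟩ := h
  refine mul_left_cancel₀ (mul_ne_zero ha' hm) ?_
  have key : a * (a + b + d) * ((w ^ 2 + p * w + q) * (a + b + 2 * d) ^ 2 * polyC a b d x ^ 2) =
      (a * (a + b + d) - a * (a + b + 2 * d)) * (a * polyA a b d x) ^ 2 +
      (a * (a + b + 2 * d) * polyC a b d x * (a + 2 * d - 2 * (a + b + 2 * d) * x) +
        (a + b + d) * (a + b + 2 * d) ^ 2 * x ^ 2 * polyC a b d x) * (a * polyA a b d x) := by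
    linear_combination a * w * (a + b + 2 * d) ^ 2 * polyC a b d x ^ 2 * h3 +
      (a + b + d) * (a + b + 2 * d) ^ 2 * polyC a b d x ^ 2 * h1 +
      ((a * (a + b + d) - a * (a + b + 2 * d)) * ((a + b + 2 * d) * polyC a b d x * w +
        a * polyA a b d x) +
      (a * (a + b + 2 * d) * polyC a b d x * (a + 2 * d - 2 * (a + b + 2 * d) * x) +
        (a + b + d) * (a + b + 2 * d) ^ 2 * x ^ 2 * polyC a b d x)) * hw
  rw [key]
  simp only [polyA, polyB, polyC, polyD]
  ring

/-- The value of the Belyi map is the quotient of the values of `yᵃ (1 - y)ᵇ (y² + p y + q)ᵈ` at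
the double point and at the triple point. -/
theorem System.numer_mul {x w p q : k} (h : System a b d x w p q) :
    numer a b d x * (x ^ a * (1 - x) ^ b * (x ^ 2 + p * x + q) ^ d) =
      denom a b d x * (w ^ a * (1 - w) ^ b * (w ^ 2 + p * w + q) ^ d) := by
  have hA := h.mul_polyC
  have hB := h.mul_polyC_one_sub
  have hQ : polyA a b d x * polyB a b d x * polyD a b d x * (x ^ 2 + p * x + q) =
      2 * d ^ 2 * (a + b + 2 * d) ^ 2 * x ^ 2 * (1 - x) ^ 2 * polyC a b d x *
        (w ^ 2 + p * w + q) := by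
    rw [← h.quadratic_at_double ha hb hd]
    linear_combination (w ^ 2 + p * w + q) * (a + b + 2 * d) ^ 2 * polyC a b d x *
      h.quadratic_at_triple ha hb hd
  rw [numer, denom]
  generalize x ^ 2 + p * x + q = Qx at *
  generalize w ^ 2 + p * w + q = Qw at *
  generalize polyA a b d x = A at *
  generalize polyB a b d x = B at *
  generalize polyC a b d x = C at *
  generalize polyD a b d x = D at *
  generalize (a + b + 2 * d : k) = n at *
  -- The numerator regroups into powers of `a A`, `b B` and `A B D`, each of which the system
  -- expresses through `w` and `Q`.
  calc _ = (a * A) ^ a * (b * B) ^ b * (A * B * D * Qx) ^ d * (x ^ a * (1 - x) ^ b) := by ring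
    _ = _ := by
      rw [hQ, ← hA, ← hB]
      generalize 1 - x = x'
      generalize 1 - w = w'
      ring

theorem exists_system {x : k} (hC : polyC a b d x ≠ 0) : ∃ w p q, System a b d x w p q := by
  have ha' : (a : k) ≠ 0 := Nat.cast_ne_zero.2 ha.ne'
  have hm : (a + b + d : k) ≠ 0 := by exact_mod_cast (by omega : a + b + d ≠ 0)
  have hn : (a + b + 2 * d : k) ≠ 0 := by exact_mod_cast (by omega : a + b + 2 * d ≠ 0)
  obtain ⟨w, hw⟩ : ∃ w, (a + b + 2 * d) * polyC a b d x * w = a * polyA a b d x :=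
    ⟨a * polyA a b d x / ((a + b + 2 * d) * polyC a b d x), by field_simp⟩
  obtain ⟨q, hq⟩ : ∃ q, a * q = (a + b + 2 * d) * x ^ 2 * w :=
    ⟨(a + b + 2 * d) * x ^ 2 * w / a, by field_simp⟩
  obtain ⟨p, hp⟩ : ∃ p, (a + b + d) * p = a + 2 * d - (a + b + 2 * d) * (2 * x + w) :=
    ⟨(a + 2 * d - (a + b + 2 * d) * (2 * x + w)) / (a + b + d), by field_simp⟩
  refine ⟨w, p, q, hq, mul_left_cancel₀ (mul_ne_zero ha' hm) ?_, hp⟩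
  simp only [polyA, polyC] at hw
  linear_combination hw + a * b * hp + b * (a + b + d) * hq

theorem System.unique {x w p q w' p' q' : k} (h : System a b d x w p q)
    (h' : System a b d x w' p' q') : w = w' ∧ p = p' ∧ q = q' := by
  have ha' : (a : k) ≠ 0 := Nat.cast_ne_zero.2 ha.ne'
  have hm : (a + b + d : k) ≠ 0 := by exact_mod_cast (by omega : a + b + d ≠ 0)
  have hn : (a + b + 2 * d : k) ≠ 0 := by exact_mod_cast (by omega : a + b + 2 * d ≠ 0)
  have hC := h.polyC_ne_zero ha hb hd
  obtain rfl : w = w' :=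
    mul_left_cancel₀ (mul_ne_zero hn hC) (h.mul_polyC.trans h'.mul_polyC.symm)
  exact ⟨rfl, mul_left_cancel₀ hm (h.sum.trans h'.sum.symm),
    mul_left_cancel₀ ha' (h.at_zero.trans h'.at_zero.symm)⟩

theorem System.denom_ne_zero {x w p q : k} (h : System a b d x w p q) (hx0 : x ≠ 0)
    (hx1 : 1 - x ≠ 0) : denom a b d x ≠ 0 :=
  Semicubical.denom_ne_zero ha hb hd hx0 hx1 (h.polyC_ne_zero ha hb hd)

theorem System.quadratic_at_triple_ne_zero {x w p q : k} (h : System a b d x w p q) (hx0 : x ≠ 0)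
    (hx1 : 1 - x ≠ 0) : x ^ 2 + p * x + q ≠ 0 := by
  have hd' : (d : k) ≠ 0 := Nat.cast_ne_zero.2 hd.ne'
  intro h0
  have := h.quadratic_at_triple ha hb hd
  rw [h0, zero_mul] at this
  exact (mul_ne_zero (mul_ne_zero (mul_ne_zero two_ne_zero (pow_ne_zero _ hd'))
    (pow_ne_zero _ hx0)) (pow_ne_zero _ hx1)) this.symm

/-- Where the logarithmic derivative vanishes, the Belyi map takes the value one. -/
theorem numer_eq_denom_of_polyT {x : k} (hden : denom a b d x ≠ 0) (hT : polyT a b d x = 0) :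
    numer a b d x = denom a b d x := by
  obtain ⟨h0, h1, hC⟩ := ne_zero_of_denom_ne_zero ha hb hd hden
  have hn : (a + b + 2 * d : k) ≠ 0 := by exact_mod_cast (by omega : a + b + 2 * d ≠ 0)
  obtain ⟨w, p, q, h⟩ := exists_system ha hb hd hC
  have hw : w = x := by
    refine mul_left_cancel₀ (mul_ne_zero hn hC) (h.mul_polyC.trans ?_)
    rw [polyT, sub_eq_zero] at hT
    rw [← hT]; ring
  subst hw
  have := h.numer_mul ha hb hd
  exact mul_right_cancel₀ (mul_ne_zero (mul_ne_zero (pow_ne_zero _ h0) (pow_ne_zero _ h1))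
    (pow_ne_zero _ (h.quadratic_at_triple_ne_zero ha hb hd h0 h1))) this

end Field

end Semicubical

/-! ### Fibres of a rational function written as a coprime quotient. -/

section Quotient

variable {K : Type*} [Field K]

/-- The common factor by which `N` and `M` differ from the reduced fraction divides both, hence is a
unit. -/
theorem exists_eq_C_mul_num_of_isCoprime {N M : K[X]} (hM : M ≠ 0) (h : IsCoprime N M) :
    ∃ u : K, u ≠ 0 ∧ N = C u * (algebraMap K[X] (RatFunc K) N / algebraMap K[X] (RatFunc K) M).num ∧
      M = C u * (algebraMap K[X] (RatFunc K) N / algebraMap K[X] (RatFunc K) M).denom := by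
  set f := algebraMap K[X] (RatFunc K) N / algebraMap K[X] (RatFunc K) M with hf
  obtain ⟨r, hr⟩ : f.denom ∣ M := RatFunc.denom_div_dvd N M
  have h1 : f.num * M = N * f.denom := by
    have hM' : algebraMap K[X] (RatFunc K) M ≠ 0 := RatFunc.algebraMap_ne_zero hM
    have hd' : algebraMap K[X] (RatFunc K) f.denom ≠ 0 :=
      RatFunc.algebraMap_ne_zero f.denom_ne_zero
    apply RatFunc.algebraMap_injective K
    rw [map_mul, map_mul, ← div_eq_div_iff hd' hM', RatFunc.num_div_denom, hf]
  have h2 : N = r * f.num := by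
    refine mul_right_cancel₀ f.denom_ne_zero ?_
    rw [← h1, hr]; ring
  have hu : IsUnit r := h.isUnit_of_dvd' (by rw [h2]; exact dvd_mul_right _ _)
    (by rw [hr]; exact dvd_mul_left _ _)
  obtain ⟨c, hc, rfl⟩ := Polynomial.isUnit_iff.1 hu
  exact ⟨c, hc.ne_zero, h2, by rw [mul_comm]; exact hr⟩

variable {π : RatFunc ℚ} {N M : ℚ[X]} {u : ℚ} (hu : u ≠ 0) (hN : N = C u * π.num)
  (hM : M = C u * π.denom)
include hu hN hM

theorem inFibre_coe_iff {k : Type*} [Field k] [CharZero k] (v c : k) :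
    InFibre π v (c : OnePoint k) ↔ aeval c N = v * aeval c M := by
  have hu' : algebraMap ℚ k u ≠ 0 := by simpa using hu
  change aeval c π.num = v * aeval c π.denom ↔ _
  rw [hN, hM, map_mul, map_mul, aeval_C, mul_left_comm v]
  exact (mul_right_injective₀ hu').eq_iff.symm

/-- The function vanishes at infinity, whereas `v ≠ 0`. -/
theorem not_inFibre_infty {k : Type*} [Field k] [CharZero k] {v : k} (hv : v ≠ 0)
    (h : N.degree < M.degree) : ¬ InFibre π v (OnePoint.infty : OnePoint k) := by
  rw [hN, hM, degree_C_mul hu, degree_C_mul hu] at h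
  change ¬ (_ < _)
  rw [max_eq_right h.le, sub_eq_add_neg, degree_add_eq_right_of_degree_lt, degree_neg,
    degree_C_mul hv, degree_map]
  · exact lt_irrefl _
  · rwa [degree_neg, degree_C_mul hv, degree_map, degree_map]

theorem isBelyiMap_of_separable (h : N.natDegree < M.natDegree)
    (hs : ∀ v : ℂ, v ≠ 0 → v ≠ 1 →
      (N.map (algebraMap ℚ ℂ) - C v * M.map (algebraMap ℚ ℂ)).Separable) : IsBelyiMap π := by
  have hNd : N.natDegree = π.num.natDegree := by rw [hN, natDegree_C_mul hu]
  have hMd : M.natDegree = π.denom.natDegree := by rw [hM, natDegree_C_mul hu]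
  rw [hNd, hMd] at h
  have hu' : algebraMap ℚ ℂ u ≠ 0 := by simpa using hu
  refine ⟨lt_max_of_lt_right (by omega), fun v hv0 hv1 => ⟨?_, ?_⟩⟩
  · have := hs v hv0 hv1
    rw [hN, hM, Polynomial.map_mul, Polynomial.map_mul, map_C, mul_left_comm (C v), ← mul_sub]
      at this
    exact this.of_mul_right
  · rw [max_eq_right h.le, sub_eq_add_neg, natDegree_add_eq_right_of_natDegree_lt, natDegree_neg,
      natDegree_C_mul hv0, natDegree_map]
    · omega
    · rwa [natDegree_neg, natDegree_C_mul hv0, natDegree_map, natDegree_map]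

end Quotient

/-! ### The logarithmic derivative of the map and the Belyi property. -/

namespace Semicubical

/-- The factor `p` on the left avoids the exponent `m - 1`, so that `m = 0` is no exception. -/
theorem derivative_pow_mul_self {R : Type*} [CommRing R] (p : R[X]) (m : ℕ) :
    derivative (p ^ m) * p = m * derivative p * p ^ m := by
  cases m with
  | zero => simp
  | succ m => rw [derivative_pow_succ]; simp; ring

section Ring

variable {R : Type*} [CommRing R] (a b d : ℕ)

theorem polyA_X : polyA a b d (X : R[X]) =
    C ((a + b + 2 * d) * (a + b + d) : R) * X ^ 2 +
      C (-2 * (a + b + 2 * d) * (a + d) : R) * X + C ((a + d) * (a + 2 * d) : R) := by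
  simp only [polyA, map_mul, map_add, map_neg, map_natCast, C_ofNat]; ring

theorem derivative_polyA : derivative (polyA a b d (X : R[X])) =
    2 * C ((a + b + 2 * d) * (a + b + d) : R) * X + C (-2 * (a + b + 2 * d) * (a + d) : R) := by
  rw [polyA_X]
  simp only [derivative_add, derivative_C_mul, derivative_X_pow, derivative_X, derivative_C,
    C_ofNat, Nat.cast_ofNat]; ring

theorem polyB_X : polyB a b d (X : R[X]) =
    C ((a + b + 2 * d) * (a + b + d) : R) * X ^ 2 +
      C (-2 * a * (a + b + 2 * d) : R) * X + C (a * (a + d) : R) := by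
  simp only [polyB, map_mul, map_add, map_neg, map_natCast, C_ofNat]; ring

theorem derivative_polyB : derivative (polyB a b d (X : R[X])) =
    2 * C ((a + b + 2 * d) * (a + b + d) : R) * X + C (-2 * a * (a + b + 2 * d) : R) := by
  rw [polyB_X]
  simp only [derivative_add, derivative_C_mul, derivative_X_pow, derivative_X, derivative_C,
    C_ofNat, Nat.cast_ofNat]; ring

theorem polyC_X : polyC a b d (X : R[X]) =
    C ((a + b) * (a + b + d) : R) * X ^ 2 +
      C (-2 * a * (a + b + d) : R) * X + C (a * (a + d) : R) := by
  simp only [polyC, map_mul, map_add, map_neg, map_natCast, C_ofNat]; ring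

theorem derivative_polyC : derivative (polyC a b d (X : R[X])) =
    2 * C ((a + b) * (a + b + d) : R) * X + C (-2 * a * (a + b + d) : R) := by
  rw [polyC_X]
  simp only [derivative_add, derivative_C_mul, derivative_X_pow, derivative_X, derivative_C,
    C_ofNat, Nat.cast_ofNat]; ring

theorem polyD_X : polyD a b d (X : R[X]) =
    C ((a + b + 2 * d) * (a + b) : R) * X ^ 2 +
      C (-2 * a * (a + b + 2 * d) : R) * X + C (a * (a + 2 * d) : R) := by
  simp only [polyD, map_mul, map_add, map_neg, map_natCast, C_ofNat]; ring

theorem derivative_polyD : derivative (polyD a b d (X : R[X])) =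
    2 * C ((a + b + 2 * d) * (a + b) : R) * X + C (-2 * a * (a + b + 2 * d) : R) := by
  rw [polyD_X]
  simp only [derivative_add, derivative_C_mul, derivative_X_pow, derivative_X, derivative_C,
    C_ofNat, Nat.cast_ofNat]; ring

theorem derivative_numer_mul :
    derivative (numer a b d (X : R[X])) * (polyA a b d X * polyB a b d X * polyD a b d X) =
      numer a b d X * (((a + d : ℕ) : R[X]) * derivative (polyA a b d (X : R[X])) * polyB a b d X * polyD a b d X
        + ((b + d : ℕ) : R[X]) * polyA a b d X * derivative (polyB a b d (X : R[X])) * polyD a b d X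
        + (d : R[X]) * polyA a b d X * polyB a b d X * derivative (polyD a b d (X : R[X]))) := by
  have hA := derivative_pow_mul_self (polyA a b d (X : R[X])) (a + d)
  have hB := derivative_pow_mul_self (polyB a b d (X : R[X])) (b + d)
  have hD := derivative_pow_mul_self (polyD a b d (X : R[X])) d
  have h0 : derivative ((a : R[X]) ^ a * (b : R[X]) ^ b) = 0 := by
    rw [← Nat.cast_pow, ← Nat.cast_pow, ← Nat.cast_mul, derivative_natCast]
  rw [numer, derivative_mul, derivative_mul, derivative_mul, h0]
  generalize derivative (polyA a b d (X : R[X]) ^ (a + d)) = A'' at *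
  generalize derivative (polyB a b d (X : R[X]) ^ (b + d)) = B'' at *
  generalize derivative (polyD a b d (X : R[X]) ^ d) = D'' at *
  generalize polyA a b d (X : R[X]) ^ (a + d) = As at *
  generalize polyB a b d (X : R[X]) ^ (b + d) = Bs at *
  generalize polyD a b d (X : R[X]) ^ d = Ds at *
  generalize (a : R[X]) ^ a * (b : R[X]) ^ b = c at *
  linear_combination c * Bs * Ds * polyB a b d X * polyD a b d X * hA +
    c * As * Ds * polyA a b d X * polyD a b d X * hB +
    c * As * Bs * polyA a b d X * polyB a b d X * hD

theorem derivative_denom_mul :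
    derivative (denom a b d (X : R[X])) * (X * (1 - X) * polyC a b d X) =
      denom a b d X * (((a + 2 * d : ℕ) : R[X]) * (1 - X) * polyC a b d X -
        ((b + 2 * d : ℕ) : R[X]) * X * polyC a b d X + ((a + b + d : ℕ) : R[X]) * X * (1 - X) * derivative (polyC a b d (X : R[X]))) := by
  have hC := derivative_pow_mul_self (polyC a b d (X : R[X])) (a + b + d)
  have h1 := derivative_pow_mul_self (X : R[X]) (a + 2 * d)
  have h2 := derivative_pow_mul_self (1 - X : R[X]) (b + 2 * d)
  have h0 : derivative ((2 : R[X]) ^ d * (d : R[X]) ^ (2 * d) *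
      ((a : R[X]) + (b : R[X]) + 2 * (d : R[X])) ^ (a + b + 2 * d)) = 0 := by
    have : ((2 : R[X]) ^ d * (d : R[X]) ^ (2 * d) * ((a : R[X]) + (b : R[X]) + 2 * (d : R[X])) ^ (a + b + 2 * d)) =
      ((2 ^ d * d ^ (2 * d) * (a + b + 2 * d) ^ (a + b + 2 * d) : ℕ) : R[X]) := by push_cast; ring
    rw [this, derivative_natCast]
  rw [derivative_X, mul_one] at h1
  rw [derivative_sub, derivative_one, derivative_X] at h2
  rw [denom, derivative_mul, derivative_mul, derivative_mul, h0]
  generalize derivative (polyC a b d (X : R[X]) ^ (a + b + d)) = A'' at *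
  generalize derivative ((X : R[X]) ^ (a + 2 * d)) = B'' at *
  generalize derivative ((1 - X : R[X]) ^ (b + 2 * d)) = D'' at *
  generalize polyC a b d (X : R[X]) ^ (a + b + d) = As at *
  generalize (X : R[X]) ^ (a + 2 * d) = Bs at *
  generalize (1 - X : R[X]) ^ (b + 2 * d) = Ds at *
  generalize (2 : R[X]) ^ d * (d : R[X]) ^ (2 * d) *
      ((a : R[X]) + (b : R[X]) + 2 * (d : R[X])) ^ (a + b + 2 * d) = c at *
  linear_combination c * Bs * Ds * X * (1 - X) * hC +
    c * As * Ds * (1 - X) * polyC a b d X * h1 +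
    c * As * Bs * X * polyC a b d X * h2

/-- The identity `π' / π = T³ / (A B D x (1 - x) C)` cleared of denominators. After division by `N
M` it is a polynomial identity in `a, b, d, X`. -/
theorem wronskian_numer_denom :
    (derivative (numer a b d (X : R[X])) * denom a b d X -
      numer a b d X * derivative (denom a b d (X : R[X]))) *
      (polyA a b d X * polyB a b d X * polyD a b d X * (X * (1 - X) * polyC a b d X)) =
    numer a b d X * denom a b d X * polyT a b d X ^ 3 := by
  have key : (((a + d : ℕ) : R[X]) * derivative (polyA a b d (X : R[X])) * polyB a b d X * polyD a b d X
        + ((b + d : ℕ) : R[X]) * polyA a b d X * derivative (polyB a b d (X : R[X])) * polyD a b d X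
        + (d : R[X]) * polyA a b d X * polyB a b d X * derivative (polyD a b d (X : R[X]))) *
        (X * (1 - X) * polyC a b d X) - polyA a b d X * polyB a b d X * polyD a b d X *
        (((a + 2 * d : ℕ) : R[X]) * (1 - X) * polyC a b d X -
        ((b + 2 * d : ℕ) : R[X]) * X * polyC a b d X + ((a + b + d : ℕ) : R[X]) * X * (1 - X) * derivative (polyC a b d (X : R[X]))) =
        polyT a b d (X : R[X]) ^ 3 := by
    rw [derivative_polyA, derivative_polyB, derivative_polyC, derivative_polyD]
    simp only [polyT, polyA, polyB, polyC, polyD, map_mul, map_add, map_neg, map_natCast, C_ofNat]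
    push_cast
    ring
  linear_combination denom a b d (X : R[X]) * (X * (1 - X) * polyC a b d X) *
    derivative_numer_mul (R := R) a b d - numer a b d (X : R[X]) *
    (polyA a b d X * polyB a b d X * polyD a b d X) * derivative_denom_mul (R := R) a b d +
    numer a b d (X : R[X]) * denom a b d X * key

end Ring

section Field

variable {k : Type*} [Field k] (a b d : ℕ)

theorem eval_numer (c : k) : (numer a b d (X : k[X])).eval c = numer a b d c := by
  simpa using map_numer a b d (X : k[X]) (evalRingHom c)

theorem eval_denom (c : k) : (denom a b d (X : k[X])).eval c = denom a b d c := by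
  simpa using map_denom a b d (X : k[X]) (evalRingHom c)

variable [CharZero k] 

theorem aeval_numer (c : k) : aeval c (numer a b d (X : ℚ[X])) = numer a b d c := by
  simpa using map_numer a b d (X : ℚ[X]) (aeval c).toRingHom

theorem aeval_denom (c : k) : aeval c (denom a b d (X : ℚ[X])) = denom a b d c := by
  simpa using map_denom a b d (X : ℚ[X]) (aeval c).toRingHom

variable {a b d} (ha : 0 < a) (hb : 0 < b) (hd : 0 < d)
include ha hb hd

/-- A multiple root is a zero of the Wronskian but not of `N` or `M`, hence a zero of `T`. There the
value is `1`, and not `v`. -/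
theorem separable_numer_sub_denom [IsAlgClosed k] {v : k} (hv0 : v ≠ 0) (hv1 : v ≠ 1) :
    (numer a b d (X : k[X]) - C v * denom a b d X).Separable := by
  refine (isCoprime_iff_aeval_ne_zero_of_isAlgClosed k k _ _).2 fun c => ?_
  by_contra! h
  obtain ⟨h0, h1⟩ := h
  simp only [coe_aeval_eq_eval, eval_sub, eval_mul, eval_C, derivative_sub, derivative_C_mul,
    eval_numer, eval_denom] at h0 h1
  have hM : denom a b d c ≠ 0 := fun h => by
    apply numer_ne_zero_of_denom_eq_zero ha hb hd h
    rw [h] at h0; simpa using h0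
  have hN : numer a b d c ≠ 0 := by
    rw [sub_eq_zero.1 h0]; exact mul_ne_zero hv0 hM
  have hT : polyT a b d c = 0 := by
    have hw := congrArg (eval c) (wronskian_numer_denom (R := k) a b d)
    rw [eval_mul, eval_sub, eval_mul, eval_mul, eval_numer, eval_denom, sub_eq_zero.1 h1,
      sub_eq_zero.1 h0, eval_mul (p := numer a b d X * denom a b d X),
      eval_mul (p := numer a b d X), eval_numer, eval_denom, sub_eq_zero.1 h0, eval_pow] at hw
    have h3 : (polyT a b d (X : k[X])).eval c = polyT a b d c := by
      simp [polyT, polyC, polyA]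
    rw [h3] at hw
    rw [show v * eval c (derivative (denom a b d (X : k[X]))) * denom a b d c -
      v * denom a b d c * eval c (derivative (denom a b d (X : k[X]))) = 0 by ring, zero_mul] at hw
    exact eq_zero_of_pow_eq_zero ((mul_eq_zero.1 hw.symm).resolve_left (mul_ne_zero (mul_ne_zero hv0 hM) hM))
  apply hv1
  have := numer_eq_denom_of_polyT ha hb hd hM hT
  rw [this] at h0
  exact mul_right_cancel₀ hM (by rw [← sub_eq_zero.1 h0, one_mul])

/-- At most `2 a + 2 b + 6 d` against `3 n = 3 a + 3 b + 6 d`: the point at infinity lies over `0`.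
-/
theorem natDegree_numer_lt : (numer a b d (X : k[X])).natDegree <
    (denom a b d (X : k[X])).natDegree := by
  have hA : (polyA a b d (X : k[X])).natDegree ≤ 2 := by
    rw [polyA_X]; exact Polynomial.natDegree_quadratic_le
  have hB : (polyB a b d (X : k[X])).natDegree ≤ 2 := by
    rw [polyB_X]; exact Polynomial.natDegree_quadratic_le
  have hD : (polyD a b d (X : k[X])).natDegree ≤ 2 := by
    rw [polyD_X]; exact Polynomial.natDegree_quadratic_le
  have hC : (polyC a b d (X : k[X])).natDegree = 2 := by
    rw [polyC_X]
    refine natDegree_quadratic (mul_ne_zero ?_ ?_)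
    · exact_mod_cast (by omega : a + b ≠ 0)
    · exact_mod_cast (by omega : a + b + d ≠ 0)
  have h1 : (1 - X : k[X]).natDegree = 1 := by
    rw [natDegree_sub, natDegree_sub_eq_left_of_natDegree_lt] <;> simp
  have hC0 : polyC a b d (X : k[X]) ≠ 0 := fun h => by rw [h] at hC; simp at hC
  have h10 : (1 - X : k[X]) ≠ 0 := fun h => by rw [h] at h1; simp at h1
  have hc : (2 ^ d * (d : k[X]) ^ (2 * d) * (a + b + 2 * d) ^ (a + b + 2 * d)) =
      C ((2 ^ d * d ^ (2 * d) * (a + b + 2 * d) ^ (a + b + 2 * d) : ℕ) : k) := by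
    rw [map_natCast]; push_cast; rfl
  have hc0 : ((2 ^ d * d ^ (2 * d) * (a + b + 2 * d) ^ (a + b + 2 * d) : ℕ) : k) ≠ 0 := by
    rw [Nat.cast_ne_zero]; positivity
  have hc' : (a ^ a * b ^ b : k[X]) = C ((a ^ a * b ^ b : ℕ) : k) := by simp
  have hden : (denom a b d (X : k[X])).natDegree =
      (a + 2 * d) + (b + 2 * d) + (a + b + d) * 2 := by
    rw [denom, hc, natDegree_mul, mul_assoc, natDegree_C_mul hc0, natDegree_mul, natDegree_pow,
      natDegree_pow, natDegree_pow, hC, natDegree_X, h1, mul_one, mul_one]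
    · exact pow_ne_zero _ X_ne_zero
    · exact pow_ne_zero _ h10
    · exact mul_ne_zero (mul_ne_zero (C_ne_zero.2 hc0) (pow_ne_zero _ X_ne_zero))
        (pow_ne_zero _ h10)
    · exact pow_ne_zero _ hC0
  rw [hden, numer, hc']
  calc _ ≤ (a + d) * 2 + (b + d) * 2 + d * 2 := by
        refine natDegree_mul_le_of_le (natDegree_mul_le_of_le ?_ (natDegree_pow_le_of_le _ hB))
          (natDegree_pow_le_of_le _ hD)
        exact (natDegree_C_mul_le _ _).trans (natDegree_pow_le_of_le _ hA)
    _ < _ := by omega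

theorem isCoprime_numer_denom : IsCoprime (numer a b d (X : ℚ[X])) (denom a b d X) := by
  refine (isCoprime_iff_aeval_ne_zero_of_isAlgClosed ℚ ℂ _ _).2 fun c => ?_
  rw [aeval_numer, aeval_denom]
  by_contra! h
  exact numer_ne_zero_of_denom_eq_zero ha hb hd h.2 h.1

/-- What has to be known about the rational function of the theorem. -/
theorem belyi_facts {π : RatFunc ℚ}
    (hπ : π = algebraMap ℚ[X] (RatFunc ℚ) (numer a b d X) / algebraMap ℚ[X] (RatFunc ℚ)
      (denom a b d X)) :
    IsBelyiMap π ∧ ∀ (k : Type u) [Field k] [CharZero k] (v : k), v ≠ 0 →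
      ¬ InFibre π v (OnePoint.infty : OnePoint k) ∧
      ∀ c : k, InFibre π v (c : OnePoint k) ↔ numer a b d c = v * denom a b d c := by
  have hlt := natDegree_numer_lt (k := ℚ) ha hb hd
  have hM : denom a b d (X : ℚ[X]) ≠ 0 := fun h => by rw [h] at hlt; simp at hlt
  obtain ⟨u, hu, h1, h2⟩ := exists_eq_C_mul_num_of_isCoprime hM
    (isCoprime_numer_denom ha hb hd)
  rw [← hπ] at h1 h2
  refine ⟨isBelyiMap_of_separable hu h1 h2 hlt fun v hv0 hv1 => ?_, fun k _ _ v hv => ⟨?_, ?_⟩⟩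
  · have e1 := map_numer a b d (X : ℚ[X]) (mapRingHom (algebraMap ℚ ℂ))
    have e2 := map_denom a b d (X : ℚ[X]) (mapRingHom (algebraMap ℚ ℂ))
    simp only [coe_mapRingHom, map_X] at e1 e2
    rw [e1, e2]
    exact separable_numer_sub_denom ha hb hd hv0 hv1
  · exact not_inFibre_infty hu h1 h2 hv (degree_lt_degree hlt)
  · intro c
    rw [inFibre_coe_iff hu h1 h2, aeval_numer, aeval_denom]

end Field

theorem eq_numer_div_denom {a b d n : ℕ} (hn : n = a + b + 2 * d)
    {x A B C D π : RatFunc ℚ} (hx : x = RatFunc.X)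
    (hA : A = -2 * n * x * (a + d) + (a + d) * (a + 2 * d) + n * x ^ 2 * (n - d))
    (hB : B = a * (a + d) - 2 * a * n * x + n * x ^ 2 * (-(d - n)))
    (hC : C = x ^ 2 * (a + b) * (n - d) - 2 * a * x * (n - d) + a * (a + d))
    (hD : D = n * x ^ 2 * (a + b) + a * (a + 2 * d) - 2 * a * n * x)
    (hπ : π = (a ^ a * b ^ b * A ^ (a + d) * B ^ (b + d) * D ^ d) /
      (2 ^ d * d ^ (2 * d) * n ^ n * x ^ (a + 2 * d) * (1 - x) ^ (b + 2 * d) * C ^ (n - d))) :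
    π = algebraMap ℚ[X] (RatFunc ℚ) (numer a b d X) / algebraMap ℚ[X] (RatFunc ℚ)
      (denom a b d X) := by
  have e : (n : RatFunc ℚ) = a + b + 2 * d := by rw [hn]; push_cast; ring
  have e' : n - d = a + b + d := by omega
  have hA' : A = polyA a b d x := by rw [hA, e, polyA]; ring
  have hB' : B = polyB a b d x := by rw [hB, e, polyB]; ring
  have hC' : C = polyC a b d x := by rw [hC, e, polyC]; ring
  have hD' : D = polyD a b d x := by rw [hD, e, polyD]
  rw [map_numer, map_denom, RatFunc.algebraMap_X, ← hx, hπ, hA', hB', hC', hD', e', e, hn]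
  simp only [numer, denom]

end Semicubical

/-! ### Marked points, choice of coordinate, isomorphism and base change of polynomial covers. -/

namespace CurveCover

variable {k : Type u} [Field k] {Y : CurveCover k}

theorem HasRamification.exists_liesOver {τ : OnePoint k} {M : Multiset ℕ}
    (h : Y.HasRamification τ M) {e : ℕ} (he : e ∈ M) : ∃ P : Y.Point, P.LiesOver τ e := by
  obtain ⟨S, f, hS, hf, rfl⟩ := h
  obtain ⟨P, hP, rfl⟩ := Multiset.mem_map.1 he
  exact ⟨P, hf P hP⟩

/-- A point is determined by its image and its ramification index if the latter occurs once. -/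
theorem HasRamification.point_unique {τ : OnePoint k} {e : ℕ} {M : Multiset ℕ}
    (h : Y.HasRamification τ (e ::ₘ M)) (he : e ∉ M) {P Q : Y.Point} (hP : P.LiesOver τ e)
    (hQ : Q.LiesOver τ e) : P = Q := by
  classical
  obtain ⟨S, f, hS, hf, hM⟩ := h
  have key : ∀ R : Y.Point, R.LiesOver τ e → R ∈ S.filter (fun R => e = f R) := fun R hR =>
    Finset.mem_filter.2 ⟨(hS R).2 hR.1, hR.unique (hf R ((hS R).2 hR.1))⟩
  have h1 : (S.filter (fun R => e = f R)).card = 1 := by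
    have h2 := congrArg (Multiset.count e) hM
    rw [Multiset.count_map, Multiset.count_cons_self, Multiset.count_eq_zero.2 he] at h2
    simpa [Finset.card, Finset.filter_val] using h2
  exact Finset.card_le_one.1 h1.le _ (key P hP) _ (key Q hQ)

theorem HasRamification.point_unique_singleton {τ : OnePoint k} {e : ℕ}
    (h : Y.HasRamification τ {e}) {P Q : Y.Point} (hP : P.TakesValue Y.covering τ)
    (hQ : Q.TakesValue Y.covering τ) : P = Q := by
  obtain ⟨S, f, hS, hf, hM⟩ := h
  have h1 : S.card = 1 := by rw [Finset.card, ← Multiset.card_map f, hM, Multiset.card_singleton]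
  exact Finset.card_le_one.1 h1.le _ ((hS P).2 hP) _ ((hS Q).2 hQ)

theorem HasRamification.exists_isTotallyRamified
    (h : Y.HasRamification OnePoint.infty {Y.degree}) : ∃ P ϖ, IsTotallyRamified (Y := Y) P ϖ := by
  obtain ⟨P, h1, ϖ, h2, h3⟩ := h.exists_liesOver (Multiset.mem_singleton_self _)
  exact ⟨P, ϖ, h1, fun Q hQ => h.point_unique_singleton hQ h1, h2, h3⟩

/-- A cover with one point over infinity and few ramification points elsewhere is a polynomial
cover: its genus is zero. -/
theorem exists_isPolynomialCover [CharZero k] [IsAlgClosed k] (hdeg : 1 < Y.degree)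
    (hinf : Y.HasRamification OnePoint.infty {Y.degree}) {M : k → Multiset ℕ} {T : Finset k}
    (hM : ∀ τ : k, Y.HasRamification (τ : OnePoint k) (M τ))
    (hT : ∀ τ ∉ T, (M τ).card = Y.degree) (hsum : ∑ τ ∈ T, (Y.degree - (M τ).card) < Y.degree) :
    ∃ y F, Y.IsPolynomialCover y F := by
  obtain ⟨P, ϖ, h⟩ := hinf.exists_isTotallyRamified
  obtain ⟨y, hy0, hy, hy1⟩ := h.exists_order_one hdeg fun g hg0 hg =>
    order_of_dual (T := T) (r := fun τ => (M τ).card) (fun τ => by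
      obtain ⟨S, e, hS, -, hMS⟩ := hM τ
      exact ⟨S, fun P hP => (hS P).1 hP, by rw [← hMS, Multiset.card_map]; rfl⟩) hT hsum hg0 hg
  obtain ⟨-, F, hF⟩ := h.isPolynomialCover_of_order_one hy0 hy hy1
  exact ⟨y, F, hF⟩

section Generators

variable [IsAlgClosed k] {y : Y.K} (hy : Y.Generates y)
include hy

/-- A function which is regular away from `y = ∞` is a polynomial in `y`. -/
theorem Generates.exists_aeval {f : Y.K} (hf : ∀ P : Y.Point, ¬ P.TakesValue y OnePoint.infty →
    P.ring.valuation f ≤ 1) : ∃ p : k[X], f = aeval y p := by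
  by_cases hf0 : f = 0
  · exact ⟨0, by simp [hf0]⟩
  obtain ⟨p, q, hq, hfpq⟩ := hy.exists_div f
  have hq0 : q ≠ 0 := by rintro rfl; simp at hq
  -- Regularity at the point `y = c` says that `c` is a root of `q` at most as often as of `p`.
  have hdvd : q ∣ p := by
    classical
    refine (IsAlgClosed.splits q).dvd_of_roots_le_roots hq0 (Multiset.le_iff_count.2 fun c => ?_)
    rw [count_roots, count_roots]
    obtain ⟨P, hP⟩ := hy.exists_point (c : OnePoint k)
    have h1 := hf P fun h => OnePoint.infty_ne_coe c (h.unique hP)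
    rw [hy.valuation_eq_zpow hP hf0 hq hfpq] at h1
    have h2 := hy.valuation_zpow_lt_one hP
      (-((p.rootMultiplicity c : ℤ) - q.rootMultiplicity c))
    rw [zpow_neg] at h2
    by_contra! h3
    have h4 := h2.2 (by omega)
    have h5 : P.ring.valuation (y - Y.const c) ^
      ((p.rootMultiplicity c : ℤ) - q.rootMultiplicity c) ≠ 0 := zpow_ne_zero _ (by
        simpa using hy.sub_const_ne_zero c)
    rw [inv_lt_one₀ (zero_lt_iff.2 h5)] at h4
    exact absurd h4 (not_lt.2 h1)
  obtain ⟨r, rfl⟩ := hdvd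
  exact ⟨r, by rw [hfpq, map_mul, mul_div_cancel_left₀ _ hq]⟩

/-- Two coordinates with the same pole differ by an affine transformation. -/
theorem Generates.exists_affine {z : Y.K} (hz : Y.Generates z) {P : Y.Point}
    (hyP : P.TakesValue y OnePoint.infty) (hzP : P.TakesValue z OnePoint.infty) :
    ∃ α β : k, z = Y.const α * y + Y.const β := by
  obtain ⟨p, hp⟩ := hy.exists_aeval (f := z) fun Q hQ => not_lt.1 fun h => hQ (by
    rwa [hz.point_unique (show Q.TakesValue z OnePoint.infty from h) hzP])
  have hp0 : p ≠ 0 := by rintro rfl; exact hz.ne_zero (by simpa using hp)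
  have hu : P.IsUniformizer y⁻¹ := by
    simpa using hy.inv.isUniformizer (Point.TakesValue.inv.1 hyP).2
  have hu' : P.IsUniformizer z⁻¹ := by
    simpa using hz.inv.isUniformizer (Point.TakesValue.inv.1 hzP).2
  have h1 := hu.valuation_eq hu'
  have h2 := P.valuation_aeval_infty hyP hp0
  rw [← hp] at h2
  rw [map_inv₀, map_inv₀, h2] at h1
  have hdeg : 1 = p.natDegree := hu.pow_injective (by rw [pow_one, map_inv₀, inv_pow, ← h1])
  refine ⟨p.coeff 1, p.coeff 0, ?_⟩
  rw [hp]
  conv_lhs => rw [eq_X_add_C_of_natDegree_le_one hdeg.ge]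
  simp [algebraMap_eq_const]

/-- The two coordinates are related by an affine map, and an affine map fixing `0` and `1` is the
identity. -/
theorem Generates.eq_of_takesValue {z : Y.K} (hz : Y.Generates z) {P Q R : Y.Point}
    (hyP : P.TakesValue y OnePoint.infty) (hzP : P.TakesValue z OnePoint.infty)
    (hyQ : Q.TakesValue y ((0 : k) : OnePoint k)) (hzQ : Q.TakesValue z ((0 : k) : OnePoint k))
    (hyR : R.TakesValue y ((1 : k) : OnePoint k)) (hzR : R.TakesValue z ((1 : k) : OnePoint k)) :
    z = y := by
  obtain ⟨α, β, h⟩ := hy.exists_affine hz hyP hzP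
  have h' : z = aeval y (C α * X + C β) := by rw [h]; simp [algebraMap_eq_const]
  have h0 := hyQ.aeval (C α * X + C β)
  rw [← h'] at h0
  have h1 := hyR.aeval (C α * X + C β)
  rw [← h'] at h1
  have hβ : β = 0 := by simpa using OnePoint.coe_injective (h0.unique hzQ)
  have hα : α = 1 := by simpa [hβ] using OnePoint.coe_injective (h1.unique hzR)
  rw [h, hα, hβ]; simp

/-- A cover with only one point over infinity is polynomial in a coordinate which has its pole
there. -/
theorem Generates.exists_isPolynomialCover {e : ℕ} (hinf : Y.HasRamification OnePoint.infty {e})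
    {P : Y.Point} (hP : P.TakesValue Y.covering OnePoint.infty)
    (hyP : P.TakesValue y OnePoint.infty) : ∃ F, Y.IsPolynomialCover y F := by
  obtain ⟨F, hF⟩ := hy.exists_aeval (f := Y.covering) fun Q hQ => not_lt.1 fun h => hQ (by
    rwa [hinf.point_unique_singleton (show Q.TakesValue Y.covering OnePoint.infty from h) hP])
  exact ⟨F, hy, hF⟩

end Generators

theorem aeval_mem_of_mem {K : Type*} [Field K] [Algebra k K] (L : IntermediateField k K) {x : K}
    (hx : x ∈ L) (p : k[X]) : aeval x p ∈ L :=
  (L.toSubalgebra.aeval_coe ⟨x, hx⟩ p) ▸ (aeval (⟨x, hx⟩ : L.toSubalgebra) p).2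

namespace IsPolynomialCover

theorem minpoly_eq {y : Y.K} {F : k[X]} (h : Y.IsPolynomialCover y F) :
    minpoly (RatFunc k) y = (F.map (algebraMap k (RatFunc k)) - C RatFunc.X) *
      C (F.map (algebraMap k (RatFunc k)) - C RatFunc.X).leadingCoeff⁻¹ := by
  have h0 : F.map (algebraMap k (RatFunc k)) - C RatFunc.X ≠ 0 := fun h0 => by
    have := h.natDegree_pos
    rw [← natDegree_sub_X, h0] at this
    simp at this
  refine (eq_of_monic_of_dvd_of_natDegree_le (minpoly.monic (Algebra.IsIntegral.isIntegral y))
    (monic_mul_leadingCoeff_inv h0) ((minpoly.dvd _ _ h.aeval_sub_X).mul_right _) ?_).symm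
  rw [natDegree_mul_leadingCoeff_inv _ h0, natDegree_sub_X, ← h.degree_eq, CurveCover.degree,
    ← IntermediateField.finrank_top', ← h.adjoin_eq_top,
    IntermediateField.adjoin.finrank (Algebra.IsIntegral.isIntegral y)]

/-- Both function fields are obtained from `k(t)` by adjoining a root of the same irreducible
polynomial, proportional to `F - t`. -/
theorem isIsomorphic {Y' : CurveCover k} {y : Y.K} {y' : Y'.K} {F : k[X]}
    (h : Y.IsPolynomialCover y F) (h' : Y'.IsPolynomialCover y' F) : Y.IsIsomorphic Y' := by
  have hm : minpoly (RatFunc k) y = minpoly (RatFunc k) y' := h.minpoly_eq.trans h'.minpoly_eq.symm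
  have e1 := IntermediateField.adjoinRootEquivAdjoin (RatFunc k)
    (Algebra.IsIntegral.isIntegral (R := RatFunc k) y)
  have e2 := IntermediateField.adjoinRootEquivAdjoin (RatFunc k)
    (Algebra.IsIntegral.isIntegral (R := RatFunc k) y')
  rw [h.adjoin_eq_top] at e1
  rw [h'.adjoin_eq_top, ← hm] at e2
  exact ⟨(IntermediateField.topEquiv.symm.trans e1.symm).trans
    (e2.trans IntermediateField.topEquiv)⟩

/-- Base change of a polynomial cover. -/
theorem map {k' : Type u} [Field k'] {Y' : CurveCover k'} {σ : k →+* k'} {y : Y.K} {F : k[X]}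
    (h : Y.IsPolynomialCover y F) (hdeg : Y.degree = Y'.degree) {f : Y.K →+* Y'.K}
    (hf : ∀ c, f (Y.const c) = Y'.const (σ c)) (hft : f Y.covering = Y'.covering)
    {P : Y'.Point} (hP : P.LiesOver OnePoint.infty Y'.degree) :
    Y'.IsPolynomialCover (f y) (F.map σ) := by
  have hcov : Y'.covering = aeval (f y) (F.map σ) := by
    rw [← hft, h.covering_eq, aeval_def, hom_eval₂, aeval_def, eval₂_map]
    congr 1
    ext c
    exact hf c
  have hF0 : F.map σ ≠ 0 := (Polynomial.map_ne_zero_iff σ.injective).2 h.ne_zero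
  have hn : (F.map σ).natDegree = Y'.degree := by
    rw [natDegree_map, ← hdeg, h.degree_eq]
  refine ⟨?_, hcov⟩
  obtain ⟨h1, ϖ, h2, h3⟩ := hP
  have hy1 : P.TakesValue (f y) OnePoint.infty := by
    rw [Point.takesValue_infty]
    by_contra hle
    rw [Point.takesValue_infty, hcov] at h1
    exact absurd (P.valuation_aeval_le (not_lt.1 hle) _) (not_le.2 h1)
  have hval : P.ring.valuation (f y) = P.ring.valuation ϖ ^ (-1 : ℤ) := by
    have h4 := Point.valuation_covering_of_liesOver h3
    rw [hcov, P.valuation_aeval_infty hy1 hF0, hn, zpow_neg, zpow_natCast, ← inv_pow] at h4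
    have hpos : Y'.degree ≠ 0 := by
      rw [← hdeg, h.degree_eq]; exact h.natDegree_pos.ne'
    rw [zpow_neg_one]
    exact (pow_left_inj₀ zero_le zero_le hpos).1 h4
  -- `f y` has a simple pole at `P`, so its powers below the degree are independent and form a basis
  -- over `k'(t)`. As `t` is a polynomial in `f y`, the latter generates the field over the
  -- constants.
  have hli := Point.linearIndependent_of_order (P := P) h1 h2 h3 (ι := Fin Y'.degree)
    (f := fun i => f y ^ (i : ℕ)) (m := fun i => -(i : ℤ)) (fun i => by
      rw [map_pow, hval, ← zpow_natCast, ← zpow_mul]; simp)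
    (fun i j hij => by
      have hi := i.2
      have hj := j.2
      have h0 := Int.eq_zero_of_abs_lt_dvd hij (by rw [abs_lt]; omega)
      exact Fin.ext (by omega))
  have hspan := hli.span_eq_top_of_card_eq_finrank' (Fintype.card_fin _)
  rw [generates_iff_adjoin, eq_top_iff]
  intro g _
  have ht : Y'.covering ∈ IntermediateField.adjoin k' {f y} := by
    rw [hcov]
    exact IntermediateField.algebra_adjoin_le_adjoin _ _ (aeval_mem_adjoin_singleton _ _)
  have hmem : ∀ p : k'[X], algebraMap (RatFunc k') Y'.K (algebraMap k'[X] (RatFunc k') p) ∈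
      IntermediateField.adjoin k' {f y} := fun p => by
    rw [← IsScalarTower.algebraMap_apply, algebraMap_polynomial]
    exact aeval_mem_of_mem (IntermediateField.adjoin k' {f y}) ht p
  have hg : g ∈ Submodule.span (RatFunc k') (Set.range fun i : Fin Y'.degree => f y ^ (i : ℕ)) := by
    rw [hspan]; trivial
  induction hg using Submodule.span_induction with
  | mem x hx =>
    obtain ⟨i, rfl⟩ := hx
    exact pow_mem (IntermediateField.mem_adjoin_simple_self _ _) _
  | zero => exact zero_mem _
  | add x y _ _ hx hy => exact add_mem (hx trivial) (hy trivial)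
  | smul r x _ hx =>
    rw [Algebra.smul_def]
    refine mul_mem ?_ (hx trivial)
    rw [← RatFunc.num_div_denom r, map_div₀]
    exact div_mem (hmem _) (hmem _)

end IsPolynomialCover

section PolyCover

theorem finiteDimensional_of_eval₂ {K : Type u} [Field K] [Algebra (RatFunc k) K] {x : K} {F : k[X]}
    (hF : 0 < F.natDegree)
    (hx : F.eval₂ ((algebraMap (RatFunc k) K).comp RatFunc.C) x = algebraMap (RatFunc k) K RatFunc.X)
    (htop : Subfield.closure (Set.range ((algebraMap (RatFunc k) K).comp RatFunc.C) ∪ {x}) = ⊤) :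
    FiniteDimensional (RatFunc k) K := by
  have hint : IsIntegral (RatFunc k) x := by
    rw [← isAlgebraic_iff_isIntegral]
    refine ⟨F.map RatFunc.C - C RatFunc.X, fun h0 => ?_, ?_⟩
    · have h1 : (F.map RatFunc.C - C RatFunc.X).natDegree = F.natDegree := by
        rw [natDegree_sub_C, natDegree_map]
      rw [h0] at h1
      simp at h1
      omega
    · rw [map_sub, aeval_C, aeval_def, eval₂_map, hx, sub_self]
  have h1 : IntermediateField.adjoin (RatFunc k) {x} = ⊤ := by
    apply IntermediateField.toSubfield_injective
    rw [IntermediateField.top_toSubfield, eq_top_iff, ← htop, Subfield.closure_le,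
      Set.union_subset_iff, Set.singleton_subset_iff]
    refine ⟨?_, IntermediateField.mem_adjoin_simple_self _ _⟩
    rintro _ ⟨c, rfl⟩
    exact IntermediateField.algebraMap_mem _ _
  have := IntermediateField.adjoin.finiteDimensional hint
  rw [h1] at this
  exact Module.Finite.equiv (IntermediateField.topEquiv (F := RatFunc k) (E := K)).toLinearEquiv

theorem closure_range_C_union_X :
    Subfield.closure (Set.range (RatFunc.C (K := k)) ∪ {RatFunc.X}) = ⊤ := by
  set L := Subfield.closure (Set.range (RatFunc.C (K := k)) ∪ {RatFunc.X}) with hL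
  have hX : RatFunc.X ∈ L := Subfield.subset_closure (Or.inr rfl)
  have hmem : ∀ p : k[X], algebraMap k[X] (RatFunc k) p ∈ L := fun p => by
    induction p using Polynomial.induction_on' with
    | add p q hp hq => rw [map_add]; exact add_mem hp hq
    | monomial n c =>
      rw [← C_mul_X_pow_eq_monomial, map_mul, map_pow, RatFunc.algebraMap_X, RatFunc.algebraMap_C]
      exact mul_mem (Subfield.subset_closure (Or.inl ⟨c, rfl⟩)) (pow_mem hX n)
  rw [eq_top_iff]
  intro r _
  rw [← RatFunc.num_div_denom r]
  exact div_mem (hmem _) (hmem _)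

theorem nonZeroDivisors_le_comap_aeval {F : k[X]} (hF : 0 < F.natDegree) :
    nonZeroDivisors k[X] ≤ (nonZeroDivisors (RatFunc k)).comap
      (aeval (R := k) (algebraMap k[X] (RatFunc k) F)) := by
  intro p hp
  refine mem_nonZeroDivisors_of_ne_zero fun h0 => ?_
  rw [aeval_algebraMap_apply, FaithfulSMul.algebraMap_eq_zero_iff, ← comp_eq_aeval,
    comp_eq_zero_iff] at h0
  rcases h0 with h0 | ⟨-, h0⟩
  · exact nonZeroDivisors.ne_zero hp h0
  · rw [h0] at hF; simp at hF

/-- Substitution of a nonconstant polynomial for the variable. -/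
noncomputable def substitution {F : k[X]} (hF : 0 < F.natDegree) : RatFunc k →ₐ[k] RatFunc k :=
  RatFunc.liftAlgHom (aeval (algebraMap k[X] (RatFunc k) F)) (nonZeroDivisors_le_comap_aeval hF)

theorem substitution_X {F : k[X]} (hF : 0 < F.natDegree) :
    substitution hF RatFunc.X = algebraMap k[X] (RatFunc k) F := by
  have := RatFunc.liftAlgHom_apply_div (S := k) (aeval (algebraMap k[X] (RatFunc k) F))
    (nonZeroDivisors_le_comap_aeval hF) X 1
  simpa [substitution] using this

theorem substitution_C {F : k[X]} (hF : 0 < F.natDegree) (c : k) :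
    substitution hF (RatFunc.C c) = RatFunc.C c := by
  rw [← RatFunc.algebraMap_eq_C]
  exact (substitution hF).commutes c

theorem exists_polynomialCover {F : k[X]} (hF : 0 < F.natDegree) :
    ∃ (Y : CurveCover k) (y : Y.K), Y.IsPolynomialCover y F := by
  have hC : (substitution hF).toRingHom.comp RatFunc.C = RatFunc.C :=
    RingHom.ext (substitution_C hF)
  have hx : F.eval₂ RatFunc.C RatFunc.X = substitution hF RatFunc.X := by
    rw [substitution_X]
    conv_rhs => rw [← eval₂_C_X (p := F), hom_eval₂, RatFunc.algebraMap_X]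
    congr 1
  -- The function field is `k(X)`, on which `k(t)` acts through `t ↦ F(X)` and not through the
  -- identity.
  let A : Algebra (RatFunc k) (RatFunc k) := (substitution hF).toRingHom.toAlgebra
  have hfin := @finiteDimensional_of_eval₂ k _ (RatFunc k) _ A RatFunc.X F hF
    (by rw [← hC] at hx; exact hx) (by
      have := closure_range_C_union_X (k := k)
      rw [← hC] at this; exact this)
  let Y : CurveCover k := @CurveCover.mk k _ (RatFunc k) _ A hfin
  refine ⟨Y, (RatFunc.X : RatFunc k), ?_, ?_⟩
  · have := closure_range_C_union_X (k := k)
    rw [← hC] at this; exact this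
  · change substitution hF RatFunc.X = _
    rw [← hx, ← hC]
    rfl

end PolyCover

end CurveCover

/-! ### The normal form and its relation to the linear system. -/

namespace Semicubical

section Normal

variable {k : Type u} [Field k]

/-- The quadratic polynomial `X² + p X + q`. -/
noncomputable def quad (p q : k) : k[X] := X ^ 2 + C p * X + C q

/-- The polynomial `γ Xᵃ (X - 1)ᵇ (X² + p X + q)ᵈ`, with fibre `a₀ b₁ d²` over zero. -/
noncomputable def normalForm (a b d : ℕ) (γ p q : k) : k[X] :=
  C γ * (X ^ a * (X - 1) ^ b * quad p q ^ d)

/-- The polynomial `F` is the normalised cover with triple point `x` over `1` and double point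
over `v`. -/
def IsNormalForm (a b d : ℕ) (v x : k) (F : k[X]) : Prop :=
  ∃ γ w p q : k, F = normalForm a b d γ p q ∧ System a b d x w p q ∧ F.eval x = 1 ∧ F.eval w = v

theorem eval_normalForm (a b d : ℕ) (γ p q c : k) : (normalForm a b d γ p q).eval c =
    γ * (c ^ a * (c - 1) ^ b * (c ^ 2 + p * c + q) ^ d) := by
  simp [normalForm, quad]

theorem derivative_normalForm_mul (a b d : ℕ) (γ p q : k) :
    derivative (normalForm a b d γ p q) * (X * (X - 1) * quad p q) =
      normalForm a b d γ p q * ((a : k[X]) * (X - 1) * quad p q + (b : k[X]) * X * quad p q +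
        (d : k[X]) * X * (X - 1) * (2 * X + C p)) := by
  have h1 := derivative_pow_mul_self (X : k[X]) a
  have h2 := derivative_pow_mul_self (X - 1 : k[X]) b
  have h3 := derivative_pow_mul_self (quad p q) d
  have h4 : derivative (quad p q) = 2 * X + C p := by
    simp [quad]; norm_num
  rw [derivative_X, mul_one] at h1
  rw [derivative_sub, derivative_one, derivative_X, sub_zero, mul_one] at h2
  rw [h4] at h3
  rw [normalForm, derivative_C_mul, derivative_mul, derivative_mul]
  generalize derivative (X ^ a : k[X]) = A' at *
  generalize derivative ((X - 1) ^ b : k[X]) = B' at *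
  generalize derivative (quad p q ^ d) = D' at *
  generalize (X ^ a : k[X]) = A at *
  generalize ((X - 1) ^ b : k[X]) = B at *
  generalize (quad p q ^ d) = D at *
  linear_combination C γ * B * D * (X - 1) * quad p q * h1 + C γ * A * D * X * quad p q * h2 +
    C γ * A * B * X * (X - 1) * h3

variable [CharZero k] {a b d : ℕ}

/-- Both cubics have leading coefficient `n`. The three equations say that the coordinates of their
difference in the basis `X - 1, X, X² - X` of the quadratics vanish. -/
theorem system_iff {x w p q : k} : System a b d x w p q ↔
    (a : k[X]) * (X - 1) * quad p q + (b : k[X]) * X * quad p q +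
        (d : k[X]) * X * (X - 1) * (2 * X + C p) =
      C (a + b + 2 * d : k) * ((X - C x) ^ 2 * (X - C w)) := by
  have hC : C (a + b + 2 * d : k) = (a + b + 2 * d : k[X]) := by
    simp only [map_add, map_mul, map_natCast, C_ofNat]
  constructor
  · rintro ⟨h1, h2, h3⟩
    have e1 := congrArg (C : k → k[X]) h1
    have e2 := congrArg (C : k → k[X]) h2
    have e3 := congrArg (C : k → k[X]) h3
    simp only [map_add, map_mul, map_natCast, C_ofNat, map_sub, map_pow, map_one] at e1 e2 e3
    rw [hC, quad]
    linear_combination (X - 1) * e1 + X * e2 + (X ^ 2 - X) * e3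
  · intro h
    have e0 := congrArg (eval 0) h
    have e1 := congrArg (eval 1) h
    have e2 := congrArg (eval 2) h
    rw [hC] at e0 e1 e2
    simp [quad] at e0 e1 e2
    refine ⟨?_, ?_, ?_⟩
    · linear_combination e0
    · linear_combination e1
    · linear_combination (1/2 : k) * e2 - (1/2 : k) * e0 - e1

/-- For `x ≠ 0, 1` the discriminant of `X² + p X + q` vanishes only with `D`; this is the role of
`D`. -/
theorem System.discrim_mul (ha : 0 < a) {x w p q : k} (h : System a b d x w p q) :
    (p ^ 2 - 4 * q) * polyC a b d x ^ 2 = -(4 * d ^ 2 * x ^ 2 * (1 - x) ^ 2 * polyD a b d x) := by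
  have ha' : (a : k) ≠ 0 := Nat.cast_ne_zero.2 ha.ne'
  have hm : (a + b + d : k) ≠ 0 := by exact_mod_cast (by omega : a + b + d ≠ 0)
  have hw := h.mul_polyC
  obtain ⟨h1, -, h3⟩ := h
  have hp : (a + b + d) * p * polyC a b d x =
      polyC a b d x * (a + 2 * d - 2 * (a + b + 2 * d) * x) - a * polyA a b d x := by
    linear_combination polyC a b d x * h3 - hw
  have hq : q * polyC a b d x = x ^ 2 * polyA a b d x := by
    refine mul_left_cancel₀ ha' ?_
    linear_combination polyC a b d x * h1 + x ^ 2 * hw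
  refine mul_left_cancel₀ (pow_ne_zero 2 hm) ?_
  have key : (a + b + d : k) ^ 2 * ((p ^ 2 - 4 * q) * polyC a b d x ^ 2) =
      (polyC a b d x * (a + 2 * d - 2 * (a + b + 2 * d) * x) - a * polyA a b d x) ^ 2 -
        4 * (a + b + d) ^ 2 * polyC a b d x * (x ^ 2 * polyA a b d x) := by
    rw [← hp, ← hq]; ring
  rw [key]
  simp only [polyA, polyC, polyD]
  ring

section IsNormalForm

variable (ha : 0 < a) (hb : 0 < b) (hd : 0 < d)

theorem IsNormalForm.unique (ha : 0 < a) (hb : 0 < b) (hd : 0 < d) {v v' x : k} {F F' : k[X]}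
    (h : IsNormalForm a b d v x F) (h' : IsNormalForm a b d v' x F') : F = F' := by
  obtain ⟨γ, w, p, q, rfl, hs, h1, -⟩ := h
  obtain ⟨γ', w', p', q', rfl, hs', h1', -⟩ := h'
  obtain ⟨rfl, rfl, rfl⟩ := hs.unique ha hb hd hs'
  rw [eval_normalForm] at h1 h1'
  rw [mul_right_cancel₀ (right_ne_zero_of_mul_eq_one h1) (h1.trans h1'.symm)]

theorem IsNormalForm.ne (ha : 0 < a) (hb : 0 < b) {v x : k} {F : k[X]}
    (h : IsNormalForm a b d v x F) : x ≠ 0 ∧ 1 - x ≠ 0 := by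
  obtain ⟨γ, w, p, q, rfl, hs, h1, -⟩ := h
  rw [eval_normalForm] at h1
  refine ⟨?_, fun h => ?_⟩
  · rintro rfl
    simp [ha.ne'] at h1
  · obtain rfl : x = 1 := (sub_eq_zero.1 h).symm
    simp [hb.ne'] at h1

theorem IsNormalForm.numer_eq (ha : 0 < a) (hb : 0 < b) (hd : 0 < d) {v x : k} {F : k[X]}
    (h : IsNormalForm a b d v x F) : denom a b d x ≠ 0 ∧ numer a b d x = v * denom a b d x := by
  obtain ⟨hx0, hx1⟩ := h.ne ha hb
  obtain ⟨γ, w, p, q, rfl, hs, h1, h2⟩ := h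
  refine ⟨hs.denom_ne_zero ha hb hd hx0 hx1, ?_⟩
  have h3 := hs.numer_mul ha hb hd
  -- `normalForm` contains `(X - 1)ᵇ` whereas `numer_mul` has `1 - x` and `1 - w`; the signs at `x`
  -- and `w` agree and drop out.
  rw [eval_normalForm, ← neg_sub, neg_pow] at h1 h2
  rw [← h2]
  linear_combination (-1) ^ b * γ * h3 - numer a b d x * h1

theorem exists_isNormalForm (ha : 0 < a) (hb : 0 < b) (hd : 0 < d) {v x : k}
    (h : numer a b d x = v * denom a b d x) : ∃ F, IsNormalForm a b d v x F := by
  have hden : denom a b d x ≠ 0 := fun h0 =>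
    numer_ne_zero_of_denom_eq_zero ha hb hd h0 (by rw [h, h0, mul_zero])
  obtain ⟨hx0, hx1, hC⟩ := ne_zero_of_denom_ne_zero ha hb hd hden
  obtain ⟨w, p, q, hs⟩ := exists_system ha hb hd hC
  have hq := hs.quadratic_at_triple_ne_zero ha hb hd hx0 hx1
  have hF : x ^ a * (x - 1) ^ b * (x ^ 2 + p * x + q) ^ d ≠ 0 :=
    mul_ne_zero (mul_ne_zero (pow_ne_zero _ hx0) (pow_ne_zero _ (by
      rw [← neg_sub]; exact neg_ne_zero.2 hx1))) (pow_ne_zero _ hq)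
  have h1 : (normalForm a b d (x ^ a * (x - 1) ^ b * (x ^ 2 + p * x + q) ^ d)⁻¹ p q).eval x = 1 := by
    rw [eval_normalForm, inv_mul_cancel₀ hF]
  refine ⟨_, _, w, p, q, rfl, hs, h1, ?_⟩
  have h3 := hs.numer_mul ha hb hd
  rw [eval_normalForm, ← neg_sub x 1, neg_pow] at *
  generalize (x ^ a * (x - 1) ^ b * (x ^ 2 + p * x + q) ^ d)⁻¹ = γ at *
  rw [← neg_sub w 1, neg_pow (w - 1)] at h3
  have hs2 : ((-1 : k) ^ b) * (-1) ^ b = 1 := by rw [← mul_pow]; simp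
  refine mul_left_cancel₀ hden ?_
  linear_combination (-γ * (-1) ^ b) * h3 + numer a b d x * h1 + h +
    γ * (numer a b d x * (x ^ a * (x - 1) ^ b * (x ^ 2 + p * x + q) ^ d) -
      denom a b d x * (w ^ a * (w - 1) ^ b * (w ^ 2 + p * w + q) ^ d)) * hs2

end IsNormalForm

end Normal

end Semicubical

/-! ### Ramification of the normal form. -/

namespace Semicubical

variable {k : Type u} [Field k] [CharZero k] {a b d : ℕ}

theorem natDegree_normalForm {γ : k} (hγ : γ ≠ 0) (p q : k) :
    (normalForm a b d γ p q).natDegree = a + b + 2 * d := by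
  have h1 : (X - 1 : k[X]).Monic := monic_X_sub_C (1 : k)
  have h1' : (X - 1 : k[X]).natDegree = 1 := natDegree_X_sub_C (1 : k)
  have h2 : (quad p q).natDegree = 2 := by
    have := natDegree_quadratic (a := (1 : k)) (b := p) (c := q) one_ne_zero
    simpa [quad] using this
  have h3 : (quad p q).Monic := by
    rw [Monic, leadingCoeff, h2]; simp [quad]
  rw [normalForm, natDegree_C_mul hγ, (((monic_X_pow a).mul (h1.pow b))).natDegree_mul (h3.pow d),
    (monic_X_pow a).natDegree_mul (h1.pow b), natDegree_X_pow, h1.natDegree_pow, h3.natDegree_pow,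
    h1', h2]
  ring

theorem map_eq_cons_replicate {ι : Type*} {S : Finset ι} {m : ι → ℕ} {x : ι} (hx : x ∈ S) {e n : ℕ}
    (hm : m x = e) (h1 : ∀ c ∈ S, c ≠ x → m c = 1) (hsum : ∑ c ∈ S, m c = n) :
    S.val.map m = e ::ₘ Multiset.replicate (n - e) 1 := by
  classical
  rw [← Finset.insert_erase hx, Finset.insert_val_of_notMem (Finset.notMem_erase x S),
    Multiset.map_cons, hm]
  have h2 : ∀ c ∈ S.erase x, m c = 1 := fun c hc =>
    h1 c (Finset.mem_of_mem_erase hc) (Finset.ne_of_mem_erase hc)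
  congr 1
  rw [Multiset.eq_replicate]
  refine ⟨?_, fun j hj => ?_⟩
  · rw [← Finset.add_sum_erase S m hx, hm, Finset.sum_congr rfl h2] at hsum
    simp only [Finset.sum_const, smul_eq_mul, mul_one] at hsum
    rw [Multiset.card_map, Finset.card_val]
    omega
  · obtain ⟨c, hc, rfl⟩ := Multiset.mem_map.1 hj
    exact h2 c hc

omit [CharZero k] in
theorem sum_rootMultiplicity [IsAlgClosed k] [DecidableEq k] (F : k[X]) :
    ∑ c ∈ F.roots.toFinset, F.rootMultiplicity c = F.natDegree := by
  rw [(IsAlgClosed.splits F).natDegree_eq_card_roots, ← Multiset.toFinset_sum_count_eq]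
  simp

section Ramification

variable (ha : 0 < a) (hb : 0 < b) (hd : 0 < d) {γ x w p q : k} (hγ : γ ≠ 0)
  (hs : System a b d x w p q)
include ha hb hd hs

/-- Ramification outside the fibre over zero. -/
theorem rootMultiplicity_normalForm_sub [DecidableEq k] (hxw : x ≠ w) {c τ : k} (hτ : τ ≠ 0)
    (hc : (normalForm a b d γ p q).eval c = τ) :
    (normalForm a b d γ p q - C τ).rootMultiplicity c = if c = x then 3 else if c = w then 2 else 1 := by
  have hn : (a + b + 2 * d : k) ≠ 0 := by exact_mod_cast (by omega : a + b + 2 * d ≠ 0)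
  set F := normalForm a b d γ p q with hF
  have hF0 : F ≠ 0 := by
    rintro h0
    rw [h0, eval_zero] at hc
    exact hτ hc.symm
  have hroot : (F - C τ).IsRoot c := by simp [hc]
  have hne : F - C τ ≠ 0 := by
    intro h0
    have hγ : γ ≠ 0 := by
      rintro rfl
      simp [hF, normalForm] at hF0
    have h1 := natDegree_normalForm (a := a) (b := b) (d := d) hγ p q
    rw [← hF, sub_eq_zero.1 h0, natDegree_C] at h1
    omega
  have hder := derivative_rootMultiplicity_of_root hroot
  rw [derivative_sub, derivative_C, sub_zero] at hder
  have hpos := (rootMultiplicity_pos hne).2 hroot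
  -- Off the zero fibre `F` and `X (X - 1) Q` are nonzero at `c`, so the multiplicity of `c` in `F'`
  -- is its multiplicity in `(X - x)² (X - w)`. The multiplicity in `F - τ` is one more.
  have hid := derivative_normalForm_mul a b d γ p q
  rw [system_iff.1 hs, ← hF] at hid
  have hM : ((X - C x) ^ 2 * (X - C w)) ≠ 0 :=
    mul_ne_zero (pow_ne_zero _ (X_sub_C_ne_zero x)) (X_sub_C_ne_zero w)
  have hR : F * (C (a + b + 2 * d : k) * ((X - C x) ^ 2 * (X - C w))) ≠ 0 :=
    mul_ne_zero hF0 (mul_ne_zero (C_ne_zero.2 hn) hM)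
  have h1 := congrArg (rootMultiplicity c) hid
  rw [rootMultiplicity_mul hR, rootMultiplicity_mul (by rw [hid]; exact hR),
    rootMultiplicity_mul (right_ne_zero_of_mul hR), rootMultiplicity_C, zero_add,
    rootMultiplicity_eq_zero (p := F) (by rw [IsRoot, hc]; exact hτ), zero_add,
    rootMultiplicity_eq_zero (p := X * (X - 1) * quad p q), add_zero] at h1
  · have h2 : ((X - C x) ^ 2 * (X - C w)).rootMultiplicity c =
        if c = x then 2 else if c = w then 1 else 0 := by
      rw [← count_roots, roots_mul hM, roots_pow, roots_X_sub_C, roots_X_sub_C]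
      by_cases h : c = x
      · subst h
        simp [hxw]
      · by_cases h' : c = w
        · subst h'
          simp [h]
        · simp [h, h']
    rw [h2] at h1
    split_ifs at h1 ⊢ <;> omega
  · intro h0
    rw [hF, eval_normalForm] at hc
    simp only [IsRoot, quad, eval_mul, eval_sub, eval_X, eval_one, eval_add, eval_pow, eval_C,
      mul_eq_zero] at h0
    apply hτ
    rw [← hc]
    rcases h0 with (h0 | h0) | h0 <;> simp [h0, ha.ne', hb.ne', hd.ne']

variable [IsAlgClosed k]

-- This serves both for the fibre over `1` with `e = 3` and for the one over `v` with `e = 2`; `hne`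
-- keeps the other critical point out of the fibre.
open Classical in
theorem map_rootMultiplicity_of_special (hγ : γ ≠ 0) {x' τ : k} (hxw : x ≠ w) {e : ℕ}
    (hτ : τ ≠ 0) (hx : (normalForm a b d γ p q).eval x' = τ)
    (he : (x' = x ∧ e = 3) ∨ (x' = w ∧ e = 2))
    (hne : (normalForm a b d γ p q).eval x ≠ (normalForm a b d γ p q).eval w) :
    ((normalForm a b d γ p q - C τ).roots.toFinset.val.map fun c =>
      (normalForm a b d γ p q - C τ).rootMultiplicity c) =
      e ::ₘ Multiset.replicate (a + b + 2 * d - e) 1 := by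
  have hdeg := natDegree_normalForm (a := a) (b := b) (d := d) hγ p q
  have h0 : normalForm a b d γ p q - C τ ≠ 0 := fun h0 => by
    rw [sub_eq_zero.1 h0, natDegree_C] at hdeg; omega
  have hmem : ∀ c, c ∈ (normalForm a b d γ p q - C τ).roots.toFinset ↔
      (normalForm a b d γ p q).eval c = τ := fun c => by
    rw [Multiset.mem_toFinset, mem_roots h0]; simp [sub_eq_zero]
  refine map_eq_cons_replicate ((hmem x').2 hx) ?_ (fun c hc hcx => ?_) ?_
  · rw [rootMultiplicity_normalForm_sub ha hb hd hs hxw hτ hx]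
    rcases he with ⟨rfl, rfl⟩ | ⟨rfl, rfl⟩
    · simp
    · simp [hxw.symm]
  · rw [hmem] at hc
    rw [rootMultiplicity_normalForm_sub ha hb hd hs hxw hτ hc]
    rcases he with ⟨rfl, rfl⟩ | ⟨rfl, rfl⟩
    · rw [if_neg hcx, if_neg]
      rintro rfl
      exact hne (hx.trans hc.symm)
    · rw [if_neg, if_neg hcx]
      rintro rfl
      exact hne (hc.trans hx.symm)
  · rw [sum_rootMultiplicity, natDegree_sub_C, hdeg]

open Classical in
theorem map_rootMultiplicity_of_general (hγ : γ ≠ 0) {τ : k} (hxw : x ≠ w) (hτ : τ ≠ 0)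
    (hx : (normalForm a b d γ p q).eval x ≠ τ) (hw : (normalForm a b d γ p q).eval w ≠ τ) :
    ((normalForm a b d γ p q - C τ).roots.toFinset.val.map fun c =>
      (normalForm a b d γ p q - C τ).rootMultiplicity c) =
      Multiset.replicate (a + b + 2 * d) 1 := by
  have hdeg := natDegree_normalForm (a := a) (b := b) (d := d) hγ p q
  have h0 : normalForm a b d γ p q - C τ ≠ 0 := fun h0 => by
    rw [sub_eq_zero.1 h0, natDegree_C] at hdeg; omega
  have h1 : ∀ c ∈ (normalForm a b d γ p q - C τ).roots.toFinset,
      (normalForm a b d γ p q - C τ).rootMultiplicity c = 1 := fun c hc => by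
    rw [Multiset.mem_toFinset, mem_roots h0] at hc
    have hc : (normalForm a b d γ p q).eval c = τ := by simpa [sub_eq_zero] using hc
    rw [rootMultiplicity_normalForm_sub ha hb hd hs hxw hτ hc, if_neg, if_neg]
    · rintro rfl; exact hw hc
    · rintro rfl; exact hx hc
  rw [Multiset.eq_replicate]
  refine ⟨?_, fun j hj => ?_⟩
  · rw [Multiset.card_map, Finset.card_val, Finset.card_eq_sum_ones, ← Finset.sum_congr rfl h1,
      sum_rootMultiplicity, natDegree_sub_C, hdeg]
  · obtain ⟨c, hc, rfl⟩ := Multiset.mem_map.1 hj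
    exact h1 c hc

-- `A ≠ 0` and `B ≠ 0` mean `w ≠ 0, 1`, so that the quadratic factor does not vanish at `0` and `1`;
-- `D ≠ 0` makes its two roots distinct.
open Classical in
theorem map_rootMultiplicity_zero (hγ : γ ≠ 0) (hx0 : x ≠ 0) (hx1 : 1 - x ≠ 0)
    (hA : polyA a b d x ≠ 0) (hB : polyB a b d x ≠ 0) (hD : polyD a b d x ≠ 0) :
    ((normalForm a b d γ p q - C 0).roots.toFinset.val.map fun c =>
      (normalForm a b d γ p q - C 0).rootMultiplicity c) = {a, b, d, d} ∧
    (normalForm a b d γ p q - C 0).rootMultiplicity 0 = a ∧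
    (normalForm a b d γ p q - C 0).rootMultiplicity 1 = b := by
  have ha' : (a : k) ≠ 0 := Nat.cast_ne_zero.2 ha.ne'
  have hb' : (b : k) ≠ 0 := Nat.cast_ne_zero.2 hb.ne'
  have hd' : (d : k) ≠ 0 := Nat.cast_ne_zero.2 hd.ne'
  have hn : (a + b + 2 * d : k) ≠ 0 := by exact_mod_cast (by omega : a + b + 2 * d ≠ 0)
  have hw0 : w ≠ 0 := fun h => mul_ne_zero ha' hA (by rw [← hs.mul_polyC, h, mul_zero])
  have hw1 : 1 - w ≠ 0 := fun h =>
    mul_ne_zero hb' hB (by rw [← hs.mul_polyC_one_sub, h, mul_zero])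
  have hdisc := hs.discrim_mul ha
  obtain ⟨r, hr⟩ := IsAlgClosed.exists_root (quad p q) (by
    have := degree_quadratic (a := (1 : k)) (b := p) (c := q) one_ne_zero
    rw [C_1, one_mul] at this
    rw [quad, this]; decide)
  obtain ⟨s, hp⟩ : ∃ s, p = -(r + s) := ⟨-p - r, by ring⟩
  have hq : q = r * s := by
    simp only [IsRoot, quad, eval_add, eval_pow, eval_X, eval_mul, eval_C] at hr
    rw [hp] at hr
    linear_combination hr
  have hq0 : r * s ≠ 0 := fun h => by
    have := hs.at_zero
    rw [hq, h, mul_zero] at this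
    exact mul_ne_zero (mul_ne_zero hn (pow_ne_zero 2 hx0)) hw0 this.symm
  have hq1 : (1 - r) * (1 - s) ≠ 0 := fun h => by
    have := hs.at_one
    rw [hq, hp, show 1 + -(r + s) + r * s = 0 by rw [← h]; ring, mul_zero] at this
    exact mul_ne_zero (mul_ne_zero hn (pow_ne_zero 2 hx1)) hw1 this.symm
  have hr0 : r ≠ 0 := left_ne_zero_of_mul hq0
  have hs0 : s ≠ 0 := right_ne_zero_of_mul hq0
  have hr1 : r ≠ 1 := fun h => left_ne_zero_of_mul hq1 (by rw [h, sub_self])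
  have hs1 : s ≠ 1 := fun h => right_ne_zero_of_mul hq1 (by rw [h, sub_self])
  have hrs : r ≠ s := by
    rintro rfl
    rw [hp, hq, show ((-(r + r)) ^ 2 - 4 * (r * r)) = 0 by ring, zero_mul] at hdisc
    refine mul_ne_zero (mul_ne_zero (mul_ne_zero (mul_ne_zero (by norm_num) (pow_ne_zero 2 hd'))
      (pow_ne_zero 2 hx0)) (pow_ne_zero 2 hx1)) hD (neg_eq_zero.1 hdisc.symm)
  set M : Multiset k := Multiset.replicate a 0 + Multiset.replicate b 1 + Multiset.replicate d r +
    Multiset.replicate d s with hM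
  have hF : normalForm a b d γ p q - C 0 = C γ * (M.map fun c => X - C c).prod := by
    rw [hM, normalForm, quad, hp, hq]
    simp only [Multiset.map_add, Multiset.prod_add, Multiset.map_replicate, Multiset.prod_replicate,
      map_neg, map_add, map_mul, map_zero, map_one, sub_zero]
    rw [mul_assoc _ _ ((X - C s) ^ d), ← mul_pow]
    congr 3
    ring
  have hroots : (normalForm a b d γ p q - C 0).roots = M := by
    rw [hF, roots_C_mul _ hγ, roots_multiset_prod_X_sub_C]
  have hcount : ∀ c, (normalForm a b d γ p q - C 0).rootMultiplicity c = M.count c := fun c => by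
    rw [← count_roots, hroots]
  have hfin : M.toFinset = {0, 1, r, s} := by
    ext c
    simp [hM, ha.ne', hb.ne', hd.ne']
  have c0 : M.count 0 = a := by
    simp [hM, Multiset.count_replicate, hr0, hs0]
  have c1 : M.count 1 = b := by
    simp [hM, Multiset.count_replicate, hr1, hs1]
  have cr : M.count r = d := by
    simp [hM, Multiset.count_replicate, hr1.symm, hr0.symm, hrs.symm]
  have cs : M.count s = d := by
    simp [hM, Multiset.count_replicate, hs1.symm, hs0.symm, hrs]
  refine ⟨?_, by rw [hcount, c0], by rw [hcount, c1]⟩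
  simp only [hcount, hroots, hfin]
  rw [Finset.insert_val_of_notMem, Finset.insert_val_of_notMem, Finset.insert_val_of_notMem]
  · simp [c0, c1, cr, cs]
  · simpa using hrs
  · simp [hr1.symm, hs1.symm]
  · simp [hr0.symm, hs0.symm]

end Ramification

end Semicubical

/-! ### Recovering the normal form from the ramification. -/

namespace Semicubical

variable {k : Type u} [Field k] [CharZero k] {a b d : ℕ}

omit [CharZero k] in
theorem isCoprime_pow_of_eval_ne_zero {F : k[X]} {c : k} (h : F.eval c ≠ 0) (m : ℕ) :
    IsCoprime ((X - C c) ^ m) F := by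
  refine IsCoprime.pow_left ?_
  rw [(irreducible_X_sub_C c).coprime_iff_not_dvd, dvd_iff_isRoot]
  exact h

theorem pow_dvd_derivative {F : k[X]} {c τ : k} {e : ℕ}
    (h : (F - C τ).rootMultiplicity c = e + 1) :
    F.eval c = τ ∧ (X - C c) ^ e ∣ derivative F := by
  have h0 : F - C τ ≠ 0 := fun h0 => by rw [h0, rootMultiplicity_zero] at h; omega
  have hr : (F - C τ).IsRoot c := (rootMultiplicity_pos h0).1 (by omega)
  have h1 := derivative_rootMultiplicity_of_root hr
  rw [h, derivative_sub, derivative_C, sub_zero, Nat.add_sub_cancel] at h1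
  exact ⟨by simpa [sub_eq_zero] using hr, h1 ▸ pow_rootMultiplicity_dvd _ _⟩

open Classical in
/-- A polynomial with the ramification of the normal form over zero. -/
theorem exists_eq_normalForm [IsAlgClosed k] (ha : 0 < a) (hb : 0 < b) {F : k[X]}
    (h0 : (F.roots.toFinset.val.map fun c => F.rootMultiplicity c) = {a, b, d, d})
    (hF0 : F.rootMultiplicity 0 = a) (hF1 : F.rootMultiplicity 1 = b) :
    ∃ γ p q, F = normalForm a b d γ p q := by
  have hne : F ≠ 0 := by rintro rfl; rw [rootMultiplicity_zero] at hF0; omega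
  have hmem : ∀ c, 0 < F.rootMultiplicity c → c ∈ F.roots.toFinset.val := fun c hc => by
    rw [Finset.mem_val, Multiset.mem_toFinset, mem_roots hne]
    exact (rootMultiplicity_pos hne).1 hc
  -- Removing the roots `0` and `1` with their multiplicities `a` and `b` leaves two roots, both of
  -- multiplicity `d`.
  obtain ⟨T, hT⟩ := Multiset.exists_cons_of_mem (hmem 0 (by omega))
  have h1 := hmem 1 (by omega)
  rw [hT, Multiset.mem_cons] at h1
  obtain ⟨U, hU⟩ := Multiset.exists_cons_of_mem (h1.resolve_left one_ne_zero)
  rw [hU] at hT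
  rw [hT, Multiset.map_cons, Multiset.map_cons, hF0, hF1, Multiset.insert_eq_cons,
    Multiset.cons_inj_right, Multiset.insert_eq_cons, Multiset.cons_inj_right] at h0
  have hcard := congrArg Multiset.card h0
  rw [Multiset.card_map, Multiset.card_eq_two.2 ⟨d, d, rfl⟩] at hcard
  obtain ⟨r, s, rfl⟩ := Multiset.card_eq_two.1 hcard
  have hr : F.rootMultiplicity r = d := by
    have : F.rootMultiplicity r ∈ ({d, d} : Multiset ℕ) := by rw [← h0]; simp
    simpa using this
  have hs : F.rootMultiplicity s = d := by
    have : F.rootMultiplicity s ∈ ({d, d} : Multiset ℕ) := by rw [← h0]; simp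
    simpa using this
  refine ⟨F.leadingCoeff, -(r + s), r * s, ?_⟩
  conv_lhs => rw [(IsAlgClosed.splits F).eq_prod_roots, Finset.prod_multiset_map_count]
  have : ∀ f : k → k[X], ∏ c ∈ F.roots.toFinset, f c = f 0 * (f 1 * (f r * f s)) := fun f => by
    rw [Finset.prod, hT]
    simp
  rw [this]
  simp only [count_roots, hF0, hF1, hr, hs, normalForm, quad]
  rw [← mul_pow, ← mul_assoc (_ ^ a), C_0, C_1, sub_zero]
  congr 3
  simp only [map_neg, map_add, map_mul]
  ring

/-- `(X - x)²` and `X - w` divide `F'` and are prime to `F`, so their product divides the cubic in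
the logarithmic derivative. Comparing leading coefficients gives equality. -/
theorem system_of_rootMultiplicity (ha : 0 < a) {γ p q x w v : k} (hv0 : v ≠ 0) (hv1 : v ≠ 1)
    (hx : (normalForm a b d γ p q - C 1).rootMultiplicity x = 3)
    (hw : (normalForm a b d γ p q - C v).rootMultiplicity w = 2) :
    System a b d x w p q := by
  have hn : (a + b + 2 * d : k) ≠ 0 := by exact_mod_cast (by omega : a + b + 2 * d ≠ 0)
  obtain ⟨hx1, hx2⟩ := pow_dvd_derivative hx
  obtain ⟨hw1, hw2⟩ := pow_dvd_derivative hw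
  have hid := derivative_normalForm_mul a b d γ p q
  set F := normalForm a b d γ p q with hF
  set G := (a : k[X]) * (X - 1) * quad p q + (b : k[X]) * X * quad p q +
        (d : k[X]) * X * (X - 1) * (2 * X + C p) with hG
  have hxw : x ≠ w := by
    rintro rfl
    exact hv1 (hw1.symm.trans hx1)
  have hd1 : (X - C x) ^ 2 ∣ G :=
    (isCoprime_pow_of_eval_ne_zero (by rw [hx1]; exact one_ne_zero) 2).dvd_of_dvd_mul_left
      (hid ▸ dvd_mul_of_dvd_left hx2 _)
  have hd2 : (X - C w) ^ 1 ∣ G :=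
    (isCoprime_pow_of_eval_ne_zero (by rw [hw1]; exact hv0) 1).dvd_of_dvd_mul_left
      (hid ▸ dvd_mul_of_dvd_left hw2 _)
  have hdvd : (X - C x) ^ 2 * (X - C w) ∣ G := by
    refine IsCoprime.mul_dvd ?_ hd1 (by simpa using hd2)
    exact (isCoprime_X_sub_C_of_isUnit_sub (sub_ne_zero.2 hxw).isUnit).pow_left
  have hGc : G = C (a + b + 2 * d : k) * X ^ 3 +
      C (a * (p - 1) + b * p + d * (p - 2) : k) * X ^ 2 +
      C (a * (q - p) + b * q - d * p) * X + C (-(a * q)) := by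
    rw [hG, quad]
    simp only [map_neg, map_add, map_mul, map_sub, map_natCast, map_one, C_ofNat]
    ring
  have hM : ((X - C x) ^ 2 * (X - C w)).Monic := ((monic_X_sub_C x).pow 2).mul (monic_X_sub_C w)
  have hMd : ((X - C x) ^ 2 * (X - C w)).natDegree = 3 := by
    rw [((monic_X_sub_C x).pow 2).natDegree_mul (monic_X_sub_C w), natDegree_pow,
      natDegree_X_sub_C, natDegree_X_sub_C]
  have h := eq_leadingCoeff_mul_of_monic_of_dvd_of_natDegree_le hM hdvd
    (by rw [hMd, hGc]; exact natDegree_cubic_le)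
  have hlead : G.leadingCoeff = a + b + 2 * d := by
    rw [hGc]; exact leadingCoeff_cubic hn
  rw [hlead] at h
  exact system_iff.2 h

end Semicubical

/-! ### Covers of the given type and normal forms. -/

section Covers

open Semicubical CurveCover

variable {k : Type u} [Field k] {a b d : ℕ}

theorem semicubical_isCoverOfType_iff {Y : CurveCover k} {v : k} :
    (semicubical a b d).IsCoverOfType (basicPencil v) Y ↔
      Y.degree = a + b + 2 * d ∧
      Y.HasRamification (v : OnePoint k) (2 ::ₘ Multiset.replicate (a + b + 2 * d - 2) 1) ∧
      Y.HasRamification ((0 : k) : OnePoint k) {a, b, d, d} ∧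
      Y.HasRamification ((1 : k) : OnePoint k) (3 ::ₘ Multiset.replicate (a + b + 2 * d - 3) 1) ∧
      Y.HasRamification OnePoint.infty {a + b + 2 * d} ∧
      ∀ τ : k, τ ≠ v → τ ≠ 0 → τ ≠ 1 →
        Y.HasRamification (τ : OnePoint k) (Multiset.replicate (a + b + 2 * d) 1) := by
  constructor
  · rintro ⟨h1, h2, h3⟩
    refine ⟨h1, h2 0, h2 1, h2 2, h2 3, fun τ hv h0 h1 => h3 τ fun i => ?_⟩
    fin_cases i
    · exact fun h => hv (OnePoint.coe_injective h)
    · exact fun h => h0 (OnePoint.coe_injective h)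
    · exact fun h => h1 (OnePoint.coe_injective h)
    · exact OnePoint.coe_ne_infty τ
  · rintro ⟨h1, h2, h3, h4, h5, h6⟩
    refine ⟨h1, fun i => ?_, fun τ hτ => ?_⟩
    · fin_cases i
      · exact h2
      · exact h3
      · exact h4
      · exact h5
    · induction τ using OnePoint.rec with
      | infty => exact absurd rfl (hτ 3)
      | coe τ =>
        refine h6 τ (fun h => hτ 0 ?_) (fun h => hτ 1 ?_) (fun h => hτ 2 ?_) <;> rw [h] <;> rfl

variable [CharZero k] [IsAlgClosed k] (ha : 0 < a) (hb : 0 < b) (hd : 0 < d)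

-- The ramification over `v, 0, 1` is `1 + (n - 4) + 2 = n - 1 < n`, as the genus zero criterion
-- requires.
include ha hb hd in
theorem exists_isPolynomialCover_of_isCoverOfType {Y : CurveCover k} {v : k} (hv0 : v ≠ 0)
    (hv1 : v ≠ 1) (h : (semicubical a b d).IsCoverOfType (basicPencil v) Y) :
    ∃ y F, Y.IsPolynomialCover y F := by
  classical
  obtain ⟨h1, h2, h3, h4, h5, h6⟩ := semicubical_isCoverOfType_iff.1 h
  set n := a + b + 2 * d with hn
  have hn4 : 4 ≤ n := by omega
  let M : k → Multiset ℕ := fun τ => if τ = v then 2 ::ₘ Multiset.replicate (n - 2) 1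
    else if τ = 0 then {a, b, d, d} else if τ = 1 then 3 ::ₘ Multiset.replicate (n - 3) 1
    else Multiset.replicate n 1
  have hMv : M v = 2 ::ₘ Multiset.replicate (n - 2) 1 := if_pos rfl
  have hM0 : M 0 = {a, b, d, d} := by simp [M, hv0.symm]
  have hM1 : M 1 = 3 ::ₘ Multiset.replicate (n - 3) 1 := by simp [M, hv1.symm]
  refine exists_isPolynomialCover (M := M) (T := {v, 0, 1}) (by omega) (by rwa [h1]) (fun τ => ?_)
    (fun τ hτ => ?_) ?_
  · by_cases hv : τ = v
    · rw [hv, hMv]; exact h2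
    by_cases h0 : τ = 0
    · rw [h0, hM0]; exact h3
    by_cases h1 : τ = 1
    · rw [h1, hM1]; exact h4
    · simpa only [M, if_neg hv, if_neg h0, if_neg h1] using h6 τ hv h0 h1
  · simp only [Finset.mem_insert, Finset.mem_singleton, not_or] at hτ
    simp only [M, if_neg hτ.1, if_neg hτ.2.1, if_neg hτ.2.2, Multiset.card_replicate, h1]
  · rw [Finset.sum_insert (by simp [hv0, hv1]), Finset.sum_insert (by simp), Finset.sum_singleton,
      hMv, hM0, hM1, h1]
    simp
    omega

include ha in
theorem isNormalForm_of_isCoverOfType {Y : CurveCover k} {v x : k} (hv0 : v ≠ 0)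
    (hv1 : v ≠ 1) (h : (semicubical a b d).IsCoverOfType (basicPencil v) Y) {y : Y.K} {F : k[X]}
    (hF : Y.IsPolynomialCover y F) (hb : 0 < b)
    (h0 : F.rootMultiplicity 0 = a) (h1 : F.rootMultiplicity 1 = b)
    (hx : (F - C 1).rootMultiplicity x = 3) : IsNormalForm a b d v x F := by
  obtain ⟨-, h2, h3, -, -, -⟩ := semicubical_isCoverOfType_iff.1 h
  have e0 := (hF.hasRamification 0).unique h3
  rw [C_0, sub_zero] at e0
  obtain ⟨γ, p, q, rfl⟩ := exists_eq_normalForm ha hb e0 h0 h1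
  obtain ⟨P, hP⟩ := h2.exists_liesOver (Multiset.mem_cons_self _ _)
  obtain ⟨w, hw, -⟩ := hF.exists_value hP.1
  have hw := (hF.liesOver_iff hw).1 hP
  exact ⟨γ, w, p, q, rfl, system_of_rootMultiplicity ha hv0 hv1 hx hw.2,
    (pow_dvd_derivative hx).1, hw.1⟩

-- `v ≠ 0` makes the numerator of `π` nonzero, hence also `A`, `B`, `D`, which settles the zero
-- fibre; `v ≠ 1` separates `x` from `w`.
include ha hb hd in
theorem isCoverOfType_of_isNormalForm {Y : CurveCover k} {v x : k} (hv0 : v ≠ 0)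
    (hv1 : v ≠ 1) {y : Y.K} {F : k[X]} (hF : Y.IsPolynomialCover y F)
    (h : IsNormalForm a b d v x F) : (semicubical a b d).IsCoverOfType (basicPencil v) Y ∧
      F.rootMultiplicity 0 = a ∧ F.rootMultiplicity 1 = b ∧ F.natDegree = a + b + 2 * d ∧
      (F - C 1).rootMultiplicity x = 3 := by
  classical
  obtain ⟨hden, hnum⟩ := h.numer_eq ha hb hd
  obtain ⟨hx0, hx1⟩ := h.ne ha hb
  obtain ⟨hA, hB, hD⟩ := ne_zero_of_numer_ne_zero ha hb hd
    (by rw [hnum]; exact mul_ne_zero hv0 hden)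
  obtain ⟨γ, w, p, q, rfl, hs, h1, h2⟩ := h
  have hγ : γ ≠ 0 := by
    rintro rfl
    simp [normalForm] at h1
  have hxw : x ≠ w := by
    rintro rfl
    exact hv1 (h2.symm.trans h1)
  have hne : (normalForm a b d γ p q).eval x ≠ (normalForm a b d γ p q).eval w := by
    rw [h1, h2]; exact hv1.symm
  have hdeg := natDegree_normalForm (a := a) (b := b) (d := d) hγ p q
  obtain ⟨e0, e1, e2⟩ := map_rootMultiplicity_zero ha hb hd hs hγ hx0 hx1 hA hB hD
  have hr0 := hF.hasRamification 0
  rw [e0] at hr0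
  have hr1 := hF.hasRamification 1
  rw [map_rootMultiplicity_of_special ha hb hd hs hγ hxw one_ne_zero h1 (Or.inl ⟨rfl, rfl⟩) hne]
    at hr1
  have hrv := hF.hasRamification v
  rw [map_rootMultiplicity_of_special ha hb hd hs hγ hxw hv0 h2 (Or.inr ⟨rfl, rfl⟩) hne] at hrv
  refine ⟨semicubical_isCoverOfType_iff.2 ⟨hF.degree_eq.trans hdeg, hrv, hr0, hr1, ?_,
    fun τ hτv hτ0 hτ1 => ?_⟩, ?_, ?_, hdeg, ?_⟩
  · rw [← hdeg]; exact hF.hasRamification_infty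
  · have hr := hF.hasRamification τ
    rwa [map_rootMultiplicity_of_general ha hb hd hs hγ hxw hτ0 (by rw [h1]; exact hτ1.symm)
      (by rw [h2]; exact hτv.symm)] at hr
  · simpa using e1
  · simpa using e2
  · rw [rootMultiplicity_normalForm_sub ha hb hd hs hxw one_ne_zero h1, if_pos rfl]

end Covers

/-! ### The coordinate on the moduli space. -/

section Coordinates

open Semicubical CurveCover

section Field

variable {k : Type u} [Field k] {a b d : ℕ}

theorem semicubicalCoordinate_of_rootMultiplicity {Y : CurveCover k} {y : Y.K} {F : k[X]} {x : k}
    (hF : Y.IsPolynomialCover y F) (ha : 0 < a) (hb : 0 < b)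
    (h0 : F.rootMultiplicity 0 = a) (h1 : F.rootMultiplicity 1 = b)
    (hdeg : F.natDegree = a + b + 2 * d) (hx : (F - C 1).rootMultiplicity x = 3) :
    semicubicalCoordinate a b d k Y (x : OnePoint k) := by
  obtain ⟨Pa, hPa⟩ := hF.generates.exists_point ((0 : k) : OnePoint k)
  obtain ⟨Pb, hPb⟩ := hF.generates.exists_point ((1 : k) : OnePoint k)
  obtain ⟨Pi, hPi⟩ := hF.generates.exists_point OnePoint.infty
  obtain ⟨Px, hPx⟩ := hF.generates.exists_point (x : OnePoint k)
  have hroot : ∀ {c : k}, 0 < F.rootMultiplicity c → F.eval c = 0 := fun hc =>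
    (rootMultiplicity_pos hF.ne_zero).1 hc
  refine ⟨y, Pa, Pb, Pi, Px, hF.generates, ?_, hPa, ?_, hPb, ?_, hPi, ?_, hPx⟩
  · exact (hF.liesOver_iff hPa).2 ⟨hroot (by omega), by rwa [C_0, sub_zero]⟩
  · exact (hF.liesOver_iff hPb).2 ⟨hroot (by omega), by rwa [C_0, sub_zero]⟩
  · rw [← hdeg]; exact hF.liesOver_infty hPi
  · refine (hF.liesOver_iff hPx).2 ⟨?_, hx⟩
    have := (rootMultiplicity_pos (hF.sub_C_ne_zero 1)).1 (by rw [hx]; norm_num)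
    simpa [sub_eq_zero] using this

theorem exists_rootMultiplicity_of_semicubicalCoordinate [IsAlgClosed k] {Y : CurveCover k}
    (hinf : Y.HasRamification OnePoint.infty {a + b + 2 * d}) {c : OnePoint k}
    (hc : semicubicalCoordinate a b d k Y c) :
    ∃ (y : Y.K) (F : k[X]) (x : k), c = x ∧ Y.IsPolynomialCover y F ∧ F.rootMultiplicity 0 = a ∧
      F.rootMultiplicity 1 = b ∧ (F - C 1).rootMultiplicity x = 3 := by
  obtain ⟨y, Pa, Pb, Pi, Px, hy, ha, hya, hb, hyb, hi, hyi, hx, hyx⟩ := hc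
  obtain ⟨F, hF⟩ := Generates.exists_isPolynomialCover hy hinf hi.1 hyi
  induction c using OnePoint.rec with
  | infty =>
    exact absurd (((hF.takesValue_infty_iff Px).2 hyx).unique hx.1) (OnePoint.infty_ne_coe 1)
  | coe x =>
    refine ⟨y, F, x, rfl, hF, ?_, ?_, ((hF.liesOver_iff hyx).1 hx).2⟩
    · simpa using ((hF.liesOver_iff hya).1 ha).2
    · simpa using ((hF.liesOver_iff hyb).1 hb).2

variable [CharZero k] [IsAlgClosed k] (ha : 0 < a) (hb : 0 < b) (hd : 0 < d)
  {v : k} (hv0 : v ≠ 0) (hv1 : v ≠ 1)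
include ha hb hd hv0 hv1

omit hd in
theorem exists_isNormalForm_of_semicubicalCoordinate {Y : CurveCover k}
    (h : (semicubical a b d).IsCoverOfType (basicPencil v) Y) {c : OnePoint k}
    (hc : semicubicalCoordinate a b d k Y c) :
    ∃ (y : Y.K) (F : k[X]) (x : k), c = x ∧ Y.IsPolynomialCover y F ∧ IsNormalForm a b d v x F := by
  obtain ⟨-, -, -, -, h5, -⟩ := semicubical_isCoverOfType_iff.1 h
  obtain ⟨y, F, x, hcx, hF, h0, h1, hx⟩ := exists_rootMultiplicity_of_semicubicalCoordinate h5 hc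
  exact ⟨y, F, x, hcx, hF, isNormalForm_of_isCoverOfType ha hv0 hv1 h hF hb h0 h1 hx⟩

/-- Since `a`, `b`, `d` are distinct, the points of index `a` and `b` over `0` are determined by the
cover. There is exactly one coordinate with values `0`, `1`, `∞` at these points and at the point
over infinity. -/
theorem existsUnique_semicubicalCoordinate (hab : a ≠ b) (had : a ≠ d) (hbd : b ≠ d)
    {Y : CurveCover k} (h : (semicubical a b d).IsCoverOfType (basicPencil v) Y) :
    ∃! c : OnePoint k, semicubicalCoordinate a b d k Y c := by
  obtain ⟨y₀, F₀, hF₀⟩ := exists_isPolynomialCover_of_isCoverOfType ha hb hd hv0 hv1 h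
  obtain ⟨h1, -, h3, h4, h5, -⟩ := semicubical_isCoverOfType_iff.1 h
  have h3' : Y.HasRamification ((0 : k) : OnePoint k) (b ::ₘ {a, d, d}) := by
    rw [Multiset.insert_eq_cons, Multiset.cons_swap]; exact h3
  have h3a : a ∉ ({b, d, d} : Multiset ℕ) := by simp [hab, had]
  have h3b : b ∉ ({a, d, d} : Multiset ℕ) := by simp [hab.symm, hbd]
  have h4x : 3 ∉ Multiset.replicate (a + b + 2 * d - 3) 1 := fun h => by
    have := Multiset.eq_of_mem_replicate h
    omega
  obtain ⟨Pa, hPa⟩ := h3.exists_liesOver (Multiset.mem_cons_self a _)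
  obtain ⟨Pb, hPb⟩ := h3'.exists_liesOver (Multiset.mem_cons_self b _)
  obtain ⟨Px, hPx⟩ := h4.exists_liesOver (Multiset.mem_cons_self 3 _)
  obtain ⟨Pi, hPi⟩ := h5.exists_liesOver (Multiset.mem_singleton_self _)
  obtain ⟨α, hα, -⟩ := hF₀.exists_value hPa.1
  obtain ⟨β, hβ, -⟩ := hF₀.exists_value hPb.1
  have hαβ : β - α ≠ 0 := fun h => by
    obtain rfl := sub_eq_zero.1 h
    obtain rfl := hF₀.generates.point_unique hα hβ
    exact hab (hPa.unique hPb)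
  have hγ : (β - α)⁻¹ ≠ 0 := inv_ne_zero hαβ
  -- The affine function sending `α` to `0` and `β` to `1`.
  set z := Y.const (β - α)⁻¹ * y₀ + Y.const (-((β - α)⁻¹ * α)) with hz
  have hz' : z = aeval y₀ (C (β - α)⁻¹ * X + C (-((β - α)⁻¹ * α))) := by
    rw [hz, map_add, map_mul, aeval_C, aeval_C, aeval_X]; rfl
  have hgen : Y.Generates z := hF₀.generates.affine hγ _
  have hza : Pa.TakesValue z ((0 : k) : OnePoint k) := by
    have := hα.aeval (C (β - α)⁻¹ * X + C (-((β - α)⁻¹ * α)))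
    rw [← hz'] at this
    simpa using this
  have hzb : Pb.TakesValue z ((1 : k) : OnePoint k) := by
    have := hβ.aeval (C (β - α)⁻¹ * X + C (-((β - α)⁻¹ * α)))
    rw [← hz'] at this
    have e : (C (β - α)⁻¹ * X + C (-((β - α)⁻¹ * α))).eval β = 1 := by
      simp only [eval_add, eval_mul, eval_C, eval_X]
      rw [← sub_eq_add_neg, ← mul_sub, inv_mul_cancel₀ hαβ]
    rwa [e] at this
  have hdeg : (C (β - α)⁻¹ * X + C (-((β - α)⁻¹ * α))).natDegree = 1 :=
    natDegree_linear hγ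
  have hzi : Pi.TakesValue z OnePoint.infty := by
    have h := (hF₀.takesValue_infty_iff Pi).1 hPi.1
    rw [Point.takesValue_infty, hz', Pi.valuation_aeval_infty h (fun h0 => by rw [h0] at hdeg; simp at hdeg),
      hdeg, pow_one]
    exact h
  obtain ⟨c, hc⟩ := hgen.exists_takesValue Px
  refine ⟨c, ⟨z, Pa, Pb, Pi, Px, hgen, hPa, hza, hPb, hzb, hPi, hzi, hPx, hc⟩, ?_⟩
  rintro c' ⟨y, Pa', Pb', Pi', Px', hy, ha', hya, hb', hyb, hi, hyi, hx, hyx⟩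
  obtain rfl := h3.point_unique h3a hPa ha'
  obtain rfl := h3'.point_unique h3b hPb hb'
  obtain rfl := h4.point_unique h4x hPx hx
  obtain rfl := h5.point_unique_singleton hPi.1 hi.1
  obtain rfl := Generates.eq_of_takesValue hgen hy hzi hyi hza hya hzb hyb
  exact hyx.unique hc

end Field

/-- The Belyi map of the theorem, for any moduli problem between the one of all covers and the
one of the covers which are constructed. -/
theorem isHurwitzBelyiMap_of_le {a b d : ℕ} (ha : 0 < a) (hb : 0 < b) (hd : 0 < d) (hab : a ≠ b)
    (had : a ≠ d) (hbd : b ≠ d) {π : RatFunc ℚ}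
    (hπ : π = algebraMap ℚ[X] (RatFunc ℚ) (numer a b d X) / algebraMap ℚ[X] (RatFunc ℚ)
      (denom a b d X)) {T : CoverProblem.{u}}
    (hT : ∀ (k : Type u) [Field k] (v : k) (Y : CurveCover k), T k v Y →
      (semicubical a b d).IsCoverOfType (basicPencil v) Y)
    (hT' : ∀ (k : Type u) [Field k] [CharZero k] [IsAlgClosed k] (v : k), v ≠ 0 → v ≠ 1 →
      ∀ (x : k) (Y : CurveCover k) (y : Y.K) (F : k[X]), Y.IsPolynomialCover y F →
      IsNormalForm a b d v x F → (semicubical a b d).IsCoverOfType (basicPencil v) Y → T k v Y) :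
    IsHurwitzBelyiMap.{u} T π (semicubicalCoordinate a b d) := by
  obtain ⟨hbelyi, hfib⟩ := belyi_facts.{u} ha hb hd hπ
  refine ⟨hbelyi, ?_, ?_, ?_, ?_, ?_⟩
  · intro k _ _ _ v hv0 hv1 Y hY
    exact existsUnique_semicubicalCoordinate ha hb hd hv0 hv1 hab had hbd (hT k v Y hY)
  · intro k _ _ _ v hv0 hv1 Y c hY hc
    obtain ⟨y, F, x, rfl, hF, hN⟩ :=
      exists_isNormalForm_of_semicubicalCoordinate ha hb hv0 hv1 (hT k v Y hY) hc
    exact ((hfib k v hv0).2 x).2 (hN.numer_eq ha hb hd).2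
  · intro k _ _ _ v hv0 hv1 Y Y' c hY hY' hc hc'
    obtain ⟨y, F, x, rfl, hF, hN⟩ :=
      exists_isNormalForm_of_semicubicalCoordinate ha hb hv0 hv1 (hT k v Y hY) hc
    obtain ⟨y', F', x', hx, hF', hN'⟩ :=
      exists_isNormalForm_of_semicubicalCoordinate ha hb hv0 hv1 (hT k v Y' hY') hc'
    obtain rfl := OnePoint.coe_injective hx
    obtain rfl := hN.unique ha hb hd hN'
    exact hF.isIsomorphic hF'
  · intro k _ _ _ v hv0 hv1 c hc
    induction c using OnePoint.rec with
    | infty => exact absurd hc (hfib k v hv0).1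
    | coe x =>
      obtain ⟨F, hN⟩ := exists_isNormalForm ha hb hd (((hfib k v hv0).2 x).1 hc)
      have hpos : 0 < F.natDegree := by
        obtain ⟨γ, w, p, q, rfl, -, h1, -⟩ := hN
        rw [natDegree_normalForm]
        · omega
        · rintro rfl
          simp [normalForm] at h1
      obtain ⟨Y, y, hF⟩ := exists_polynomialCover hpos
      obtain ⟨h1, h2, h3, h4, h5⟩ := isCoverOfType_of_isNormalForm ha hb hd hv0 hv1 hF hN
      exact ⟨Y, hT' k v hv0 hv1 x Y y F hF hN h1,
        semicubicalCoordinate_of_rootMultiplicity hF ha hb h2 h3 h4 h5⟩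
  · rintro k k' _ _ _ _ _ _ σ v hv0 hv1 Y Y' c hY hY' ⟨hdeg, f, hf, hft⟩ hc
    obtain ⟨e1, -, -, -, h5, -⟩ := semicubical_isCoverOfType_iff.1 (hT k v Y hY)
    obtain ⟨e1', -, -, -, h5', -⟩ := semicubical_isCoverOfType_iff.1 (hT k' (σ v) Y' hY')
    obtain ⟨y, F, x, rfl, hF, h0, h1, hx⟩ := exists_rootMultiplicity_of_semicubicalCoordinate h5 hc
    obtain ⟨P, hP⟩ := h5'.exists_liesOver (Multiset.mem_singleton_self _)
    have hF' := hF.map hdeg hf hft (by rwa [e1'] : P.LiesOver OnePoint.infty Y'.degree)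
    refine semicubicalCoordinate_of_rootMultiplicity hF' ha hb ?_ ?_ ?_ ?_
    · rw [← h0, eq_rootMultiplicity_map σ.injective, map_zero]
    · rw [← h1, eq_rootMultiplicity_map σ.injective, map_one]
    · rw [natDegree_map, ← hF.degree_eq, e1]
    · rw [← hx, eq_rootMultiplicity_map σ.injective x]
      simp

end Coordinates

/-! ### Blocks of the monodromy group and decompositions of polynomials. -/

section Composition

variable {k : Type u} [Field k]

/-- If `g - g(η)` divides `F - F(η)` for almost all `η`, then `F` is a polynomial in `g`. -/
theorem exists_eq_comp_of_dvd [Infinite k] {g : k[X]} (hg : 0 < g.natDegree) :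
    ∀ (n : ℕ) (F : k[X]), F.natDegree < n →
      {η : k | ¬ g - C (g.eval η) ∣ F - C (F.eval η)}.Finite → ∃ f : k[X], F = f.comp g := by
  intro n
  induction n with
  | zero => intro F hF; omega
  | succ n ih =>
    intro F hF hfin
    obtain ⟨η, hη⟩ := hfin.infinite_compl.nonempty
    obtain ⟨R, hR⟩ := not_not.1 hη
    have hdeg : (g - C (g.eval η)).natDegree = g.natDegree := natDegree_sub_C
    have hne : g - C (g.eval η) ≠ 0 := fun h0 => by rw [h0] at hdeg; simp at hdeg; omega
    by_cases hR0 : R = 0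
    · refine ⟨C (F.eval η), ?_⟩
      rw [hR0, mul_zero, sub_eq_zero] at hR
      rw [C_comp]; exact hR
    have hRdeg : R.natDegree < n := by
      have h1 := congrArg natDegree hR
      rw [natDegree_sub_C, natDegree_mul hne hR0, hdeg] at h1
      omega
    -- The quotient `R` has smaller degree and inherits the divisibility property outside the finite
    -- fibre of `g` through `η`; this is why finitely many exceptions are allowed.
    obtain ⟨f, rfl⟩ := ih R hRdeg (by
      classical
      have hfib : {η' | g.eval η' = g.eval η}.Finite := by
        refine (g - C (g.eval η)).roots.toFinset.finite_toSet.subset fun η' hη' => ?_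
        simp only [Finset.mem_coe, Multiset.mem_toFinset, mem_roots hne]
        simpa [sub_eq_zero] using hη'
      refine (hfin.union hfib).subset fun η' hη' => ?_
      by_contra hn
      simp only [Set.mem_union, Set.mem_ofPred_eq, not_or, not_not] at hn hη'
      obtain ⟨S, hS⟩ := hn.1
      apply hη'
      have hc : g.eval η' - g.eval η ≠ 0 := sub_ne_zero.2 hn.2
      have h1 : F.eval η' - F.eval η = (g.eval η' - g.eval η) * R.eval η' := by
        have := congrArg (eval η') hR
        simpa using this
      have h2 : (g - C (g.eval η')) ∣ C (g.eval η' - g.eval η) * (R - C (R.eval η')) := by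
        refine ⟨S - R, ?_⟩
        have h3 := congrArg C h1
        simp only [map_sub, map_mul] at h3
        rw [map_sub]
        linear_combination hS - hR + h3
      rwa [(isUnit_C.2 hc.isUnit).dvd_mul_left] at h2)
    refine ⟨C (F.eval η) + (X - C (g.eval η)) * f, ?_⟩
    rw [add_comp, mul_comp, sub_comp, C_comp, C_comp, X_comp]
    linear_combination hR

end Composition

namespace CurveCover

variable {k : Type u} [Field k] {Y : CurveCover k} {y : Y.K} {F : k[X]}

theorem card_sheets [CharZero k] : Fintype.card Y.Sheets = Y.degree := AlgHom.card _ _ _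

theorem monodromy_apply (g : AlgebraicClosure (RatFunc k) ≃ₐ[RatFunc k] AlgebraicClosure (RatFunc k))
    (φ : Y.Sheets) (z : Y.K) : Y.monodromy g φ z = g (φ z) := rfl

namespace IsPolynomialCover

variable (h : Y.IsPolynomialCover y F)
include h

theorem algHom_ext {L : Type*} [Field L] [Algebra (RatFunc k) L] {φ ψ : Y.K →ₐ[RatFunc k] L}
    (hφ : φ y = ψ y) : φ = ψ := by
  have h1 : φ.comp (⊤ : IntermediateField (RatFunc k) Y.K).val =
      ψ.comp (⊤ : IntermediateField (RatFunc k) Y.K).val :=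
    IntermediateField.algHom_ext_of_eq_adjoin (RatFunc k) h.adjoin_eq_top.symm fun x hx => by
      obtain rfl := Set.mem_singleton_iff.1 hx
      exact hφ
  ext z
  exact DFunLike.congr_fun h1 ⟨z, trivial⟩

theorem isIntegral : IsIntegral k[X] y := by
  have h1 : (F * C F.leadingCoeff⁻¹).Monic := monic_mul_leadingCoeff_inv h.ne_zero
  refine ⟨(F * C F.leadingCoeff⁻¹).map C - C (X * C F.leadingCoeff⁻¹), ?_, ?_⟩
  · refine (h1.map C).sub_of_left (degree_C_le.trans_lt ?_)
    rw [degree_map, ← natDegree_pos_iff_degree_pos, natDegree_mul_leadingCoeff_inv _ h.ne_zero]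
    exact h.natDegree_pos
  · have e : (algebraMap k[X] Y.K).comp C = algebraMap k Y.K := by
      ext c
      simp [algebraMap_polynomial]
    rw [eval₂_sub, eval₂_map, eval₂_C, e, ← aeval_def, map_mul, aeval_C, map_mul,
      algebraMap_polynomial, algebraMap_polynomial, aeval_X, aeval_C, h.covering_eq, sub_self]

variable [CharZero k]

/-- Transitivity: all images of `y` have the same minimal polynomial, and `y` determines the sheet.
-/
theorem exists_monodromy_eq (φ ψ : Y.Sheets) : ∃ g, Y.monodromy g φ = ψ := by
  have h1 : IsConjRoot (RatFunc k) (ψ y) (φ y) := by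
    rw [IsConjRoot, minpoly.algHom_eq _ ψ.injective, minpoly.algHom_eq _ φ.injective]
  obtain ⟨g, hg⟩ := isConjRoot_iff_exists_algEquiv.1 h1
  exact ⟨g, h.algHom_ext hg⟩

/-- A function all of whose conjugates are fixed by the stabiliser of a sheet comes from that
sheet. -/
theorem exists_sheet_eq (φ : Y.Sheets) {u : AlgebraicClosure (RatFunc k)}
    (hu : ∀ g, Y.monodromy g φ = φ → g u = u) : ∃ z, φ z = u := by
  have h1 := InfiniteGalois.fixedField_fixingSubgroup φ.fieldRange
  have h2 : u ∈ IntermediateField.fixedField φ.fieldRange.fixingSubgroup := fun g => by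
    refine hu g.1 (h.algHom_ext ?_)
    exact (IntermediateField.mem_fixingSubgroup_iff _ _).1 g.2 (φ y) ⟨y, rfl⟩
  rw [h1] at h2
  exact h2

end IsPolynomialCover

namespace IsTotallyRamified

variable {P : Y.Point} {ϖ : Y.K} {W : ValuationSubring (AlgebraicClosure (RatFunc k))}

/-- Functions with the same valuation have the same valuation on all sheets. -/
theorem valuation_sheet_eq (hW : ∀ (σ : Y.Sheets) (f : Y.K), σ f ∈ W ↔ f ∈ P.ring) (φ : Y.Sheets)
    {f g : Y.K} (hfg : P.ring.valuation f = P.ring.valuation g) :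
    W.valuation (φ f) = W.valuation (φ g) := by
  by_cases hg : g = 0
  · rw [hg, map_zero, map_eq_zero] at hfg
    rw [hfg, hg]
  have hg' : P.ring.valuation g ≠ 0 := by simpa using hg
  have hf' : P.ring.valuation f ≠ 0 := by rw [hfg]; exact hg'
  have h1 : φ (f / g) ∈ W := by
    rw [hW, ← ValuationSubring.valuation_le_one_iff, map_div₀, hfg, div_self hg']
  have h2 : φ (g / f) ∈ W := by
    rw [hW, ← ValuationSubring.valuation_le_one_iff, map_div₀, ← hfg, div_self hf']
  rw [← ValuationSubring.valuation_le_one_iff, map_div₀, map_div₀] at h1 h2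
  have hf0 : 0 < W.valuation (φ f) := by
    rw [zero_lt_iff]; simpa using hf'
  have hg0 : 0 < W.valuation (φ g) := by
    rw [zero_lt_iff]; simpa using hg'
  exact le_antisymm ((div_le_one₀ hg0).1 h1) ((div_le_one₀ hf0).1 h2)

end IsTotallyRamified

namespace IsPolynomialCover

variable (h : Y.IsPolynomialCover y F) [CharZero k] [IsAlgClosed k]
include h

open MulAction in
/-- Blocks of the monodromy group come from decompositions of the polynomial. -/
theorem exists_comp_of_isBlock {B : Set Y.Sheets} (hB : IsBlock Y.monodromy.range B)
    (hne : B.Nonempty) : ∃ f g : k[X], F = f.comp g ∧ g.natDegree = B.ncard := by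
  classical
  obtain ⟨φ₀, hφ₀⟩ := hne
  have hinf := h.hasRamification_infty
  rw [← h.degree_eq] at hinf
  obtain ⟨P, ϖ, hP⟩ := hinf.exists_isTotallyRamified
  obtain ⟨W, hW⟩ := hP.exists_valuationSubring
  set S : Finset Y.Sheets := B.toFinset with hS
  have hcard : S.card = B.ncard := (Set.ncard_eq_toFinset_card' B).symm
  have hyP : P.TakesValue y OnePoint.infty := (h.takesValue_infty_iff P).1 hP.takesValue
  -- The product of the conjugates of `y` in the block. An automorphism sending one sheet of the
  -- block into the block preserves the block and fixes `u`. Hence `u` comes from a function `z`,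
  -- which is integral and so a polynomial `g₀` in `y`.
  set u := ∏ φ ∈ S, φ y with hu
  have hstab : ∀ (g) (φ : Y.Sheets), φ ∈ B → Y.monodromy g φ ∈ B → g u = u := by
    intro g φ h1 h2
    have h3 := hB.smul_eq_of_mem (g := (⟨Y.monodromy g, g, rfl⟩ : Y.monodromy.range)) h1 h2
    have h4 : S.image (Y.monodromy g) = S := by
      rw [← Finset.coe_inj, Finset.coe_image, hS, Set.coe_toFinset]
      exact h3
    conv_rhs => rw [hu, ← h4, Finset.prod_image fun _ _ _ _ e => (Y.monodromy g).injective e]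
    rw [hu, map_prod]
    rfl
  obtain ⟨z, hz⟩ := h.exists_sheet_eq φ₀ fun g hg => hstab g φ₀ hφ₀ (by rw [hg]; exact hφ₀)
  have hzint : IsIntegral k[X] z := by
    have h1 : IsIntegral k[X] u := IsIntegral.prod _ fun φ _ => by
      have := h.isIntegral.map (φ.restrictScalars k[X])
      exact this
    rw [← hz] at h1
    exact (isIntegral_algHom_iff (φ₀.restrictScalars k[X]) φ₀.injective).1 h1
  obtain ⟨g₀, hg₀⟩ := h.generates.exists_aeval (f := z) fun Q hQ => by
    rw [← h.takesValue_infty_iff, Point.takesValue_infty, not_lt] at hQ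
    exact (Q.ring.valuation_le_one_iff _).2 (Point.mem_ring_of_isIntegral hQ hzint)
  have hφz : ∀ φ ∈ S, φ z = u := fun φ hφ => by
    obtain ⟨g, rfl⟩ := h.exists_monodromy_eq φ₀ φ
    rw [monodromy_apply, hz]
    exact hstab g φ₀ hφ₀ (Set.mem_toFinset.1 hφ)
  have hu0 : u ≠ 0 := Finset.prod_ne_zero_iff.2 fun φ _ => by
    simpa using h.generates.ne_zero
  have hg0 : g₀ ≠ 0 := by
    rintro rfl
    rw [map_zero] at hg₀
    rw [hg₀, map_zero] at hz
    exact hu0 hz.symm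
  -- All conjugates of `y` have the same valuation, since `t` has the valuation of `y ^ deg F` on
  -- every sheet. Comparing `u` with `g₀(y)` gives the degree of `g₀`.
  have hval : ∀ φ : Y.Sheets, W.valuation (φ y) = W.valuation (φ₀ y) := fun φ => by
    have h1 : P.ring.valuation Y.covering = P.ring.valuation (y ^ F.natDegree) := by
      rw [h.covering_eq, P.valuation_aeval_infty hyP h.ne_zero, map_pow]
    have h2 := IsTotallyRamified.valuation_sheet_eq hW φ h1
    have h3 := IsTotallyRamified.valuation_sheet_eq hW φ₀ h1
    rw [map_pow, map_pow, covering, AlgHom.commutes] at h2 h3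
    exact (pow_left_inj₀ zero_le zero_le h.natDegree_pos.ne').1 (h2.symm.trans h3)
  have hdeg : g₀.natDegree = S.card := by
    have h1 : P.ring.valuation z = P.ring.valuation (y ^ g₀.natDegree) := by
      rw [hg₀, P.valuation_aeval_infty hyP hg0, map_pow]
    have h2 := IsTotallyRamified.valuation_sheet_eq hW φ₀ h1
    rw [hz, hu, map_prod, Finset.prod_congr rfl fun φ _ => hval φ, Finset.prod_const, map_pow,
      map_pow] at h2
    have h3 : 1 < W.valuation (φ₀ y) := by
      rw [← not_le, ValuationSubring.valuation_le_one_iff, hW,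
        ← ValuationSubring.valuation_le_one_iff, not_le]
      exact hyP
    exact (pow_right_injective₀ (zero_lt_one.trans h3) h3.ne' h2).symm
  have hpos : 0 < S.card := Finset.card_pos.2 ⟨φ₀, Set.mem_toFinset.2 hφ₀⟩
  set g := g₀ * C g₀.leadingCoeff⁻¹ with hg
  have hgm : g.Monic := monic_mul_leadingCoeff_inv hg0
  have hgdeg : g.natDegree = S.card := by rw [hg, natDegree_mul_leadingCoeff_inv _ hg0, hdeg]
  have hgy : ∀ φ ∈ S, φ (aeval y g) = φ₀ (aeval y g) := fun φ hφ => by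
    rw [hg, map_mul (aeval y), ← hg₀, map_mul, map_mul, hφz φ hφ, hz, aeval_C,
      IsScalarTower.algebraMap_apply k (RatFunc k) Y.K, AlgHom.commutes, AlgHom.commutes]
  -- On the sheet `φ₀`, `g(X) - g(y)` is the product of `X - φ y` over the block, and each `φ y` is
  -- a root of `F(X) - t`.
  have hdvd : g.map (algebraMap k Y.K) - C (aeval y g) ∣
      F.map (algebraMap k Y.K) - C (aeval y F) := by
    rw [← map_dvd_map' (φ₀ : Y.K →+* AlgebraicClosure (RatFunc k))]
    have heval : ∀ (p : k[X]) (φ : Y.Sheets), ((p.map (algebraMap k Y.K) - C (aeval y p)).map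
        (φ₀ : Y.K →+* AlgebraicClosure (RatFunc k))).eval (φ y) =
          φ (aeval y p) - φ₀ (aeval y p) := fun p φ => by
      have e : (φ₀ : Y.K →+* AlgebraicClosure (RatFunc k)).comp (algebraMap k Y.K) =
          (φ : Y.K →+* AlgebraicClosure (RatFunc k)).comp (algebraMap k Y.K) := by
        ext c
        simp only [RingHom.comp_apply, RingHom.coe_coe,
          IsScalarTower.algebraMap_apply k (RatFunc k) Y.K, AlgHom.commutes]
      rw [Polynomial.map_sub, Polynomial.map_map, e, map_C, eval_sub, eval_C, eval_map,
        aeval_def, hom_eval₂]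
      congr 1
      · exact (hom_eval₂ p (algebraMap k Y.K) (φ : Y.K →+* AlgebraicClosure (RatFunc k)) y).symm
      · exact (hom_eval₂ p (algebraMap k Y.K) (φ₀ : Y.K →+* AlgebraicClosure (RatFunc k)) y).symm
    have hprod : ∀ q : (AlgebraicClosure (RatFunc k))[X], (∀ φ ∈ S, q.eval (φ y) = 0) →
        ∏ φ ∈ S, (X - C (φ y)) ∣ q := fun q hq =>
      Finset.prod_dvd_of_coprime (fun φ _ ψ _ hne =>
        pairwise_coprime_X_sub_C (s := fun φ : Y.Sheets => φ y)
          (fun _ _ e => h.algHom_ext e) hne) fun φ hφ => dvd_iff_isRoot.2 (hq φ hφ)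
    have hm : ((g.map (algebraMap k Y.K) - C (aeval y g)).map
        (φ₀ : Y.K →+* AlgebraicClosure (RatFunc k))).Monic :=
      ((hgm.map _).sub_of_left (degree_C_le.trans_lt (by
        rw [degree_map, ← natDegree_pos_iff_degree_pos, hgdeg]; exact hpos))).map _
    rw [eq_of_monic_of_dvd_of_natDegree_le (monic_prod_X_sub_C _ _) hm
      (hprod _ fun φ hφ => by rw [heval, hgy φ hφ, sub_self]) (by
        rw [natDegree_map, natDegree_sub_C, natDegree_map, natDegree_finsetProd_X_sub_C_eq_card,
          hgdeg])]
    refine hprod _ fun φ _ => ?_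
    rw [heval, ← h.covering_eq, covering, AlgHom.commutes, AlgHom.commutes, sub_self]
  -- As `y` is transcendental, the divisibility holds with an indeterminate in place of `y`, which
  -- may then be specialized to any `η`.
  have hdvd2 : g.map C - C g ∣ F.map C - C F := by
    have hm : (g.map C - C g).Monic := (hgm.map C).sub_of_left (degree_C_le.trans_lt (by
      rw [degree_map, ← natDegree_pos_iff_degree_pos, hgdeg]; exact hpos))
    rw [← map_dvd_map ((aeval y : k[X] →ₐ[k] Y.K) : k[X] →+* Y.K) h.generates.aeval_injective hm]
    have hmap : ∀ p : k[X], (p.map C - C p).map ((aeval y : k[X] →ₐ[k] Y.K) : k[X] →+* Y.K) =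
        p.map (algebraMap k Y.K) - C (aeval y p) := fun p => by
      rw [Polynomial.map_sub, map_C, Polynomial.map_map]
      congr 2
      ext c
      simp
    rw [hmap, hmap]
    exact hdvd
  obtain ⟨f, hf⟩ := exists_eq_comp_of_dvd (g := g) (by omega) _ F (Nat.lt_succ_self _) (by
    convert Set.finite_empty
    refine Set.eq_empty_iff_forall_notMem.2 fun η hη => hη ?_
    have := Polynomial.map_dvd (evalRingHom η) hdvd2
    have hmap : ∀ p : k[X], (p.map C - C p).map (evalRingHom η) = p - C (p.eval η) := fun p => by
      rw [Polynomial.map_sub, map_C, Polynomial.map_map]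
      have e : (evalRingHom η).comp C = RingHom.id k := by
        ext c
        simp
      rw [e, Polynomial.map_id]
      rfl
    rwa [hmap, hmap] at this)
  exact ⟨f, g, hf, hgdeg.trans hcard⟩

end IsPolynomialCover

end CurveCover

/-! ### Decompositions of polynomials with few critical points. -/

section Composition

variable {k : Type u} [Field k] [CharZero k] [IsAlgClosed k]

/-- A polynomial vanishing at all of its critical points is a power of a linear polynomial. -/
theorem exists_eq_C_mul_pow_of_derivative {f : k[X]} (hf : 0 < f.natDegree)
    (h : ∀ c, f.derivative.eval c = 0 → f.eval c = 0) :
    ∃ γ c : k, γ ≠ 0 ∧ f = C γ * (X - C c) ^ f.natDegree := by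
  classical
  have hf0 : f ≠ 0 := fun h0 => by simp [h0] at hf
  have hd : f.derivative.natDegree + 1 = f.natDegree := by
    rw [natDegree_derivative, Nat.sub_add_cancel hf]
  have hd0 : f.derivative ≠ 0 := fun h0 => by
    have h1 := derivative_eq_zero.1 h0
    omega
  have h1 : ∑ c ∈ f.roots.toFinset, f.derivative.rootMultiplicity c = f.derivative.natDegree := by
    rw [← Semicubical.sum_rootMultiplicity f.derivative]
    symm
    refine Finset.sum_subset (fun c hc => ?_) fun c _ hc => ?_
    · rw [Multiset.mem_toFinset, mem_roots hd0] at hc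
      rw [Multiset.mem_toFinset, mem_roots hf0]
      exact h c hc
    · rw [Multiset.mem_toFinset, mem_roots hd0] at hc
      exact rootMultiplicity_eq_zero hc
  have h2 : ∑ c ∈ f.roots.toFinset, (f.derivative.rootMultiplicity c + 1) = f.natDegree := by
    rw [← Semicubical.sum_rootMultiplicity f]
    refine Finset.sum_congr rfl fun c hc => ?_
    rw [Multiset.mem_toFinset, mem_roots hf0] at hc
    have := (rootMultiplicity_pos hf0).2 hc
    rw [derivative_rootMultiplicity_of_root hc, Nat.sub_add_cancel this]
  -- All roots of `f'` are roots of `f`, so `deg f` is `deg f'` plus the number of distinct roots of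
  -- `f`; that number is one.
  rw [Finset.sum_add_distrib, h1, Finset.sum_const, smul_eq_mul, mul_one] at h2
  obtain ⟨c, hc⟩ := Finset.card_eq_one.1 (by omega : f.roots.toFinset.card = 1)
  have h3 := Semicubical.sum_rootMultiplicity f
  rw [hc, Finset.sum_singleton] at h3
  obtain ⟨q, hq⟩ := h3 ▸ pow_rootMultiplicity_dvd f c
  have hq0 : q ≠ 0 := by rintro rfl; exact hf0 (by simpa using hq)
  have h4 := congrArg natDegree hq
  rw [natDegree_mul (pow_ne_zero _ (X_sub_C_ne_zero c)) hq0, natDegree_pow, natDegree_X_sub_C,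
    mul_one] at h4
  obtain ⟨γ, rfl⟩ := natDegree_eq_zero.1 (by omega : q.natDegree = 0)
  exact ⟨γ, c, by simpa using hq0, by rw [mul_comm]; exact hq⟩

/-- A polynomial whose critical points outside the zero fibre are a triple and a double point
in different fibres is a composition only if it is a power. -/
theorem exists_eq_C_mul_pow_of_comp {F f g : k[X]} (hF : F = f.comp g) (hf : 0 < f.natDegree)
    (hg : 2 ≤ g.natDegree) {x w : k} (hxw : F.eval x ≠ F.eval w)
    (h : ∀ c τ, τ ≠ 0 → F.eval c = τ →
      (F - C τ).rootMultiplicity c ≤ 3 ∧ (c ≠ x → c ≠ w → (F - C τ).rootMultiplicity c ≤ 1)) :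
    ∃ (γ : k) (p : k[X]), γ ≠ 0 ∧ F = C γ * p ^ f.natDegree := by
  obtain ⟨γ, c, hγ, hfc⟩ := exists_eq_C_mul_pow_of_derivative hf fun ζ hζ => by
    classical
    by_contra hτ
    set τ := f.eval ζ with hτe
    have hf0 : f - C τ ≠ 0 := fun h0 => by
      rw [sub_eq_zero.1 h0, natDegree_C] at hf
      omega
    have h1 : (X - C ζ) ^ 2 ∣ f - C τ := by
      have h2 : 1 < (f - C τ).rootMultiplicity ζ := by
        rw [one_lt_rootMultiplicity_iff_isRoot hf0]
        exact ⟨by simp [τ], by simpa using hζ⟩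
      exact (pow_dvd_pow _ h2).trans (pow_rootMultiplicity_dvd _ _)
    have hG : (g - C ζ).natDegree = g.natDegree := natDegree_sub_C
    have hG0 : g - C ζ ≠ 0 := fun h0 => by rw [h0, natDegree_zero] at hG; omega
    have h2 : (g - C ζ) ^ 2 ∣ F - C τ := by
      obtain ⟨q, hq⟩ := h1
      refine ⟨q.comp g, ?_⟩
      have := congrArg (comp · g) hq
      simpa [← hF] using this
    have hFt : F - C τ ≠ 0 := fun h0 => by
      have h3 := congrArg natDegree hF
      rw [natDegree_comp, sub_eq_zero.1 h0, natDegree_C] at h3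
      exact absurd h3.symm (Nat.mul_pos hf (by omega)).ne'
    -- A critical point `ζ` of `f` makes `(g - ζ)²` divide `F - τ`, so every point of `g` over `ζ`
    -- is multiple for `F`.
    have hrm : ∀ c, 2 * (g - C ζ).rootMultiplicity c ≤ (F - C τ).rootMultiplicity c := fun c => by
      rw [le_rootMultiplicity_iff hFt, mul_comm, pow_mul]
      exact (pow_dvd_pow_of_dvd (pow_rootMultiplicity_dvd _ _) 2).trans h2
    have hev : ∀ c ∈ (g - C ζ).roots.toFinset, F.eval c = τ ∧
        0 < (g - C ζ).rootMultiplicity c := fun c hc => by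
      rw [Multiset.mem_toFinset] at hc
      have hc' := (mem_roots hG0).1 hc
      refine ⟨?_, (rootMultiplicity_pos hG0).2 hc'⟩
      have : g.eval c = ζ := by simpa [sub_eq_zero] using hc'
      rw [hF, eval_comp, this]
    have hsub : ∀ c ∈ (g - C ζ).roots.toFinset, c = x ∨ c = w := fun c hc => by
      by_contra hn
      rw [not_or] at hn
      have := (h c τ hτ (hev c hc).1).2 hn.1 hn.2
      have := hrm c
      have := (hev c hc).2
      omega
    have hsum := Semicubical.sum_rootMultiplicity (g - C ζ)
    -- Multiple points off the zero fibre are `x` or `w`, which lie in different fibres of `F`. So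
    -- `g` has at most one point over `ζ`, of multiplicity at most `1` because `2 m ≤ 3`, which
    -- contradicts `deg g ≥ 2`.
    have hcard : (g - C ζ).roots.toFinset.card ≤ 1 := Finset.card_le_one.2 fun c hc c' hc' => by
      have e := (hev c hc).1.trans (hev c' hc').1.symm
      rcases hsub c hc with rfl | rfl <;> rcases hsub c' hc' with rfl | rfl
      · rfl
      · exact absurd e hxw
      · exact absurd e.symm hxw
      · rfl
    have hle : ∑ c ∈ (g - C ζ).roots.toFinset, (g - C ζ).rootMultiplicity c ≤
        (g - C ζ).roots.toFinset.card • 1 := Finset.sum_le_card_nsmul _ _ _ fun c hc => by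
      have := (h c τ hτ (hev c hc).1).1
      have := hrm c
      omega
    rw [hsum, hG, smul_eq_mul, mul_one] at hle
    omega
  refine ⟨γ, g - C c, hγ, ?_⟩
  have := congrArg (comp · g) hfc
  simpa [← hF] using this

omit [CharZero k] [IsAlgClosed k] in
/-- The ramification indices over zero of a power are divisible by the exponent. -/
theorem dvd_rootMultiplicity_C_mul_pow {γ : k} (hγ : γ ≠ 0) (p : k[X]) (m : ℕ) (c : k) :
    m ∣ (C γ * p ^ m).rootMultiplicity c := by
  classical
  rw [← count_roots, roots_C_mul _ hγ, roots_pow, Multiset.count_nsmul]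
  exact dvd_mul_right _ _

end Composition

namespace Semicubical

variable {k : Type u} [Field k] [CharZero k] [IsAlgClosed k] {a b d : ℕ}

open Classical in
theorem IsNormalForm.natDegree_eq_one_of_comp (ha : 0 < a) (hb : 0 < b) (hd : 0 < d)
    (hgcd : Nat.gcd a (Nat.gcd b d) = 1) {v x : k} (hv1 : v ≠ 1) {F f g : k[X]}
    (hN : IsNormalForm a b d v x F) (h0 : ((F - C 0).roots.toFinset.val.map fun c =>
      (F - C 0).rootMultiplicity c) = {a, b, d, d}) (hF : F = f.comp g) (hf : 0 < f.natDegree)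
    (hg : 2 ≤ g.natDegree) : f.natDegree = 1 := by
  classical
  obtain ⟨γ, w, p, q, hFn, hs, h1, hw⟩ := hN
  have hxw : F.eval x ≠ F.eval w := by rw [h1, hw]; exact hv1.symm
  obtain ⟨γ', P, hγ', hP⟩ := exists_eq_C_mul_pow_of_comp hF hf hg hxw fun c τ hτ hc => by
    have := rootMultiplicity_normalForm_sub ha hb hd hs (fun e => hxw (by rw [e])) hτ
      (by rw [← hFn]; exact hc)
    rw [hFn, this]
    refine ⟨by split_ifs <;> omega, fun e1 e2 => by rw [if_neg e1, if_neg e2]⟩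
  have key : ∀ e ∈ ({a, b, d, d} : Multiset ℕ), f.natDegree ∣ e := fun e he => by
    rw [← h0, Multiset.mem_map] at he
    obtain ⟨c, -, rfl⟩ := he
    rw [C_0, sub_zero, hP]
    exact dvd_rootMultiplicity_C_mul_pow hγ' P _ c
  have := Nat.dvd_gcd (key a (by simp)) (Nat.dvd_gcd (key b (by simp)) (key d (by simp)))
  rw [hgcd] at this
  exact Nat.dvd_one.1 this

end Semicubical

/-! ### Inertia in a Galois cover and its action on the fibre. -/

namespace CurveCover

variable {k : Type u} [Field k] {Y : CurveCover k}

theorem covering_sub_const_eq (c : k) :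
    Y.covering - Y.const c = aeval Y.covering (X - C c) := by
  rw [map_sub, aeval_X, aeval_C, algebraMap_eq_const]

variable (Y) in
theorem exists_takesValue_covering (τ : k) :
    ∃ P : Y.Point, P.TakesValue Y.covering (τ : OnePoint k) := by
  have hinj := transcendental_iff_injective.1 Y.transcendental_covering
  have hne : Y.covering - Y.const τ ≠ 0 := by
    rw [covering_sub_const_eq, Ne, map_eq_zero_iff _ hinj]
    exact X_sub_C_ne_zero τ
  obtain ⟨P, -, h⟩ := Y.exists_point hne (Algebra.adjoin k {Y.covering})
    (sub_mem (Algebra.self_mem_adjoin_singleton k _) ((Algebra.adjoin k _).algebraMap_mem τ)) (by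
      intro h
      rw [Algebra.adjoin_singleton_eq_range_aeval] at h
      obtain ⟨p, hp⟩ := h
      have h3 : aeval Y.covering p = (Y.covering - Y.const τ)⁻¹ := hp
      have h2 : aeval Y.covering ((X - C τ) * p) = aeval Y.covering (1 : k[X]) := by
        rw [map_mul, h3, ← covering_sub_const_eq, mul_inv_cancel₀ hne, map_one]
      have := congrArg (eval τ) (hinj h2)
      simp at this)
  exact ⟨P, h⟩

namespace Point

/-- In a Galois cover, the inertia group of a point is nontrivial if the local parameter of the
base vanishes twice. -/
theorem exists_inertia [CharZero k] [IsGalois (RatFunc k) Y.K] {P : Y.Point} {τ : k}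
    (hP : P.TakesValue Y.covering (τ : OnePoint k)) {f u : Y.K} (hf : IsIntegral k[X] f)
    (hu : IsIntegral k[X] u) (hfP : P.ring.valuation f < 1)
    (h : Y.covering - Y.const τ = f ^ 2 * u) :
    ∃ g : Y.K ≃ₐ[RatFunc k] Y.K, g ≠ 1 ∧
      ∀ z, IsIntegral k[X] z → P.ring.valuation (g z - z) < 1 := by
  have hlo := center_liesOver hP
  have hirr := irreducible_X_sub_C τ
  have : (Ideal.span {X - C τ} : Ideal k[X]).IsMaximal :=
    PrincipalIdealRing.isMaximal_of_irreducible hirr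
  let : MulSemiringAction (Y.K ≃ₐ[RatFunc k] Y.K) Y.integers :=
    IsIntegralClosure.MulSemiringAction k[X] (RatFunc k) Y.K Y.integers
  have hG : IsGaloisGroup (Y.K ≃ₐ[RatFunc k] Y.K) k[X] Y.integers :=
    IsGaloisGroup.of_isFractionRing _ k[X] Y.integers (RatFunc k) Y.K
  have : CharZero (Ideal.span {X - C τ} : Ideal k[X]).ResidueField :=
    charZero_of_injective_algebraMap
      (algebraMap k (Ideal.span {X - C τ} : Ideal k[X]).ResidueField).injective
  have hcard := Ideal.card_inertia_eq_ramificationIdxIn (G := Y.K ≃ₐ[RatFunc k] Y.K)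
    (Ideal.span {X - C τ} : Ideal k[X]) (center hP.mem)
  rw [Ideal.ramificationIdxIn_eq_ramificationIdx (Ideal.span {X - C τ} : Ideal k[X])
    (center hP.mem) (Y.K ≃ₐ[RatFunc k] Y.K)] at hcard
  -- `t - τ = f² u` lies in the square of the center, so the ramification index is not `1`; it is
  -- the order of the inertia group.
  have hmap : (Ideal.span {X - C τ} : Ideal k[X]).map (algebraMap k[X] Y.integers) ≤
      center hP.mem ^ 2 := by
    rw [Ideal.map_span, Set.image_singleton, Ideal.span_singleton_le_iff_mem]
    have e : algebraMap k[X] Y.integers (X - C τ) = ⟨f, hf⟩ ^ 2 * ⟨u, hu⟩ := by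
      apply Subtype.ext
      change algebraMap k[X] Y.K (X - C τ) = f ^ 2 * u
      rw [← h, algebraMap_polynomial, covering_sub_const_eq]
    rw [e]
    exact Ideal.mul_mem_right _ _ (Ideal.pow_mem_pow ((mem_center hP.mem).2 hfP) 2)
  have hne : (Ideal.span {X - C τ} : Ideal k[X]) ≠ ⊥ := by
    rw [Ne, Ideal.span_singleton_eq_bot]
    exact hirr.ne_zero
  have hram : Ideal.ramificationIdx (center hP.mem) k[X] ≠ 1 := by
    rw [← Ideal.ramificationIdx'_eq_ramificationIdx (Ideal.span {X - C τ} : Ideal k[X])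
      (center hP.mem) hne,
      Ideal.ramificationIdx'_ne_one_iff (hmap.trans (Ideal.pow_le_self two_ne_zero))]
    exact hmap
  rw [← hcard, Ne, Subgroup.card_eq_one, Subgroup.eq_bot_iff_forall] at hram
  push Not at hram
  obtain ⟨g, hg, hg1⟩ := hram
  refine ⟨g, hg1, fun z hz => ?_⟩
  have h1 : P.ring.valuation ((g • (⟨z, hz⟩ : Y.integers) - ⟨z, hz⟩ : Y.integers) : Y.K) < 1 :=
    (mem_center hP.mem).1 (hg ⟨z, hz⟩)
  have h2 : ((g • (⟨z, hz⟩ : Y.integers) : Y.integers) : Y.K) = g z :=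
    algebraMap_galRestrict_apply k[X] g (⟨z, hz⟩ : Y.integers)
  rwa [Subalgebra.coe_sub, h2] at h1

end Point

end CurveCover

namespace CurveCover

variable {k : Type u} [Field k] {Y Z : CurveCover k} {P : Z.Point}

namespace Point

theorem takesValue_const (c : k) : P.TakesValue (Z.const c) (c : OnePoint k) := by
  simp [takesValue_coe]

theorem TakesValue.sub {f g : Z.K} {c d : k} (hf : P.TakesValue f (c : OnePoint k))
    (hg : P.TakesValue g (d : OnePoint k)) :
    P.TakesValue (f - g) ((c - d : k) : OnePoint k) := by
  rw [takesValue_coe, const_sub, sub_sub_sub_comm]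
  exact (P.ring.valuation.map_sub _ _).trans_lt (max_lt hf hg)

theorem TakesValue.mul {f g : Z.K} {c d : k} (hf : P.TakesValue f (c : OnePoint k))
    (hg : P.TakesValue g (d : OnePoint k)) :
    P.TakesValue (f * g) ((c * d : k) : OnePoint k) := by
  have h1 : f * g - Z.const (c * d) = (f - Z.const c) * g + Z.const c * (g - Z.const d) := by
    rw [← algebraMap_eq_const, ← algebraMap_eq_const, ← algebraMap_eq_const, map_mul]
    ring
  rw [takesValue_coe, h1]
  refine (P.ring.valuation.map_add _ _).trans_lt (max_lt ?_ ?_)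
  · rw [map_mul]; exact mul_lt_one_of_lt_of_le hf hg.mem
  · rw [map_mul, mul_comm]; exact mul_lt_one_of_lt_of_le hg (P.valuation_const_le c)

theorem TakesValue.prod {ι : Type*} (s : Finset ι) {f : ι → Z.K} {c : ι → k}
    (h : ∀ i ∈ s, P.TakesValue (f i) (c i : OnePoint k)) :
    P.TakesValue (∏ i ∈ s, f i) ((∏ i ∈ s, c i : k) : OnePoint k) := by
  classical
  induction s using Finset.induction_on with
  | empty => simpa using P.takesValue_const 1
  | insert i s hi ih =>
    rw [Finset.prod_insert hi, Finset.prod_insert hi]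
    exact (h i (Finset.mem_insert_self i s)).mul
      (ih fun j hj => h j (Finset.mem_insert_of_mem hj))

end Point

namespace IsPolynomialCover

variable {y : Y.K} {F : k[X]} (h : Y.IsPolynomialCover y F)
include h

theorem aeval_conj_sub (ψ : Y.K →ₐ[RatFunc k] Z.K) (τ : k) :
    aeval (ψ y) (F - C τ) = Z.covering - Z.const τ := by
  have h1 : ψ (aeval y (F - C τ)) = aeval (ψ y) (F - C τ) :=
    (aeval_algHom_apply (ψ.restrictScalars k) y (F - C τ)).symm
  rw [← h1, ← h.covering_sub_const, map_sub, covering, const, AlgHom.commutes, AlgHom.commutes]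
  rfl

theorem isIntegral_conj (ψ : Y.K →ₐ[RatFunc k] Z.K) : IsIntegral k[X] (ψ y) := by
  have := h.isIntegral.map (ψ.restrictScalars k[X])
  exact this

theorem isIntegral_aeval_conj (ψ : Y.K →ₐ[RatFunc k] Z.K) (p : k[X]) :
    IsIntegral k[X] (aeval (ψ y) p) := by
  induction p using Polynomial.induction_on' with
  | add p q hp hq => rw [map_add]; exact hp.add hq
  | monomial n c =>
    rw [aeval_monomial, IsScalarTower.algebraMap_apply k k[X] Z.K]
    exact isIntegral_algebraMap.mul ((h.isIntegral_conj ψ).pow n)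

/-- The factorisation of the polynomial of the cover, in a cover which contains all conjugates. -/
theorem const_sub_covering_eq_prod {ι : Type*} [Fintype ι] {ψ : ι → (Y.K →ₐ[RatFunc k] Z.K)}
    (hψ : Function.Injective ψ) (hcard : Fintype.card ι = F.natDegree) (η : k) :
    Z.const (F.eval η) - Z.covering =
      Z.const F.leadingCoeff * ∏ i, (Z.const η - ψ i y) := by
  classical
  set q : Z.K[X] := F.map (algebraMap k Z.K) - C Z.covering with hq
  have hdeg : q.natDegree = F.natDegree := by rw [natDegree_sub_C, natDegree_map]
  have hq0 : q ≠ 0 := fun h0 => by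
    rw [h0, natDegree_zero] at hdeg
    exact h.natDegree_pos.ne hdeg
  have hlc : q.leadingCoeff = Z.const F.leadingCoeff := by
    rw [hq, leadingCoeff_sub_of_degree_lt, leadingCoeff_map, algebraMap_eq_const]
    refine degree_C_le.trans_lt ?_
    rw [degree_map]
    exact natDegree_pos_iff_degree_pos.1 h.natDegree_pos
  have hroot : ∀ i, ψ i y ∈ q.roots := fun i => by
    have h1 := h.aeval_conj_sub (ψ i) 0
    rw [C_0, sub_zero, const_zero, sub_zero] at h1
    rw [mem_roots hq0, IsRoot.def, hq, eval_sub, eval_C, eval_map, ← aeval_def, h1, sub_self]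
  have hinj : Function.Injective fun i => ψ i y := fun i j hij => hψ (h.algHom_ext hij)
  have hroots : Finset.univ.val.map (fun i => ψ i y) = q.roots := by
    -- The conjugates are distinct roots and as many as the degree.
    refine Multiset.eq_of_le_of_card_le
      ((Multiset.le_iff_subset (Finset.univ.nodup.map hinj)).2 fun z hz => ?_) ?_
    · obtain ⟨i, -, rfl⟩ := Multiset.mem_map.1 hz
      exact hroot i
    · rw [Multiset.card_map, Finset.card_val, Finset.card_univ, hcard, ← hdeg]
      exact card_roots' q
  have h1 := C_leadingCoeff_mul_prod_multiset_X_sub_C (p := q) (by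
    rw [← hroots, Multiset.card_map, Finset.card_val, Finset.card_univ, hcard, hdeg])
  rw [← hroots, Multiset.map_map, hlc] at h1
  have h2 := congrArg (eval (Z.const η)) h1
  rw [eval_mul, eval_C] at h2
  have h3 : q.eval (Z.const η) = Z.const (F.eval η) - Z.covering := by
    rw [hq, eval_sub, eval_C, eval_map, ← algebraMap_eq_const, ← algebraMap_eq_const,
      eval₂_at_apply]
  rw [h3] at h2
  rw [← h2]
  congr 1
  change eval (Z.const η) (∏ i, (X - C (ψ i y))) = ∏ i, (Z.const η - ψ i y)
  rw [eval_prod]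
  simp

/-- The values of the conjugates of the coordinate at a point over `τ` are the points of the
fibre over `τ`. -/
theorem exists_takesValue_conj [IsAlgClosed k] {ι : Type*} [Fintype ι]
    {ψ : ι → (Y.K →ₐ[RatFunc k] Z.K)} (hψ : Function.Injective ψ)
    (hcard : Fintype.card ι = F.natDegree) {τ : k}
    (hP : P.TakesValue Z.covering (τ : OnePoint k)) :
    ∃ c : ι → k, (∀ i, P.TakesValue (ψ i y) (c i : OnePoint k)) ∧
      (F - C τ).roots = Finset.univ.val.map c := by
  choose c hc using fun i => P.exists_takesValue_of_eval (h.sub_C_ne_zero τ) (f := ψ i y) (by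
    rw [h.aeval_conj_sub]; exact hP)
  refine ⟨c, hc, ?_⟩
  have h1 : F - C τ = C F.leadingCoeff * ∏ i, (X - C (c i)) := by
    -- Taking values at `P` in the factorization over the Galois cover, for each constant `η`.
    refine Polynomial.funext fun η => ?_
    have h2 := ((P.takesValue_const (F.eval η)).sub hP).unique
      (h.const_sub_covering_eq_prod hψ hcard η ▸ (P.takesValue_const F.leadingCoeff).mul
        (Point.TakesValue.prod Finset.univ fun i _ => (P.takesValue_const η).sub (hc i)))
    rw [eval_sub, eval_C, OnePoint.coe_injective h2, eval_mul, eval_C, eval_prod]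
    simp
  rw [h1, roots_C_mul _ (leadingCoeff_ne_zero.2 h.ne_zero)]
  have h3 := roots_multiset_prod_X_sub_C (Finset.univ.val.map c)
  rwa [Multiset.map_map] at h3

/-- Over a multiple point of the fibre over `τ`, there is a nontrivial automorphism of a Galois
cover containing all conjugates which preserves the points of the fibre. -/
theorem exists_automorphism [CharZero k] [IsAlgClosed k] [IsGalois (RatFunc k) Z.K] {ι : Type*}
    [Fintype ι] {ψ : ι → (Y.K →ₐ[RatFunc k] Z.K)} (hψ : Function.Injective ψ)
    (hcard : Fintype.card ι = F.natDegree) {τ w : k} (hw : 2 ≤ (F - C τ).rootMultiplicity w) :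
    ∃ (g : Z.K ≃ₐ[RatFunc k] Z.K) (c : ι → k), g ≠ 1 ∧
      (F - C τ).roots = Finset.univ.val.map c ∧ ∀ i j, ψ j y = g (ψ i y) → c j = c i := by
  classical
  obtain ⟨P, hP⟩ := Z.exists_takesValue_covering τ
  obtain ⟨c, hc, hroots⟩ := h.exists_takesValue_conj hψ hcard hP
  obtain ⟨i, -, hi⟩ : ∃ i ∈ Finset.univ.val, c i = w := by
    rw [← Multiset.mem_map, ← hroots, ← Multiset.count_pos, count_roots]
    omega
  -- Substituting the conjugate of `y` with value `w` at `P` turns `F - τ = (X - w)² r` into a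
  -- factorization of `t - τ` with a square vanishing at `P`.
  obtain ⟨r, hr⟩ := (pow_dvd_pow _ hw).trans (pow_rootMultiplicity_dvd (F - C τ) w)
  obtain ⟨g, hg, hgP⟩ := Point.exists_inertia hP
    (f := aeval (ψ i y) (X - C w)) (u := aeval (ψ i y) r) (h.isIntegral_aeval_conj _ _)
    (h.isIntegral_aeval_conj _ _) (by
      rw [map_sub, aeval_X, aeval_C, algebraMap_eq_const, ← hi]; exact hc i) (by
      rw [← h.aeval_conj_sub (ψ i), hr, map_mul, map_pow])
  refine ⟨g, c, hg, hroots, fun i j hij => ?_⟩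
  have h2 := hc j
  rw [hij, Point.takesValue_coe] at h2
  refine (OnePoint.coe_injective (Point.TakesValue.unique (hc i) ?_)).symm
  rw [Point.takesValue_coe, ← sub_sub_sub_cancel_left _ _ (g (ψ i y))]
  exact (P.ring.valuation.map_sub _ _).trans_lt (max_lt h2 (hgP _ (h.isIntegral_conj _)))

end IsPolynomialCover

end CurveCover

/-! ### The Galois closure and transpositions. -/

namespace CurveCover

variable {k : Type u} [Field k] {Y : CurveCover k}

variable (Y) in
/-- The Galois closure of a cover. -/
noncomputable abbrev galoisClosure : CurveCover k where
  K := IntermediateField.normalClosure (RatFunc k) Y.K (AlgebraicClosure (RatFunc k))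

variable (Y) in
/-- The embeddings of the function field into its Galois closure correspond to the sheets. -/
noncomputable def conj : Y.Sheets ≃ (Y.K →ₐ[RatFunc k] Y.galoisClosure.K) :=
  (normalClosure.algHomEquiv (RatFunc k) Y.K (AlgebraicClosure (RatFunc k))).symm

/-- Automorphisms of the Galois closure act faithfully on the sheets, through the monodromy
group. -/
theorem exists_monodromy_conj (g : Y.galoisClosure.K ≃ₐ[RatFunc k] Y.galoisClosure.K)
    (hg : g ≠ 1) : ∃ σ ∈ Y.monodromy.range, σ ≠ 1 ∧
      ∀ φ z, Y.conj (σ φ) z = g (Y.conj φ z) := by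
  set G := g.liftNormal (AlgebraicClosure (RatFunc k)) with hG
  have hconj : ∀ φ z, Y.conj (Y.monodromy G φ) z = g (Y.conj φ z) := fun φ z =>
    Subtype.ext (g.liftNormal_commutes (AlgebraicClosure (RatFunc k)) (Y.conj φ z))
  refine ⟨Y.monodromy G, ⟨G, rfl⟩, fun h1 => hg ?_, hconj⟩
  -- If the lift acted trivially on the sheets, it would fix all images of the function field, hence
  -- the field they generate, and `g` would be trivial.
  have h2 : IntermediateField.normalClosure (RatFunc k) Y.K (AlgebraicClosure (RatFunc k)) ≤
      IntermediateField.fixedField (Subgroup.zpowers G) := by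
    refine iSup_le fun φ => ?_
    rintro _ ⟨z, rfl⟩ ⟨σ, hσ⟩
    obtain ⟨n, rfl⟩ := Subgroup.mem_zpowers_iff.1 hσ
    change Y.monodromy (G ^ n) φ z = φ z
    rw [map_zpow, h1, one_zpow]
    rfl
  refine AlgEquiv.ext fun z => Subtype.ext ?_
  have h3 : G z = z := h2 z.2 ⟨G, Subgroup.mem_zpowers G⟩
  exact (g.liftNormal_commutes (AlgebraicClosure (RatFunc k)) z).symm.trans h3

namespace IsPolynomialCover

variable {y : Y.K} {F : k[X]}

open Classical in
/-- A simple branch point gives a transposition in the monodromy group. -/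
theorem exists_isSwap [CharZero k] [IsAlgClosed k] (h : Y.IsPolynomialCover y F) {τ w : k}
    (hw : (F - C τ).rootMultiplicity w = 2)
    (h1 : ∀ c, c ≠ w → (F - C τ).rootMultiplicity c ≤ 1) :
    ∃ σ ∈ Y.monodromy.range, σ.IsSwap := by
  obtain ⟨g, c, hg, hroots, hgc⟩ := h.exists_automorphism (Z := Y.galoisClosure)
    Y.conj.injective (card_sheets.trans h.degree_eq) hw.ge
  have hcount : ∀ e, (Finset.univ.filter fun φ => c φ = e).card =
      (F - C τ).rootMultiplicity e := fun e => by
    rw [← count_roots, hroots, Multiset.count_map]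
    simp only [eq_comm]
    rfl
  obtain ⟨σ, hσ, hσ1, hσg⟩ := exists_monodromy_conj g hg
  have hcσ : ∀ φ, c (σ φ) = c φ := fun φ => hgc φ (σ φ) (hσg φ y)
  refine ⟨σ, hσ, Equiv.Perm.card_support_eq_two.1 (le_antisymm ?_
    (Equiv.Perm.one_lt_card_support_of_ne_one hσ1))⟩
  rw [← hw, ← hcount]
  -- `σ` preserves the values `c`, and every value other than `w` is taken on at most one sheet; so
  -- `σ` moves only the two sheets with value `w`.
  refine Finset.card_le_card fun φ hφ => ?_
  rw [Equiv.Perm.mem_support] at hφ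
  rw [Finset.mem_filter]
  refine ⟨Finset.mem_univ _, ?_⟩
  by_contra hne
  refine hφ (Finset.card_le_one.1 ((hcount (c φ)).trans_le (h1 _ hne)) _ ?_ _ ?_)
  · simp [hcσ]
  · simp

end IsPolynomialCover

end CurveCover

/-! ### The full symmetric group and the theorem. -/

namespace Semicubical

open CurveCover

variable {k : Type u} [Field k] [CharZero k] [IsAlgClosed k] {a b d : ℕ}

omit [IsAlgClosed k] in
theorem IsNormalForm.exists_rootMultiplicity (ha : 0 < a) (hb : 0 < b) (hd : 0 < d) {v x : k}
    (hv0 : v ≠ 0) (hv1 : v ≠ 1) {F : k[X]} (hN : IsNormalForm a b d v x F) :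
    ∃ w, (F - C v).rootMultiplicity w = 2 ∧
      ∀ c, c ≠ w → (F - C v).rootMultiplicity c ≤ 1 := by
  classical
  obtain ⟨γ, w, p, q, rfl, hs, h1, hw⟩ := hN
  have hxv : ∀ {c : k}, (normalForm a b d γ p q).eval c = v → c ≠ x := by
    rintro c hc rfl
    exact hv1 (hc.symm.trans h1)
  have hrm := fun {c : k} hc =>
    rootMultiplicity_normalForm_sub ha hb hd hs (hxv hw).symm hv0 (c := c) (γ := γ) hc
  refine ⟨w, by rw [hrm hw, if_neg (hxv hw), if_pos rfl], fun c hc => ?_⟩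
  by_cases hcv : (normalForm a b d γ p q).eval c = v
  · rw [hrm hcv, if_neg (hxv hcv), if_neg hc]
  · rw [rootMultiplicity_eq_zero]
    · exact zero_le_one
    · rw [IsRoot.def, eval_sub, eval_C, sub_eq_zero]
      exact hcv

/-- If `gcd(a, b, d) = 1`, then the covers in normal form have the full symmetric group as
monodromy group. -/
theorem IsNormalForm.hasSymmetricMonodromy (ha : 0 < a) (hb : 0 < b) (hd : 0 < d)
    (hgcd : Nat.gcd a (Nat.gcd b d) = 1) {v x : k} (hv0 : v ≠ 0) (hv1 : v ≠ 1)
    {Y : CurveCover k} {y : Y.K} {F : k[X]} (hN : IsNormalForm a b d v x F)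
    (hF : Y.IsPolynomialCover y F) (h0 : Y.HasRamification ((0 : k) : OnePoint k) {a, b, d, d}) :
    Y.HasSymmetricMonodromy := by
  classical
  obtain ⟨w, hw, hw'⟩ := hN.exists_rootMultiplicity ha hb hd hv0 hv1
  obtain ⟨σ, hσ, hswap⟩ := hF.exists_isSwap hw hw'
  -- Jordan's theorem: a primitive group containing a transposition is the full symmetric group.
  refine Equiv.Perm.subgroup_eq_top_of_isPreprimitive_of_isSwap_mem ?_ σ hswap hσ
  have : MulAction.IsPretransitive Y.monodromy.range Y.Sheets := ⟨fun φ ψ => by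
    obtain ⟨g, hg⟩ := hF.exists_monodromy_eq φ ψ
    exact ⟨⟨Y.monodromy g, g, rfl⟩, hg⟩⟩
  refine ⟨fun {B} hB => ?_⟩
  rw [MulAction.IsTrivialBlock, or_iff_not_imp_left, Set.not_subsingleton_iff]
  intro hB2
  -- A block with at least two sheets gives `F = f ∘ g` with `deg g` the size of the block; `deg f =
  -- 1` then means that the block contains all sheets.
  obtain ⟨f, g, hfg, hg⟩ := hF.exists_comp_of_isBlock hB hB2.nonempty
  have h2 : 2 ≤ g.natDegree := by
    rw [hg]
    exact (Set.one_lt_ncard_iff_nontrivial).2 hB2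
  have hdeg := congrArg natDegree hfg
  rw [natDegree_comp] at hdeg
  have hf : 0 < f.natDegree := Nat.pos_of_ne_zero fun h => by
    rw [h, zero_mul] at hdeg
    exact hF.natDegree_pos.ne' hdeg
  rw [hN.natDegree_eq_one_of_comp ha hb hd hgcd hv1 ((hF.hasRamification 0).unique h0) hfg hf h2,
    one_mul, hg, ← hF.degree_eq, ← card_sheets, ← Nat.card_eq_fintype_card,
    ← Set.ncard_univ] at hdeg
  exact Set.eq_of_subset_of_ncard_le (Set.subset_univ B) hdeg.le

end Semicubical

theorem theorem5p1 (a b d n : ℕ) (ha : 0 < a) (hb : 0 < b) (hd : 0 < d)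
    (hab : a ≠ b) (had : a ≠ d) (hbd : b ≠ d) (hn : n = a + b + 2 * d)
    (x A B C D π : RatFunc ℚ) (hx : x = RatFunc.X)
    (hA : A = -2 * n * x * (a + d) + (a + d) * (a + 2 * d) + n * x ^ 2 * (n - d))
    (hB : B = a * (a + d) - 2 * a * n * x + n * x ^ 2 * (-(d - n)))
    (hC : C = x ^ 2 * (a + b) * (n - d) - 2 * a * x * (n - d) + a * (a + d))
    (hD : D = n * x ^ 2 * (a + b) + a * (a + 2 * d) - 2 * a * n * x)
    (hπ : π = (a ^ a * b ^ b * A ^ (a + d) * B ^ (b + d) * D ^ d) /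
      (2 ^ d * d ^ (2 * d) * n ^ n * x ^ (a + 2 * d) * (1 - x) ^ (b + 2 * d) * C ^ (n - d))) :
    IsHurwitzBelyiMap.{u} (semicubical a b d).branchedCovers π (semicubicalCoordinate a b d) ∧
    (Nat.gcd a (Nat.gcd b d) = 1 →
      IsHurwitzBelyiMap.{u} (semicubical a b d).symmetricCovers π
        (semicubicalCoordinate a b d)) := by
  have h := Semicubical.eq_numer_div_denom hn hx hA hB hC hD hπ
  exact ⟨isHurwitzBelyiMap_of_le ha hb hd hab had hbd h (fun _ _ _ _ hY => hY)
      fun _ _ _ _ _ _ _ _ _ _ _ _ _ hY => hY,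
    fun hgcd => isHurwitzBelyiMap_of_le ha hb hd hab had hbd h (fun _ _ _ _ hY => hY.1)
      fun _ _ _ _ _ hv0 hv1 _ _ _ _ hF hN hY =>
        ⟨hY, hN.hasSymmetricMonodromy ha hb hd hgcd hv0 hv1 hF
          (semicubical_isCoverOfType_iff.1 hY).2.2.1⟩⟩
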